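/- Let $\mathfrak g$ be a finite-dimensional complex semisimple Lie algebra with Cartan subalgebra $\mathfrak h$ and simple roots $\pi=\{\alpha_1,\dots,\alpha_n\}$; write $h_i$ for the simple coroots, $e_i$, $f_i$ for root vectors of weights $\alpha_i$, $-\alpha_i$, $\omega_1,\dots,\omega_n$ for the fundamental weights, $P^+(\pi)=\sum_i\mathbb N\omega_i$ for the set of dominant integral weights, and $w_0$ for the longest element of the Weyl group $W$. Let $\theta$ be an automorphism of order two of $\mathfrak g$ which is maximally split: $\theta(\mathfrak h)=\mathfrak h$; if $\theta(h_i)=h_i$ then $\theta(e_i)=e_i$ and $\theta(f_i)=f_i$; if $\theta(h_i)\ne h_i$ then $\theta(e_i)$ is a root vector for a negative root and $\theta(f_i)$ a root vector for a positive root. Let $\Theta$ be the induced involution of $\mathfrak h^*$, let $\pi_\Theta=\{\alpha_i\in\pi\mid\Theta(\alpha_i)=\alpha_i\}$, let $w_0'$ be the longest element of the subgroup $W(\pi_\Theta)$ of $W$ generated by the simple reflections for $\pi_\Theta$, and put $$P_{Z(\check B)}=\{\mu\in P^+(\pi)\mid \Theta(\mu)=\mu+w_0\mu-w_0'\mu\}.$$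 For $\alpha_i\notin\pi_\Theta$ define $p(i)$ by $\Theta(\alpha_i)\in-\alpha_{p(i)}+\mathbb Z\pi_\Theta$. The Satake diagram of $\theta$ is the Dynkin diagram in which the nodes in $\pi_\Theta$ are black, the others are white, and arrows join the white nodes $i$ and $p(i)$ whenever $p(i)\ne i$. **Proposition 9.1.** Assume that $(\mathfrak g,\mathfrak g^\theta)$ is irreducible, that is, $\mathfrak g\neq 0$ and $\mathfrak g$ has no $\theta$-stable ideals besides $0$ and $\mathfrak g$. Then either $\mathfrak g$ is simple and, for a suitable numbering of the simple roots, the pair occurs in one of 2)–6) below, or the pair is as in 1). The set $P_{Z(\check B)}$ is determined by the following list (simple roots numbered as in Bourbaki). 1. Let $\mathfrak g=\mathfrak g'\oplus\mathfrak g''$ with simple ideals $\mathfrak g',\mathfrak g''$ that are interchanged by $\theta$. Let $\pi'$ be the set of simple roots of $\mathfrak g'$, $P^+(\pi')$ its set of dominant integral weights, and $w_0^1$ the longest element of its Weyl group. The weights of $\mathfrak g''$ are identified with those of $\mathfrak g'$ through $-\Theta$, so that $P^+(\pi)=P^+(\pi')\times P^+(\pi')$, where $(\mu,\nu)$ stands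 for $\mu-\Theta(\nu)$. Then $P_{Z(\check B)}=\{(\mu,-w_0^1\mu)\mid\mu\in P^+(\pi')\}$. 2. If $\mathfrak g$ is of type $B_n$, $C_n$ ($n\ge2$), $E_7$, $E_8$, $F_4$ or $G_2$, then $P_{Z(\check B)}=P^+(\pi)$. 3. $P_{Z(\check B)}=\{\mu\in P^+(\pi)\mid\mu=-w_0\mu\}$ in the following types, none of which has arrows: - AI: $A_n$, $n\ge1$, no black nodes; - AII: $A_n$, $n\ge3$ odd, black nodes $\alpha_1,\alpha_3,\dots,\alpha_n$; - (DI, case 3): $D_n$, $n\ge4$, no black nodes; - (DIII, case 1): $D_n$, $n\ge4$ even, black nodes $\alpha_1,\alpha_3,\dots,\alpha_{n-1}$; - EI: $E_6$, no black nodes; - EIV: $E_6$, black nodes $\alpha_2,\alpha_3,\alpha_4,\alpha_5$. 4. $P_{Z(\check B)}=P^+(\pi)$ in the following types: - AIII: $A_n$, $2\le r\le (n+1)/2$, black nodes $\alpha_i$ with $r+1\le i\le n-r$, and $p(i)=n+1-i$ on the white nodes; - AIV: $A_n$, $n\ge2$, black nodes $\alpha_2,\dots,\alpha_{n-1}$,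 arrow $1\leftrightarrow n$; - EII: $E_6$, no black nodes, arrows $1\leftrightarrow6$, $3\leftrightarrow5$; - EIII: $E_6$, black nodes $\alpha_3,\alpha_4,\alpha_5$, arrow $1\leftrightarrow6$; - (DIII, case 2): $D_n$, $n\ge5$ odd, black nodes $\alpha_1,\alpha_3,\dots,\alpha_{n-2}$, arrow $n-1\leftrightarrow n$. 5. Let the type be (DI, case 1): $D_n$, $n\ge4$, $2\le r\le n-2$, or DII: $D_n$, $n\ge4$, $r=1$; in both types the black nodes are $\alpha_{r+1},\dots,\alpha_n$ and there are no arrows. Then $P_{Z(\check B)}=P^+(\pi)$ if $r$ is even, and $P_{Z(\check B)}=\sum_{i=1}^{n-2}\mathbb N\omega_i+\mathbb N(\omega_{n-1}+\omega_n)$ if $r$ is odd. 6. Let the type be (DI, case 2): $D_n$, $n\ge4$, no black nodes, arrow $n-1\leftrightarrow n$. Then $P_{Z(\check B)}=P^+(\pi)$ if $n$ is odd, and $P_{Z(\check B)}=\sum_{i=1}^{n-2}\mathbb N\omega_i+\mathbb N(\omega_{n-1}+\omega_n)$ if $n$ is even. -/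

import Mathlib

open Module

noncomputable section

namespace SymPair

section WeylGroup

variable {ι R M N : Type*} [CommRing R] [AddCommGroup M] [Module R M] [AddCommGroup N] [Module R N]

/-- The group `W(J)` of linear automorphisms of the weight space generated by the reflections in the
roots belonging to `J`. If `J` is the set of all simple roots, this is the Weyl group `W`. -/
def reflectionSubgroup (P : RootPairing ι R M N) (J : Set ι) : Subgroup (M ≃ₗ[R] M) :=
  Subgroup.closure (P.reflection '' J)

/-- The length of `w ∈ W(J)`: the least number of factors in an expression of `w` as a product of
reflections in elements of `J`. -/
def wordLength (P : RootPairing ι R M N) (J : Set ι) (w : M ≃ₗ[R] M) : ℕ :=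
  sInf {k | ∃ l : List ι, l.length = k ∧ (∀ i ∈ l, i ∈ J) ∧ (l.map P.reflection).prod = w}

/-- `w` is an element of maximal length in `W(J)`. -/
def IsLongestElement (P : RootPairing ι R M N) (J : Set ι) (w : M ≃ₗ[R] M) : Prop :=
  w ∈ reflectionSubgroup P J ∧
    ∀ v ∈ reflectionSubgroup P J, wordLength P J v ≤ wordLength P J w

theorem exists_isLongestElement [Finite ι] (P : RootPairing ι R M N) [P.IsRootSystem]
    (J : Set ι) : ∃ w, IsLongestElement P J w := by
  have hmaps : ∀ w ∈ reflectionSubgroup P J, ∀ i, ∃ j, w (P.root i) = P.root j := by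
    intro w hw
    induction hw using Subgroup.closure_induction'' with
    | one => exact fun i => ⟨i, rfl⟩
    | mem x hx =>
      obtain ⟨k, -, rfl⟩ := hx
      exact fun i => ⟨P.reflectionPerm k i, (P.root_reflectionPerm k i).symm⟩
    | inv_mem x hx =>
      obtain ⟨k, -, rfl⟩ := hx
      refine fun i => ⟨P.reflectionPerm k i, ?_⟩
      rw [RootPairing.reflection_inv]
      exact (P.root_reflectionPerm k i).symm
    | mul x y _ _ hx hy =>
      intro i
      obtain ⟨j, hj⟩ := hy i
      obtain ⟨k, hk⟩ := hx j
      exact ⟨k, by rw [LinearEquiv.mul_apply, hj, hk]⟩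
  choose! f hf using hmaps
  have hfin : Finite (reflectionSubgroup P J) := by
    refine Finite.of_injective (fun w : reflectionSubgroup P J => f w.1) ?_
    rintro ⟨w, hw⟩ ⟨v, hv⟩ h
    ext1
    apply LinearEquiv.toLinearMap_injective
    refine LinearMap.ext_on_range (v := P.root) ?_ fun i => ?_
    · exact RootPairing.IsRootSystem.span_root_eq_top
    · simp only [LinearEquiv.coe_coe]
      rw [hf w hw i, hf v hv i]
      exact congrArg P.root (congrFun h i)
  obtain ⟨w, hw⟩ := Finite.exists_max fun w : reflectionSubgroup P J => wordLength P J w.1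
  exact ⟨w.1, w.2, fun v hv => hw ⟨v, hv⟩⟩

/-- The longest element of `W(J)`, for a set `J` of simple roots. -/
def longestElement [Finite ι] (P : RootPairing ι R M N) [P.IsRootSystem] (J : Set ι) :
    M ≃ₗ[R] M :=
  (exists_isLongestElement P J).choose

end WeylGroup

open LieAlgebra.IsKilling (rootSystem)

variable {L : Type*} [LieRing L] [LieAlgebra ℂ L]

/-- `θ` is an automorphism of order two and `(𝔤, 𝔤^θ)` is irreducible: `𝔤` is nonzero and has no
`θ`-stable ideals besides `0` and `𝔤`. -/
structure IsIrreduciblePair (θ : L ≃ₗ⁅ℂ⁆ L) : Prop where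
  involutive : ∀ x, θ (θ x) = x
  ne_id : ∃ x, θ x ≠ x
  irreducible : ∀ I : LieIdeal ℂ L, (∀ x ∈ I, θ x ∈ I) → I = ⊥ ∨ I = ⊤

/-- `𝔤 = I ⊕ J` for ideals `I`, `J` that are interchanged by `θ`, with `I` (and so `J`) simple. -/
structure IsDiagonal (θ : L ≃ₗ⁅ℂ⁆ L) (I J : LieIdeal ℂ L) : Prop where
  isSimple : LieAlgebra.IsSimple ℂ I
  isCompl : IsCompl I J
  map_left : ∀ x ∈ I, θ x ∈ J
  map_right : ∀ x ∈ J, θ x ∈ I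

variable [FiniteDimensional ℂ L] [LieAlgebra.IsSemisimple ℂ L]
  {H : LieSubalgebra ℂ L} [H.IsCartanSubalgebra]

/-- `θ` is maximally split with respect to the Cartan subalgebra `H` and the triangular
decomposition given by the simple roots `b`: it preserves `H`; if it fixes a simple coroot `hᵢ`, then
it fixes the root vectors `eᵢ`, `fᵢ`; otherwise it maps `eᵢ` to a negative and `fᵢ` to a positive root
vector. (Root spaces are one-dimensional.) -/
structure IsMaximallySplit (b : (rootSystem H).Base) (θ : L ≃ₗ⁅ℂ⁆ L) : Prop where
  map_cartan : ∀ x ∈ H, θ x ∈ H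
  fixed : ∀ i ∈ b.support, θ ((rootSystem H).coroot i) = (rootSystem H).coroot i →
    (∀ x ∈ LieAlgebra.rootSpace H i.1, θ x = x) ∧
    (∀ x ∈ LieAlgebra.rootSpace H (-(i.1 : H → ℂ)), θ x = x)
  moved : ∀ i ∈ b.support, θ ((rootSystem H).coroot i) ≠ (rootSystem H).coroot i →
    (∃ β : H.root, b.IsPos β ∧
      ∀ x ∈ LieAlgebra.rootSpace H i.1, θ x ∈ LieAlgebra.rootSpace H (-(β.1 : H → ℂ))) ∧
    (∃ β : H.root, b.IsPos β ∧
      ∀ x ∈ LieAlgebra.rootSpace H (-(i.1 : H → ℂ)), θ x ∈ LieAlgebra.rootSpace H β.1)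

/-- The set `P⁺(π)` of dominant integral weights. -/
def dominantWeights (b : (rootSystem H).Base) : Set (Dual ℂ H) :=
  {μ | ∀ i ∈ b.support, ∃ k : ℕ, μ ((rootSystem H).coroot i) = k}

/-- The fundamental weight `ωᵢ`: the value of `ωᵢ` at the simple coroot `j` is `1` if `j = i`, and
`0` otherwise. -/
def fundamentalWeight (b : (rootSystem H).Base) (i : b.support) : Dual ℂ H :=
  b.toCoweightBasis.coord i

/-- The longest element `w₀` of the Weyl group `W`. -/
def w₀ (b : (rootSystem H).Base) : Dual ℂ H ≃ₗ[ℂ] Dual ℂ H :=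
  longestElement (rootSystem H) b.support

section Involution

variable {b : (rootSystem H).Base} {θ : L ≃ₗ⁅ℂ⁆ L} (hs : IsMaximallySplit b θ)

/-- The involution `Θ` of `𝔥*` induced by `θ`, that is `(Θ μ)(h) = μ (θ h)`. -/
def bigTheta : Dual ℂ H →ₗ[ℂ] Dual ℂ H :=
  (((θ : L →ₗ⁅ℂ⁆ L) : L →ₗ[ℂ] L).restrict (p := H.toSubmodule) (q := H.toSubmodule)
    hs.map_cartan).dualMap

/-- The set `π_Θ` of simple roots fixed by `Θ`. -/
def fixedSimpleRoots : Set H.root :=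
  {i | i ∈ b.support ∧ bigTheta hs ((rootSystem H).root i) = (rootSystem H).root i}

/-- The longest element `w₀'` of the subgroup `W(π_Θ)` of `W`. -/
def w₀' : Dual ℂ H ≃ₗ[ℂ] Dual ℂ H :=
  longestElement (rootSystem H) (fixedSimpleRoots hs)

/-- The set `P_{Z(B̌)}`. -/
def PZB : Set (Dual ℂ H) :=
  {μ | μ ∈ dominantWeights b ∧ bigTheta hs μ = μ + w₀ b μ - w₀' hs μ}

/-- With respect to the numbering `e` of the simple roots, the Satake diagram of `θ` has the set `X`
of black nodes, and the arrows are given by the map `p` on the white nodes: `π_Θ` is the set of the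
`αᵢ` with `i ∈ X`, and `Θ(αᵢ) ∈ -α_{p(i)} + ℤ π_Θ` for `i ∉ X`. The values of `p` on `X` are
immaterial. -/
def HasSatakeDiagram {n : ℕ} (e : Fin n ≃ b.support) (X : Set (Fin n)) (p : Fin n → Fin n) : Prop :=
  (∀ i, (e i : H.root) ∈ fixedSimpleRoots hs ↔ i ∈ X) ∧
  ∀ i ∉ X, bigTheta hs ((rootSystem H).root (e i)) + (rootSystem H).root (e (p i)) ∈
    Submodule.span ℤ ((rootSystem H).root '' fixedSimpleRoots hs)

end Involution

/-- The set of selfdual dominant integral weights. -/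
def selfdualWeights (b : (rootSystem H).Base) : Set (Dual ℂ H) :=
  {μ | μ ∈ dominantWeights b ∧ μ = -w₀ b μ}

/-- The submonoid `ℕ ω₁ + ⋯ + ℕ ω_{n-2} + ℕ (ω_{n-1} + ω_n)`, for the numbering `e` of the simple
roots (`Fin n` starts at `0`, so that `ωᵢ` is the fundamental weight number `i - 1` here). -/
def evenSubmonoid {b : (rootSystem H).Base} {n : ℕ} (e : Fin n ≃ b.support) :
    AddSubmonoid (Dual ℂ H) :=
  AddSubmonoid.closure
    ({ω | ∃ i : Fin n, i.val + 2 < n ∧ ω = fundamentalWeight b (e i)} ∪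
     {ω | ∃ i j : Fin n, i.val + 2 = n ∧ j.val + 1 = n ∧
        ω = fundamentalWeight b (e i) + fundamentalWeight b (e j)})

/-- The simple roots that belong to the ideal `I`. -/
def simpleRootsIn (b : (rootSystem H).Base) (I : LieIdeal ℂ L) : Set H.root :=
  {i | i ∈ b.support ∧ ∀ x ∈ LieAlgebra.rootSpace H i.1, x ∈ I}

/-- The dominant integral weights `P⁺(π')` for a subset `π'` of the simple roots, as a subset of
`P⁺(π)`: those that vanish on the simple coroots outside `π'`. -/
def dominantWeightsOn (b : (rootSystem H).Base) (J : Set H.root) : Set (Dual ℂ H) :=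
  {μ | μ ∈ dominantWeights b ∧ ∀ i ∈ b.support, i ∉ J → μ ((rootSystem H).coroot i) = 0}

section Types

variable {b : (rootSystem H).Base}

/-- The numbering `e` of the simple roots identifies the Cartan matrix with `C`. -/
def IsNumbering {n : ℕ} (e : Fin n ≃ b.support) (C : Matrix (Fin n) (Fin n) ℤ) : Prop :=
  ∀ i j, b.cartanMatrix (e i) (e j) = C i j

variable (b) in
/-- The root system is of the type with Cartan matrix `C`. -/
def HasType {n : ℕ} (C : Matrix (Fin n) (Fin n) ℤ) : Prop :=
  ∃ e : Fin n ≃ b.support, IsNumbering e C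

variable (b) in
/-- `𝔤` is of one of the types `B_n`, `C_n`, `E₇`, `E₈`, `F₄`, `G₂`. -/
def IsTypeBCEFG : Prop :=
  (∃ n, 2 ≤ n ∧ HasType b (CartanMatrix.B n)) ∨ (∃ n, 2 ≤ n ∧ HasType b (CartanMatrix.C n)) ∨
    HasType b CartanMatrix.E₇ ∨ HasType b CartanMatrix.E₈ ∨
    HasType b CartanMatrix.F₄ ∨ HasType b CartanMatrix.G₂

/-! The types of Araki's list, for simple `𝔤` of type `A_n`, `D_n`, `E₆`, by their Satake diagrams.
The simple roots are numbered as in Bourbaki, but starting at `0`: the simple root `αᵢ` has the number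
`i - 1`. The parameter `r` is the rank of the restricted root system in the types where it occurs. -/

/-- The exchange of the last two nodes. -/
def swapLast {n : ℕ} (i : Fin n) : Fin n :=
  if h : i.val + 2 = n then ⟨n - 1, by omega⟩
  else if h' : i.val + 1 = n then ⟨n - 2, by omega⟩
  else i

variable {θ : L ≃ₗ⁅ℂ⁆ L} (hs : IsMaximallySplit b θ)

/-- No black nodes, no arrows. -/
def IsAI {n : ℕ} (e : Fin n ≃ b.support) : Prop :=
  1 ≤ n ∧ IsNumbering e (CartanMatrix.A n) ∧ HasSatakeDiagram hs e ∅ id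

/-- `n` is odd, the nodes `α₁, α₃, …, α_n` are black, no arrows. -/
def IsAII {n : ℕ} (e : Fin n ≃ b.support) : Prop :=
  3 ≤ n ∧ Odd n ∧ IsNumbering e (CartanMatrix.A n) ∧
    HasSatakeDiagram hs e {i | Odd (i.val + 1)} id

/-- The nodes `α_{r+1}, …, α_{n-r}` are black, arrows between `αᵢ` and `α_{n+1-i}`. -/
def IsAIII {n : ℕ} (e : Fin n ≃ b.support) (r : ℕ) : Prop :=
  2 ≤ r ∧ 2 * r ≤ n + 1 ∧ IsNumbering e (CartanMatrix.A n) ∧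
    HasSatakeDiagram hs e {i | r + 1 ≤ i.val + 1 ∧ i.val + 1 ≤ n - r} Fin.rev

/-- The nodes `α₂, …, α_{n-1}` are black, an arrow between `α₁` and `α_n`. -/
def IsAIV {n : ℕ} (e : Fin n ≃ b.support) : Prop :=
  2 ≤ n ∧ IsNumbering e (CartanMatrix.A n) ∧
    HasSatakeDiagram hs e {i | 2 ≤ i.val + 1 ∧ i.val + 1 ≤ n - 1} Fin.rev

/-- Type `DI`, case 1 (`2 ≤ r ≤ n - 2`): the nodes `α_{r+1}, …, α_n` are black, no arrows. -/
def IsDI₁ {n : ℕ} (e : Fin n ≃ b.support) (r : ℕ) : Prop :=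
  4 ≤ n ∧ 2 ≤ r ∧ r + 2 ≤ n ∧ IsNumbering e (CartanMatrix.D n) ∧
    HasSatakeDiagram hs e {i | r + 1 ≤ i.val + 1} id

/-- Type `DI`, case 2 (`r = n - 1`): no black nodes, an arrow between `α_{n-1}` and `α_n`. -/
def IsDI₂ {n : ℕ} (e : Fin n ≃ b.support) : Prop :=
  4 ≤ n ∧ IsNumbering e (CartanMatrix.D n) ∧ HasSatakeDiagram hs e ∅ swapLast

/-- Type `DI`, case 3 (`r = n`): no black nodes, no arrows. -/
def IsDI₃ {n : ℕ} (e : Fin n ≃ b.support) : Prop :=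
  4 ≤ n ∧ IsNumbering e (CartanMatrix.D n) ∧ HasSatakeDiagram hs e ∅ id

/-- Type `DII` (`r = 1`): the nodes `α₂, …, α_n` are black, no arrows. -/
def IsDII {n : ℕ} (e : Fin n ≃ b.support) : Prop :=
  4 ≤ n ∧ IsNumbering e (CartanMatrix.D n) ∧ HasSatakeDiagram hs e {i | 2 ≤ i.val + 1} id

/-- Type `DIII`, case 1 (`n` even): the nodes `α₁, α₃, …, α_{n-1}` are black, no arrows. -/
def IsDIII₁ {n : ℕ} (e : Fin n ≃ b.support) : Prop :=
  4 ≤ n ∧ Even n ∧ IsNumbering e (CartanMatrix.D n) ∧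
    HasSatakeDiagram hs e {i | Odd (i.val + 1)} id

/-- Type `DIII`, case 2 (`n` odd): the nodes `α₁, α₃, …, α_{n-2}` are black, an arrow between
`α_{n-1}` and `α_n`. -/
def IsDIII₂ {n : ℕ} (e : Fin n ≃ b.support) : Prop :=
  4 ≤ n ∧ Odd n ∧ IsNumbering e (CartanMatrix.D n) ∧
    HasSatakeDiagram hs e {i | Odd (i.val + 1) ∧ i.val + 1 ≤ n - 2} swapLast

/-- No black nodes, no arrows. -/
def IsEI (e : Fin 6 ≃ b.support) : Prop :=
  IsNumbering e CartanMatrix.E₆ ∧ HasSatakeDiagram hs e ∅ id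

/-- No black nodes, arrows between `α₁` and `α₆` and between `α₃` and `α₅`. -/
def IsEII (e : Fin 6 ≃ b.support) : Prop :=
  IsNumbering e CartanMatrix.E₆ ∧ HasSatakeDiagram hs e ∅ ![5, 1, 4, 3, 2, 0]

/-- The nodes `α₃, α₄, α₅` are black, an arrow between `α₁` and `α₆`. -/
def IsEIII (e : Fin 6 ≃ b.support) : Prop :=
  IsNumbering e CartanMatrix.E₆ ∧ HasSatakeDiagram hs e {2, 3, 4} ![5, 1, 4, 3, 2, 0]

/-- The nodes `α₂, α₃, α₄, α₅` are black, no arrows. -/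
def IsEIV (e : Fin 6 ≃ b.support) : Prop :=
  IsNumbering e CartanMatrix.E₆ ∧ HasSatakeDiagram hs e {1, 2, 3, 4} id

/-- The pair is of one of the types of Araki's list, for a suitable numbering of the simple roots. -/
def IsInArakiList : Prop :=
  IsTypeBCEFG b ∨
  (∃ (n : ℕ) (e : Fin n ≃ b.support),
    IsAI hs e ∨ IsAII hs e ∨ (∃ r, IsAIII hs e r) ∨ IsAIV hs e ∨
    (∃ r, IsDI₁ hs e r) ∨ IsDI₂ hs e ∨ IsDI₃ hs e ∨ IsDII hs e ∨ IsDIII₁ hs e ∨ IsDIII₂ hs e) ∨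
  (∃ e : Fin 6 ≃ b.support, IsEI hs e ∨ IsEII hs e ∨ IsEIII hs e ∨ IsEIV hs e)

end Types

end SymPair

end

/-! Write X for π_Θ and w_X for w₀'. The map δ = −Θ w_X permutes the simple roots: w_X makes the
positive roots in the span of X negative and Θ fixes them, whereas w_X keeps the other positive
roots positive and Θ makes them negative. So δ comes from an involution τ of the Dynkin diagram, and
τ agrees with p on the white nodes. With the identity in place of Θ and all simple roots in place of
X, the same construction yields δ₀ = −w₀ and its permutation τ₀ (`isSplitInvolution_refl`).

As Θ = −w_X δ, the condition Θμ = μ + w₀μ − w_X μ is equivalent to w_X(μ − δμ) = μ − δ₀μ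
(`IsSplitInvolution.apply_eq_iff`). If δ = δ₀, it holds for all μ, because v = μ − δμ satisfies δv =
−v and this forces w_X v = v. If δ = 1, it says μ = δ₀μ, and if δ₀ = 1, it says μ = δμ. For simple 𝔤
each type falls under one of these cases, so only τ and τ₀ have to be found.

For the completeness of the list, a minimal ideal I and its image under θ show that 𝔤 is simple or
diagonal. If 𝔤 is simple, its Dynkin diagram is classified by induction: a node with connected
complement is removed, and Vinberg's criterion excludes all but the known ways of attaching it
again. The pairs (X, τ) then obey the constraints collected in `SatakeDatum`. The involution τ
preserves the Cartan matrix, the set X and every component of X. Since w_X acts trivially on the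
integral weights modulo the root lattice of X, there are divisibility conditions which decide how τ
acts on X (`IsSplitInvolution.dvd_add_diagramPerm`). If τ fixes a white node i, the value of αᵢ at
the sum of the positive coroots for X is even (`even_of_map_mem`); this follows from the invariance
of the Killing form, applied to the principal 𝔰𝔩₂ of the black nodes. Finally some node is white, as
otherwise θ = 1 (`forall_eq_of_fixed_eq_support`). Only the listed diagrams survive.

In the diagonal case X is empty and Θ = −δ, where δ exchanges the simple roots of the two ideals.
The condition is then compared on the two sets of coroots
(`IsSplitInvolution.exchange_condition_iff`). -/

noncomputable section
namespace SymPair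

set_option linter.unusedSectionVars false

/-! ### Weyl groups: the exchange condition and longest elements -/

section WeylGroup

variable {ι K M N : Type*} [Field K] [AddCommGroup M] [Module K M]
  [AddCommGroup N] [Module K N] {P : RootPairing ι K M N}

/-- A linear automorphism of the weight space maps roots to roots. -/
def PermutesRoots (P : RootPairing ι K M N) (f : M ≃ₗ[K] M) : Prop :=
  ∀ i, ∃ j, f (P.root i) = P.root j

theorem PermutesRoots.mul {f g : M ≃ₗ[K] M} (hf : PermutesRoots P f) (hg : PermutesRoots P g) :
    PermutesRoots P (f * g) := fun i => by
  obtain ⟨j, hj⟩ := hg i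
  obtain ⟨k, hk⟩ := hf j
  exact ⟨k, by rw [LinearEquiv.mul_apply, hj, hk]⟩

theorem permutesRoots_reflection (i : ι) : PermutesRoots P (P.reflection i) :=
  fun j => ⟨P.reflectionPerm i j, (P.root_reflectionPerm i j).symm⟩

theorem reflection_mul_self (i : ι) : P.reflection i * P.reflection i = 1 := by
  ext x; simp

theorem exists_root_eq_neg (i : ι) : ∃ j, P.root j = -P.root i :=
  ⟨P.reflectionPerm i i, by simp⟩

theorem reflection_mem {J : Set ι} {i : ι} (hi : i ∈ J) :
    P.reflection i ∈ reflectionSubgroup P J :=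
  Subgroup.subset_closure ⟨i, hi, rfl⟩

/-- Reflections are involutions, so inverses of generators need no case of their own. -/
theorem reflectionSubgroup_induction {J : Set ι}
    {p : ∀ w : M ≃ₗ[K] M, w ∈ reflectionSubgroup P J → Prop} (one : p 1 (one_mem _))
    (refl_mul : ∀ i (hi : i ∈ J) w (hw : w ∈ reflectionSubgroup P J), p w hw →
      p (P.reflection i * w) (mul_mem (reflection_mem hi) hw))
    {w : M ≃ₗ[K] M} (hw : w ∈ reflectionSubgroup P J) : p w hw := by
  induction hw using Subgroup.closure_induction_left with
  | one => exact one
  | mul_left x hx y hy h =>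
    obtain ⟨k, hk, rfl⟩ := hx
    exact refl_mul k hk y hy h
  | inv_mul_cancel x hx y hy h =>
    obtain ⟨k, hk, rfl⟩ := hx
    simp only [RootPairing.reflection_inv]
    exact refl_mul k hk y hy h

theorem permutesRoots_of_mem {J : Set ι} {w : M ≃ₗ[K] M} (hw : w ∈ reflectionSubgroup P J) :
    PermutesRoots P w :=
  reflectionSubgroup_induction (p := fun w _ => PermutesRoots P w) (fun i => ⟨i, rfl⟩)
    (fun i _ _ _ h => (permutesRoots_reflection i).mul h) hw

theorem apply_sub_mem_span {J : Set ι} {w : M ≃ₗ[K] M} (hw : w ∈ reflectionSubgroup P J) (x : M) :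
    w x - x ∈ Submodule.span K (P.root '' J) := by
  induction hw using reflectionSubgroup_induction with
  | one => simp
  | refl_mul i hi w _ h =>
    have : (P.reflection i * w) x - x = (w x - x) - P.coroot' i (w x) • P.root i := by
      rw [LinearEquiv.mul_apply, RootPairing.reflection_apply]; abel
    rw [this]
    exact sub_mem h (Submodule.smul_mem _ _ (Submodule.subset_span ⟨i, hi, rfl⟩))

theorem apply_mem_span {J : Set ι} {w : M ≃ₗ[K] M} (hw : w ∈ reflectionSubgroup P J) {x : M}
    (hx : x ∈ Submodule.span K (P.root '' J)) : w x ∈ Submodule.span K (P.root '' J) := by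
  simpa using add_mem (apply_sub_mem_span hw x) hx

theorem exists_word {J : Set ι} {w : M ≃ₗ[K] M} (hw : w ∈ reflectionSubgroup P J) :
    ∃ l : List ι, l.length = wordLength P J w ∧ (∀ i ∈ l, i ∈ J) ∧
      (l.map P.reflection).prod = w := by
  refine Nat.sInf_mem (s := {k | ∃ l : List ι, l.length = k ∧ (∀ i ∈ l, i ∈ J) ∧
    (l.map P.reflection).prod = w}) ?_
  induction hw using reflectionSubgroup_induction with
  | one => exact ⟨0, [], by simp⟩
  | refl_mul i hi w _ h =>
    obtain ⟨_, l, rfl, hl, rfl⟩ := h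
    exact ⟨_, i :: l, rfl, by simpa [hi] using hl, by simp⟩

theorem wordLength_le {J : Set ι} {l : List ι} (hl : ∀ i ∈ l, i ∈ J) :
    wordLength P J (l.map P.reflection).prod ≤ l.length :=
  Nat.sInf_le ⟨l, rfl, hl, rfl⟩

theorem prod_mem {J : Set ι} {l : List ι} (hl : ∀ i ∈ l, i ∈ J) :
    (l.map P.reflection).prod ∈ reflectionSubgroup P J := by
  refine list_prod_mem fun x hx => ?_
  obtain ⟨i, hi, rfl⟩ := List.mem_map.1 hx
  exact reflection_mem (hl i hi)

variable [Finite ι] [CharZero K] [P.IsRootSystem]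

/-- The coroots are determined by the roots. Hence a linear map that permutes the roots is an
automorphism of the root pairing, and its transpose permutes the coroots accordingly. -/
theorem PermutesRoots.coroot'_apply {f : M ≃ₗ[K] M} (hf : PermutesRoots P f) {i j : ι}
    (h : f (P.root i) = P.root j) (x : M) : P.coroot' j (f x) = P.coroot' i x := by
  choose e he using hf
  have hinj : Function.Injective e := fun a c hac =>
    P.root.injective (f.injective (by rw [he, he, hac]))
  let e' := Equiv.ofBijective e (Finite.injective_iff_bijective.1 hinj)
  let g := RootPairing.Equiv.mk' P P f e' he
  have h1 := congrFun g.coroot_coweightMap j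
  have h2 := congrArg (fun φ => φ (P.coroot j) x) g.weight_coweight_transpose
  have hj : e'.symm j = i := by
    rw [Equiv.symm_apply_eq]; exact P.root.injective (by rw [← h, he]; rfl)
  have h3 : g.coweightMap (P.coroot j) = P.coroot i := by
    simp only [Function.comp_apply] at h1
    rw [h1]; exact congrArg P.coroot hj
  simp only [LinearMap.comp_apply, LinearMap.dualMap_apply, h3] at h2
  exact h2

theorem PermutesRoots.reflection_mul {f : M ≃ₗ[K] M} (hf : PermutesRoots P f) {i j : ι}
    (h : f (P.root i) = P.root j) : P.reflection j * f = f * P.reflection i := by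
  ext x
  rw [LinearEquiv.mul_apply, LinearEquiv.mul_apply, RootPairing.reflection_apply,
    RootPairing.reflection_apply, hf.coroot'_apply h, map_sub, map_smul, h]

variable (b : P.Base)

theorem exists_int_coeff (k : ι) : ∃ f : ι → ℤ,
    P.root k = ∑ j ∈ b.support, f j • P.root j ∧ (b.IsPos k → 0 ≤ f) ∧ (¬ b.IsPos k → f ≤ 0) := by
  obtain ⟨f, -, hf, h⟩ := b.exists_root_eq_sum_int k
  refine ⟨f, h, fun hk => ?_, fun hk => ?_⟩
  · rcases hf with hf | hf
    · exact hf.le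
    · rw [RootPairing.Base.isPos_iff, RootPairing.Base.height_eq_sum h] at hk
      exact absurd hk (not_lt.2 (Finset.sum_nonpos fun i _ => hf.le i))
  · rcases hf with hf | hf
    · rw [RootPairing.Base.isPos_iff', RootPairing.Base.height_eq_sum h] at hk
      exact absurd (Finset.sum_nonneg fun i _ => hf.le i) hk
    · exact hf.le

/-- A linear form extending the height allows the height of the image of a root under a linear map
to be read off from its simple coefficients. -/
theorem exists_heightFunctional : ∃ φ : M →ₗ[K] K, ∀ k, φ (P.root k) = (b.height k : K) := by
  refine ⟨b.toWeightBasis.constr K fun _ => (1 : K), fun k => ?_⟩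
  obtain ⟨f, hf, -⟩ := exists_int_coeff b k
  rw [RootPairing.Base.height_eq_sum hf, hf, map_sum, Int.cast_sum]
  refine Finset.sum_congr rfl fun j hj => ?_
  have := b.toWeightBasis.constr_basis K (fun _ => (1 : K)) ⟨j, hj⟩
  rw [b.toWeightBasis_apply] at this
  rw [map_zsmul, this]; simp

variable {b}

theorem coeff_eq_zero_of_mem_span {X : Set ι} {f : ι → ℤ}
    (h : ∑ j ∈ b.support, f j • P.root j ∈ Submodule.span K (P.root '' X)) (hX : X ⊆ b.support)
    {j : ι} (hj : j ∈ b.support) (hjX : j ∉ X) : f j = 0 := by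
  have hle : Submodule.span K (P.root '' X) ≤ LinearMap.ker (b.toWeightBasis.coord ⟨j, hj⟩) := by
    rw [Submodule.span_le]
    rintro _ ⟨i, hi, rfl⟩
    have : b.toWeightBasis.repr (P.root i) = _ := b.toWeightBasis_repr_root ⟨i, hX hi⟩
    simp only [SetLike.mem_coe, LinearMap.mem_ker, Basis.coord_apply, this]
    rw [Finsupp.single_eq_of_ne]
    rintro h; exact hjX (by rw [Subtype.mk.injEq] at h; rwa [h])
  have := hle h
  rw [LinearMap.mem_ker, map_sum, Finset.sum_eq_single_of_mem j hj] at this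
  · have h2 : b.toWeightBasis.repr (P.root j) = _ := b.toWeightBasis_repr_root ⟨j, hj⟩
    rw [map_zsmul, Basis.coord_apply, h2] at this
    simpa using this
  · intro i hi hij
    have h2 : b.toWeightBasis.repr (P.root i) = _ := b.toWeightBasis_repr_root ⟨i, hi⟩
    rw [map_zsmul, Basis.coord_apply, h2, Finsupp.single_eq_of_ne, smul_zero]
    simpa using hij.symm

theorem mem_of_root_mem_span {X : Set ι} (hX : X ⊆ b.support) {j : ι} (hj : j ∈ b.support)
    (h : P.root j ∈ Submodule.span K (P.root '' X)) : j ∈ X := by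
  classical
  by_contra hjX
  have := coeff_eq_zero_of_mem_span (f := fun i => if i = j then 1 else 0)
    (by simpa [hj] using h) hX hj hjX
  simp at this

theorem not_isPos_of_root_eq_neg {i j : ι} (h : P.root j = -P.root i) :
    b.IsPos j ↔ ¬ b.IsPos i := by
  have := RootPairing.Base.IsPos.neg_iff_not b i
  have hj : j = P.reflectionPerm i i := P.root.injective (by simp [h])
  rw [hj]; exact this

variable [P.IsCrystallographic]

/-- Positive roots are reached from simple ones by adding simple roots one at a time; only the last
addition matters here. Heights show that the two alternatives exclude each other, so this detects
simple roots. -/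
theorem eq_or_exists_add_of_isPos {k : ι} (hk : b.IsPos k) :
    k ∈ b.support ∨ ∃ i j, b.IsPos i ∧ b.IsPos j ∧ P.root k = P.root i + P.root j := by
  have : b.IsPos k ∧
      (k ∈ b.support ∨ ∃ i j, b.IsPos i ∧ b.IsPos j ∧ P.root k = P.root i + P.root j) := by
    refine hk.induction_on_add (p := fun k => b.IsPos k ∧ (k ∈ b.support ∨
      ∃ i j, b.IsPos i ∧ b.IsPos j ∧ P.root k = P.root i + P.root j)) (fun i hi => ⟨RootPairing.Base.isPos_of_mem_support hi, .inl hi⟩) ?_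
    rintro i j k h ⟨hi, -⟩ hj
    have hj' := RootPairing.Base.isPos_of_mem_support hj
    exact ⟨hi.add hj' h, .inr ⟨i, j, hi, hj', h⟩⟩
  exact this.2

/-- An automorphism of the root system that preserves the positive roots permutes the simple
roots. -/
theorem exists_perm_support {f : M ≃ₗ[K] M}
    (hf : ∀ i, b.IsPos i → ∃ j, b.IsPos j ∧ f (P.root i) = P.root j) :
    ∃ τ : Equiv.Perm b.support, ∀ i : b.support, f (P.root i) = P.root (τ i) := by
  choose! e hpos he using hf
  let e' : {i // b.IsPos i} → {i // b.IsPos i} := fun i => ⟨e i.1, hpos i.1 i.2⟩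
  have hinj : Function.Injective e' := by
    rintro ⟨i, hi⟩ ⟨j, hj⟩ h
    simp only [e', Subtype.mk.injEq] at h ⊢
    exact P.root.injective (f.injective (by rw [he i hi, he j hj, h]))
  have hsurj := Finite.injective_iff_surjective.1 hinj
  have hsupp : ∀ i ∈ b.support, e i ∈ b.support := by
    intro i hi
    have hi' := RootPairing.Base.isPos_of_mem_support hi
    rcases eq_or_exists_add_of_isPos (hpos i hi') with h | ⟨j, k, hj, hk, h⟩
    · exact h
    -- The summands of a decomposition of the image are images of positive roots. Pulled back, they
    -- would write a simple root, of height one, as a sum of two positive roots.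
    · exfalso
      obtain ⟨⟨j', hj'⟩, hjj⟩ := hsurj ⟨j, hj⟩
      obtain ⟨⟨k', hk'⟩, hkk⟩ := hsurj ⟨k, hk⟩
      simp only [e', Subtype.mk.injEq] at hjj hkk
      have h3 : P.root i = P.root j' + P.root k' := by
        apply f.injective
        rw [map_add, he _ hi', he _ hj', he _ hk', h, hjj, hkk]
      have h4 := b.height_add h3
      rw [RootPairing.Base.height_one_of_mem_support hi] at h4
      rw [RootPairing.Base.isPos_iff] at hj' hk'
      omega
  let t : b.support → b.support := fun i => ⟨e i.1, hsupp i.1 i.2⟩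
  have htinj : Function.Injective t := by
    rintro ⟨i, hi⟩ ⟨j, hj⟩ h
    simp only [t, Subtype.mk.injEq] at h ⊢
    exact P.root.injective (f.injective (by
      rw [he i (RootPairing.Base.isPos_of_mem_support hi),
        he j (RootPairing.Base.isPos_of_mem_support hj), h]))
  exact ⟨Equiv.ofBijective t (Finite.injective_iff_bijective.1 htinj),
    fun i => he i (RootPairing.Base.isPos_of_mem_support i.2)⟩

variable [P.IsReduced] {X : Set ι}

/-- The exchange condition. -/
theorem exchange (hX : X ⊆ b.support) {j : ι} (hj : j ∈ X) (l : List ι) (hl : ∀ i ∈ l, i ∈ X)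
    {k : ι} (hk : (l.map P.reflection).prod (P.root j) = P.root k) (hneg : ¬ b.IsPos k) :
    ∃ l' : List ι, (∀ i ∈ l', i ∈ X) ∧ l'.length + 1 = l.length ∧
      (l'.map P.reflection).prod = (l.map P.reflection).prod * P.reflection j := by
  induction l generalizing k with
  | nil =>
    have : j = k := P.root.injective (by simpa using hk)
    exact absurd (RootPairing.Base.isPos_of_mem_support (this ▸ hX hj)) hneg
  | cons a l ih =>
    simp only [List.mem_cons, forall_eq_or_imp] at hl
    have hw := permutesRoots_of_mem (prod_mem (P := P) hl.2)
    obtain ⟨k', hk'⟩ := hw j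
    by_cases hpos : b.IsPos k'
    -- The rest of the word maps αⱼ to a positive root which the first letter makes negative; a
    -- simple reflection does this only to its own root. Conjugation then turns `reflection j` into
    -- the first letter, and the two cancel.
    · have hka : k' = a := by
        by_contra hne
        apply hneg
        have h := hpos.reflectionPerm (hX hl.1) hne
        have : P.reflectionPerm a k' = k := P.root.injective (by
          rw [← hk, List.map_cons, List.prod_cons, LinearEquiv.mul_apply, hk',
            RootPairing.root_reflectionPerm])
        rwa [this] at h
      subst hka
      refine ⟨l, hl.2, rfl, ?_⟩
      rw [List.map_cons, List.prod_cons, mul_assoc, ← hw.reflection_mul hk', ← mul_assoc,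
        reflection_mul_self, one_mul]
    · obtain ⟨l', h1, h2, h3⟩ := ih hl.2 hk' hpos
      refine ⟨a :: l', by simpa [hl.1] using h1, by simp [h2], ?_⟩
      rw [List.map_cons, List.prod_cons, h3, List.map_cons, List.prod_cons, mul_assoc]

theorem longestElement_mem (X : Set ι) : longestElement P X ∈ reflectionSubgroup P X :=
  (exists_isLongestElement P X).choose_spec.1

/-- Otherwise w sⱼ maps αⱼ to a negative root. Exchange deletes a letter of a reduced word of w sⱼ
and leaves a word of w, so w would be shorter than w sⱼ, against maximality. -/
theorem not_isPos_of_longestElement_apply (hX : X ⊆ b.support) {j k : ι} (hj : j ∈ X)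
    (hk : longestElement P X (P.root j) = P.root k) : ¬ b.IsPos k := by
  intro hpos
  set w := longestElement P X
  have hw : w ∈ reflectionSubgroup P X := longestElement_mem X
  have hu : w * P.reflection j ∈ reflectionSubgroup P X := mul_mem hw (reflection_mem hj)
  obtain ⟨l, hl1, hl2, hl3⟩ := exists_word hu
  obtain ⟨k', hk'⟩ := exists_root_eq_neg (P := P) k
  obtain ⟨l', h1, h2, h3⟩ := exchange hX hj l hl2 (k := k')
    (by rw [hl3, LinearEquiv.mul_apply, RootPairing.reflection_apply_self, map_neg, hk, hk'])
    (by rw [not_isPos_of_root_eq_neg hk']; exact not_not.2 hpos)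
  rw [hl3, mul_assoc, reflection_mul_self, mul_one] at h3
  have h4 := wordLength_le (P := P) h1
  rw [h3] at h4
  have h5 : wordLength P X (w * P.reflection j) ≤ wordLength P X w :=
    (exists_isLongestElement P X).choose_spec.2 _ hu
  omega

/-- If a reduced word of w ends in j, then w sⱼ, given by the word without that letter, maps αⱼ to a
negative root. Exchange deletes one more letter and produces a word of w that is too short. -/
theorem eq_one_of_forall_isPos (hX : X ⊆ b.support) {w : M ≃ₗ[K] M}
    (hw : w ∈ reflectionSubgroup P X)
    (h : ∀ j ∈ X, ∀ k, w (P.root j) = P.root k → b.IsPos k) : w = 1 := by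
  obtain ⟨l, hl1, hl2, hl3⟩ := exists_word hw
  rcases List.eq_nil_or_concat l with rfl | ⟨l₀, j, rfl⟩
  · simpa using hl3.symm
  · exfalso
    have hj : j ∈ X := hl2 j (by simp)
    have hl0 : ∀ i ∈ l₀, i ∈ X := fun i hi => hl2 i (by simp [hi])
    have hprod : (l₀.map P.reflection).prod = w * P.reflection j := by
      rw [← hl3]; simp [mul_assoc, reflection_mul_self]
    obtain ⟨k, hk⟩ := permutesRoots_of_mem hw j
    obtain ⟨k', hk'⟩ := exists_root_eq_neg (P := P) k
    obtain ⟨l', h1, h2, h3⟩ := exchange hX hj l₀ hl0 (k := k')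
      (by rw [hprod, LinearEquiv.mul_apply, RootPairing.reflection_apply_self, map_neg, hk, hk'])
      (by rw [not_isPos_of_root_eq_neg hk']; exact not_not.2 (h j hj k hk))
    rw [hprod, mul_assoc, reflection_mul_self, mul_one] at h3
    have h4 := wordLength_le (P := P) h1
    rw [h3] at h4
    simp at hl1
    omega

/-- W(X) preserves the span of X, so the root never becomes one of the simple roots in X, and those
are the only positive roots that the generators can make negative. -/
theorem isPos_of_notMem_span (hX : X ⊆ b.support) {w : M ≃ₗ[K] M}
    (hw : w ∈ reflectionSubgroup P X) {k : ι} (hk : b.IsPos k)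
    (hkX : P.root k ∉ Submodule.span K (P.root '' X)) :
    ∃ k', w (P.root k) = P.root k' ∧ b.IsPos k' ∧
      P.root k' ∉ Submodule.span K (P.root '' X) := by
  induction hw using reflectionSubgroup_induction with
  | one => exact ⟨k, rfl, hk, hkX⟩
  | refl_mul i hi w _ h =>
    obtain ⟨k', h1, h2, h3⟩ := h
    refine ⟨P.reflectionPerm i k', ?_, ?_, ?_⟩
    · rw [LinearEquiv.mul_apply, h1, RootPairing.root_reflectionPerm]
    · refine h2.reflectionPerm (hX hi) ?_
      rintro rfl
      exact h3 (Submodule.subset_span ⟨k', hi, rfl⟩)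
    · intro h4
      apply h3
      have := apply_mem_span (P := P) (reflection_mem hi) h4
      rwa [RootPairing.root_reflectionPerm, RootPairing.reflection_same] at this

/-- The root is a nonnegative combination of simple roots in X, and the height is linear; hence the
height of its image is a sum of nonpositive terms. -/
theorem not_isPos_of_mem_span (hX : X ⊆ b.support) {w : M ≃ₗ[K] M} (hw : PermutesRoots P w)
    (h : ∀ j ∈ X, ∀ k, w (P.root j) = P.root k → ¬ b.IsPos k) {k k' : ι} (hk : b.IsPos k)
    (hkX : P.root k ∈ Submodule.span K (P.root '' X)) (hk' : w (P.root k) = P.root k') :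
    ¬ b.IsPos k' := by
  obtain ⟨f, hf, hf0, -⟩ := exists_int_coeff b k
  have hf0 := hf0 hk
  obtain ⟨φ, hφ⟩ := exists_heightFunctional b
  choose e he using hw
  have hzero : ∀ j ∈ b.support, j ∉ X → f j = 0 := fun j hj hjX =>
    coeff_eq_zero_of_mem_span (hf ▸ hkX) hX hj hjX
  have key : b.height k' = ∑ j ∈ b.support, f j * b.height (e j) := by
    have : (b.height k' : K) = ((∑ j ∈ b.support, f j * b.height (e j) : ℤ) : K) := by
      rw [← hφ, ← hk', hf, map_sum, map_sum, Int.cast_sum]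
      refine Finset.sum_congr rfl fun j _ => ?_
      rw [map_zsmul, map_zsmul, he, hφ]; simp
    exact_mod_cast this
  rw [RootPairing.Base.isPos_iff, key, not_lt]
  refine Finset.sum_nonpos fun j hj => ?_
  by_cases hjX : j ∈ X
  · have := h j hjX (e j) (he j)
    rw [RootPairing.Base.isPos_iff, not_lt] at this
    exact mul_nonpos_of_nonneg_of_nonpos (hf0 j) this
  · simp [hzero j hj hjX]

/-- The product of two elements that make X negative keeps X positive, hence is trivial. This gives
both the uniqueness of the longest element and the fact that it is an involution. -/
theorem eq_inv_of_forall_not_isPos (hX : X ⊆ b.support) {u w : M ≃ₗ[K] M}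
    (hu : u ∈ reflectionSubgroup P X) (hw : w ∈ reflectionSubgroup P X)
    (hu' : ∀ j ∈ X, ∀ k, u (P.root j) = P.root k → ¬ b.IsPos k)
    (hw' : ∀ j ∈ X, ∀ k, w (P.root j) = P.root k → ¬ b.IsPos k) : u * w = 1 := by
  refine eq_one_of_forall_isPos hX (mul_mem hu hw) fun j hj k hk => ?_
  obtain ⟨i, hi⟩ := permutesRoots_of_mem hw j
  obtain ⟨i', hi'⟩ := exists_root_eq_neg (P := P) i
  obtain ⟨k', hk'⟩ := exists_root_eq_neg (P := P) k
  have hmem : P.root i' ∈ Submodule.span K (P.root '' X) := by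
    rw [hi', ← hi]
    exact neg_mem (apply_mem_span hw (Submodule.subset_span ⟨j, hj, rfl⟩))
  have hpos : b.IsPos i' := (not_isPos_of_root_eq_neg hi').2 (hw' j hj i hi)
  have := not_isPos_of_mem_span hX (permutesRoots_of_mem hu) hu' hpos hmem (k' := k')
    (by rw [hi', map_neg, ← hi, hk', ← hk, LinearEquiv.mul_apply])
  rw [not_isPos_of_root_eq_neg hk'] at this
  exact not_not.1 this

theorem longestElement_mul_self (hX : X ⊆ b.support) :
    longestElement P X * longestElement P X = 1 :=
  eq_inv_of_forall_not_isPos hX (longestElement_mem X) (longestElement_mem X)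
    (fun _ hj _ => not_isPos_of_longestElement_apply hX hj)
    (fun _ hj _ => not_isPos_of_longestElement_apply hX hj)

theorem eq_longestElement (hX : X ⊆ b.support) {u : M ≃ₗ[K] M}
    (hu : u ∈ reflectionSubgroup P X)
    (hu' : ∀ j ∈ X, ∀ k, u (P.root j) = P.root k → ¬ b.IsPos k) : u = longestElement P X := by
  have h := eq_inv_of_forall_not_isPos hX hu (longestElement_mem X) hu'
    (fun _ hj _ => not_isPos_of_longestElement_apply hX hj)
  rw [mul_eq_one_iff_eq_inv.1 h, inv_eq_iff_mul_eq_one]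
  exact longestElement_mul_self hX

theorem longestElement_apply_apply (hX : X ⊆ b.support) (x : M) :
    longestElement P X (longestElement P X x) = x := by
  rw [← LinearEquiv.mul_apply, longestElement_mul_self hX]; rfl

omit [P.IsReduced] in
/-- `W(X)` acts trivially on a functional on integral weights that vanishes modulo `m` on the roots
in `X`. -/
theorem exists_sum_coroot_apply_sub_eq {w : M ≃ₗ[K] M}
    (hw : w ∈ reflectionSubgroup P X) {m : ℤ} {c : ι → ℤ}
    (hc : ∀ j ∈ X, m ∣ ∑ i ∈ b.support, c i * P.pairingIn ℤ j i) {μ : M}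
    (hμ : ∀ i, ∃ z : ℤ, P.coroot' i μ = z) :
    ∃ z : ℤ, ∑ i ∈ b.support, (c i : K) * P.coroot' i (w μ - μ) = m * z := by
  -- The induction subtracts multiples of roots in X. That the multiples are integers has to be
  -- carried along.
  suffices (∀ i, ∃ z : ℤ, P.coroot' i (w μ) = z) ∧
    ∃ z : ℤ, ∑ i ∈ b.support, (c i : K) * P.coroot' i (w μ - μ) = m * z from this.2
  induction hw using reflectionSubgroup_induction with
  | one => exact ⟨hμ, 0, by simp⟩
  | refl_mul j hj w _ h =>
    obtain ⟨h1, z, hz⟩ := h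
    obtain ⟨y, hy⟩ := h1 j
    have hpair : ∀ i, P.coroot' i (P.root j) = (P.pairingIn ℤ j i : K) := fun i => by
      rw [RootPairing.root_coroot'_eq_pairing]; exact (P.algebraMap_pairingIn ℤ j i).symm
    have hrefl : (P.reflection j * w) μ = w μ - (y : K) • P.root j := by
      rw [LinearEquiv.mul_apply, RootPairing.reflection_apply, hy]
    refine ⟨fun i => ?_, ?_⟩
    · obtain ⟨x, hx⟩ := h1 i
      exact ⟨x - y * P.pairingIn ℤ j i, by rw [hrefl, map_sub, map_smul, hx, hpair]; simp⟩
    · obtain ⟨x, hx⟩ := hc j hj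
      refine ⟨z - y * x, ?_⟩
      have : (P.reflection j * w) μ - μ = (w μ - μ) - (y : K) • P.root j := by rw [hrefl]; abel
      have hx' : ((∑ i ∈ b.support, c i * P.pairingIn ℤ j i : ℤ) : K) = m * x := by
        rw [hx]; push_cast; rfl
      push_cast at hx' ⊢
      rw [this, mul_sub, ← hz, ← mul_assoc, mul_comm (m : K), mul_assoc, ← hx', Finset.mul_sum,
        ← Finset.sum_sub_distrib]
      refine Finset.sum_congr rfl fun i _ => ?_
      rw [map_sub, map_smul, hpair, smul_eq_mul]; ring

end WeylGroup

end SymPair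

end

/-! ### Split involutions and the diagram automorphism −T w_X -/

noncomputable section
namespace SymPair

set_option linter.unusedSectionVars false

section SplitInvolution

variable {ι K M N : Type*} [Field K] [AddCommGroup M] [Module K M]
  [AddCommGroup N] [Module K N] {P : RootPairing ι K M N}
  [Finite ι] [CharZero K] [P.IsRootSystem] [P.IsCrystallographic] [P.IsReduced]

theorem PermutesRoots.neg {f : M ≃ₗ[K] M} (hf : PermutesRoots P f) :
    PermutesRoots P (LinearEquiv.neg K * f) := fun i => by
  obtain ⟨j, hj⟩ := hf i
  obtain ⟨k, hk⟩ := exists_root_eq_neg (P := P) j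
  exact ⟨k, by rw [LinearEquiv.mul_apply, hj, hk, LinearEquiv.neg_apply]⟩

open Classical in
theorem exists_fundamental (b : P.Base) (i : b.support) :
    ∃ μ : M, ∀ j : b.support, P.coroot' j μ = if j = i then 1 else 0 := by
  refine ⟨P.toPerfPair.symm (b.toCoweightBasis.coord i), fun j => ?_⟩
  have : P.coroot' j (P.toPerfPair.symm (b.toCoweightBasis.coord i)) =
      P.toPerfPair (P.toPerfPair.symm (b.toCoweightBasis.coord i)) (P.coroot j) := rfl
  rw [this, LinearEquiv.apply_symm_apply, Basis.coord_apply, b.toCoweightBasis_repr_coroot,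
    Finsupp.single_apply]

theorem coroot'_integral {b : P.Base} {μ : M} (h : ∀ j ∈ b.support, ∃ z : ℤ, P.coroot' j μ = z)
    (k : ι) : ∃ z : ℤ, P.coroot' k μ = z := by
  have hk := b.coroot_mem_span_int k
  have key : ∀ y ∈ Submodule.span ℤ (P.coroot '' b.support),
      ∃ z : ℤ, P.flip.toLinearMap y μ = z := by
    intro y hy
    induction hy using Submodule.span_induction with
    | mem x hx =>
      obtain ⟨j, hj, rfl⟩ := hx
      exact h j hj
    | zero => exact ⟨0, by simp⟩
    | add x y _ _ hx hy =>
      obtain ⟨z, hz⟩ := hx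
      obtain ⟨z', hz'⟩ := hy
      exact ⟨z + z', by rw [map_add, LinearMap.add_apply, hz, hz']; simp⟩
    | smul a x _ hx =>
      obtain ⟨z, hz⟩ := hx
      exact ⟨a * z, by rw [map_zsmul, LinearMap.smul_apply, hz]; simp⟩
  exact key _ hk

/-- The restriction to the weight space of a maximally split involution: `T` fixes the simple roots
in `X` and maps the other ones to negative roots. -/
structure IsSplitInvolution (b : P.Base) (T : M ≃ₗ[K] M) (X : Set ι) : Prop where
  permutesRoots : PermutesRoots P T
  involutive : ∀ x, T (T x) = x
  subset : X ⊆ b.support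
  fixed : ∀ j ∈ X, T (P.root j) = P.root j
  moved : ∀ j ∈ b.support, j ∉ X → ∀ k, T (P.root j) = P.root k → ¬ b.IsPos k

/-- `-T w_X`. -/
def diagramMap (P : RootPairing ι K M N) [P.IsRootSystem] (T : M ≃ₗ[K] M) (X : Set ι) :
    M ≃ₗ[K] M :=
  LinearEquiv.neg K * (T * longestElement P X)

theorem diagramMap_apply (T : M ≃ₗ[K] M) (X : Set ι) (x : M) :
    diagramMap P T X x = -T (longestElement P X x) := rfl

variable {b : P.Base} {T : M ≃ₗ[K] M} {X : Set ι}

theorem exists_nonzero_coeff {f : ι → ℤ}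
    (h : ∑ j ∈ b.support, f j • P.root j ∉ Submodule.span K (P.root '' X)) :
    ∃ j ∈ b.support, j ∉ X ∧ f j ≠ 0 := by
  by_contra! hcon
  refine h (Submodule.sum_mem _ ?_)
  intro j hj
  by_cases hjX : j ∈ X
  · have hj' : P.root j ∈ Submodule.span K (P.root '' X) := Submodule.subset_span ⟨j, hjX, rfl⟩
    exact zsmul_mem hj' _
  · rw [hcon j hj hjX, zero_smul]; exact zero_mem _

namespace IsSplitInvolution

variable (hT : IsSplitInvolution b T X)
include hT

theorem apply_of_mem_span {x : M} (hx : x ∈ Submodule.span K (P.root '' X)) : T x = x := by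
  induction hx using Submodule.span_induction with
  | mem x hx =>
    obtain ⟨j, hj, rfl⟩ := hx
    exact hT.fixed j hj
  | zero => simp
  | add x y _ _ hx hy => rw [map_add, hx, hy]
  | smul a x _ hx => rw [map_smul, hx]

/-- The linear form `l` adds up the coefficients outside X. It is nonnegative on positive roots,
zero on the images of the simple roots in X and negative on the images of the others. A positive
root outside the span of X has a positive coefficient outside X, so `l` is negative on its image. -/
theorem not_isPos_apply {k k' : ι} (hk : b.IsPos k)
    (hkX : P.root k ∉ Submodule.span K (P.root '' X)) (h : T (P.root k) = P.root k') :
    ¬ b.IsPos k' := by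
  classical
  let l : M →ₗ[K] K := b.toWeightBasis.constr K fun j => if (j : ι) ∈ X then (0 : K) else 1
  have hl : ∀ f : ι → ℤ, l (∑ j ∈ b.support, f j • P.root j) =
      ((∑ j ∈ b.support, if j ∈ X then 0 else f j : ℤ) : K) := by
    intro f
    rw [map_sum, Int.cast_sum]
    refine Finset.sum_congr rfl fun j hj => ?_
    have := b.toWeightBasis.constr_basis K (fun j => if (j : ι) ∈ X then (0 : K) else 1) ⟨j, hj⟩
    rw [b.toWeightBasis_apply] at this
    rw [map_zsmul, this]; split_ifs <;> simp
  choose f hf hf0 hf1 using exists_int_coeff b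
  let L : ι → ℤ := fun k => ∑ j ∈ b.support, if j ∈ X then 0 else f k j
  have hL : ∀ k, l (P.root k) = (L k : K) := fun k => by
    have := hl (f k)
    rwa [← hf k] at this
  have hLpos : ∀ k, b.IsPos k → 0 ≤ L k := fun k hk => Finset.sum_nonneg fun j _ => by
    split_ifs
    · exact le_rfl
    · exact hf0 k hk j
  choose e he using hT.permutesRoots
  have hLX : ∀ j ∈ X, L (e j) = 0 := by
    intro j hj
    have : e j = j := P.root.injective (by rw [← he, hT.fixed j hj])
    rw [this]
    refine Finset.sum_eq_zero fun i hi => ?_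
    split_ifs with hiX
    · rfl
    · exact coeff_eq_zero_of_mem_span (f := f j)
        (by rw [← hf j]; exact Submodule.subset_span ⟨j, hj, rfl⟩) hT.subset hi hiX
  have hLneg : ∀ j ∈ b.support, j ∉ X → L (e j) < 0 := by
    intro j hj hjX
    have hneg := hT.moved j hj hjX _ (he j)
    have hle : ∀ i, (if i ∈ X then 0 else f (e j) i) ≤ 0 := fun i => by
      split_ifs
      · exact le_rfl
      · exact hf1 _ hneg i
    refine lt_of_le_of_ne (Finset.sum_nonpos fun i _ => hle i) fun h0 => ?_
    rw [Finset.sum_eq_zero_iff_of_nonpos fun i _ => hle i] at h0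
    -- If the image of αⱼ lay in the span of X, then T would fix it. As T is injective, it would be
    -- equal to αⱼ, which is positive.
    by_cases hmem : P.root (e j) ∈ Submodule.span K (P.root '' X)
    · have h1 := hT.apply_of_mem_span hmem
      have h2 : e j = j := P.root.injective (T.injective (by rw [h1, he]))
      exact hneg (by rw [h2]; exact RootPairing.Base.isPos_of_mem_support hj)
    · rw [hf (e j)] at hmem
      obtain ⟨i, hi, hiX, hne⟩ := exists_nonzero_coeff hmem
      have := h0 i hi
      rw [if_neg hiX] at this
      exact hne this
  have key : L k' = ∑ j ∈ b.support, f k j * L (e j) := by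
    have : (L k' : K) = ((∑ j ∈ b.support, f k j * L (e j) : ℤ) : K) := by
      rw [← hL, ← h, hf k, map_sum, map_sum, Int.cast_sum]
      refine Finset.sum_congr rfl fun j _ => ?_
      rw [map_zsmul, map_zsmul, he, hL]; simp
    exact_mod_cast this
  have hlt : L k' < 0 := by
    rw [key]
    have hle : ∀ j ∈ b.support, f k j * L (e j) ≤ 0 := fun j hj => by
      by_cases hjX : j ∈ X
      · simp [hLX j hjX]
      · exact mul_nonpos_of_nonneg_of_nonpos (hf0 k hk j) (hLneg j hj hjX).le
    rw [hf k] at hkX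
    obtain ⟨i, hi, hiX, hne⟩ := exists_nonzero_coeff hkX
    refine Finset.sum_neg' hle ⟨i, hi, ?_⟩
    exact mul_neg_of_pos_of_neg (lt_of_le_of_ne (hf0 k hk i) hne.symm) (hLneg i hi hiX)
  intro hpos
  exact absurd (hLpos k' hpos) (not_le.2 hlt)

/-- T fixes the roots in X, hence commutes with their reflections. -/
theorem mul_comm_of_mem {w : M ≃ₗ[K] M} (hw : w ∈ reflectionSubgroup P X) : T * w = w * T := by
  induction hw using reflectionSubgroup_induction with
  | one => simp
  | refl_mul i hi w _ h =>
    rw [← mul_assoc, ← hT.permutesRoots.reflection_mul (hT.fixed i hi), mul_assoc, h, mul_assoc]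

theorem apply_longestElement (x : M) : T (longestElement P X x) = longestElement P X (T x) :=
  LinearEquiv.congr_fun (hT.mul_comm_of_mem (longestElement_mem X)) x

theorem diagramMap_diagramMap (x : M) : diagramMap P T X (diagramMap P T X x) = x := by
  simp only [diagramMap_apply, map_neg, neg_neg, hT.apply_longestElement, hT.involutive]
  exact longestElement_apply_apply hT.subset x

theorem permutesRoots_diagramMap : PermutesRoots P (diagramMap P T X) :=
  (hT.permutesRoots.mul (permutesRoots_of_mem (longestElement_mem X))).neg

/-- On the span of X the map T is the identity and −w_X preserves positivity. Off the span, w_X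
preserves positivity and stays off the span, where −T preserves positivity. -/
theorem diagramMap_isPos {i : ι} (hi : b.IsPos i) :
    ∃ j, b.IsPos j ∧ diagramMap P T X (P.root i) = P.root j := by
  have hw : longestElement P X ∈ reflectionSubgroup P X := longestElement_mem X
  by_cases hiX : P.root i ∈ Submodule.span K (P.root '' X)
  · obtain ⟨k, hk⟩ := permutesRoots_of_mem hw i
    obtain ⟨k', hk'⟩ := exists_root_eq_neg (P := P) k
    refine ⟨k', ?_, ?_⟩
    · rw [not_isPos_of_root_eq_neg hk']
      exact not_isPos_of_mem_span hT.subset (permutesRoots_of_mem hw)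
        (fun j hj k => not_isPos_of_longestElement_apply hT.subset hj) hi hiX hk
    · rw [diagramMap_apply, hT.apply_of_mem_span (apply_mem_span hw hiX), hk, hk']
  · obtain ⟨k, h1, h2, h3⟩ := isPos_of_notMem_span hT.subset hw hi hiX
    obtain ⟨k', hk'⟩ := hT.permutesRoots k
    obtain ⟨k'', hk''⟩ := exists_root_eq_neg (P := P) k'
    refine ⟨k'', ?_, ?_⟩
    · rw [not_isPos_of_root_eq_neg hk'']
      exact hT.not_isPos_apply h2 h3 hk'
    · rw [diagramMap_apply, h1, hk', hk'']

theorem exists_diagramPerm : ∃ τ : Equiv.Perm b.support,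
    ∀ i : b.support, diagramMap P T X (P.root i) = P.root (τ i) :=
  exists_perm_support fun _ hi => hT.diagramMap_isPos hi

theorem apply_eq (x : M) : T x = -longestElement P X (diagramMap P T X x) := by
  rw [diagramMap_apply, map_neg, neg_neg, ← hT.apply_longestElement,
    longestElement_apply_apply hT.subset]

section DiagramPerm

variable {τ : Equiv.Perm b.support}
  (hτ : ∀ i : b.support, diagramMap P T X (P.root i) = P.root (τ i))
include hτ

theorem diagramPerm_diagramPerm (i : b.support) : τ (τ i) = i := by
  apply Subtype.ext
  apply P.root.injective
  rw [← hτ, ← hτ, hT.diagramMap_diagramMap]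

theorem coroot'_diagramMap (i : b.support) (x : M) :
    P.coroot' (τ i) (diagramMap P T X x) = P.coroot' i x :=
  hT.permutesRoots_diagramMap.coroot'_apply (hτ i) x

theorem cartanMatrix_diagramPerm (i j : b.support) :
    b.cartanMatrix (τ i) (τ j) = b.cartanMatrix i j := by
  have h := hT.coroot'_diagramMap hτ j (P.root i)
  rw [hτ, RootPairing.root_coroot'_eq_pairing, RootPairing.root_coroot'_eq_pairing,
    ← P.algebraMap_pairingIn ℤ, ← P.algebraMap_pairingIn ℤ] at h
  exact FaithfulSMul.algebraMap_injective ℤ K h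

/-- T is the identity on the span of X, so that there −T w_X is just −w_X: on the black nodes τ is
the opposition involution of the black diagram. -/
theorem longestElement_root (i : b.support) (hi : (i : ι) ∈ X) :
    longestElement P X (P.root i) = -P.root (τ i) := by
  rw [← hτ, diagramMap_apply, neg_neg, hT.apply_of_mem_span]
  exact apply_mem_span (longestElement_mem X) (Submodule.subset_span ⟨_, hi, rfl⟩)

theorem diagramPerm_mem (i : b.support) (hi : (i : ι) ∈ X) : (τ i : ι) ∈ X := by
  refine mem_of_root_mem_span hT.subset (τ i).2 ?_
  rw [← neg_neg (P.root _), ← hT.longestElement_root hτ i hi]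
  exact neg_mem (apply_mem_span (longestElement_mem X) (Submodule.subset_span ⟨_, hi, rfl⟩))

theorem diagramPerm_mem_iff (i : b.support) : (τ i : ι) ∈ X ↔ (i : ι) ∈ X := by
  refine ⟨fun h => ?_, hT.diagramPerm_mem hτ i⟩
  have := hT.diagramPerm_mem hτ _ h
  rwa [hT.diagramPerm_diagramPerm hτ] at this

/-- T αᵢ = −w_X α_{τ i} is congruent to −α_{τ i} modulo the span of X, and simple roots are
independent. Hence τ is the map that defines the arrows. -/
theorem eq_diagramPerm {i j : b.support} (hi : (i : ι) ∉ X)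
    (h : T (P.root i) + P.root j ∈ Submodule.span K (P.root '' X)) : j = τ i := by
  classical
  have h1 := apply_sub_mem_span (P := P) (longestElement_mem X) (P.root (τ i))
  have h2 : T (P.root i) = -longestElement P X (P.root (τ i)) := by rw [hT.apply_eq, hτ]
  have h3 : P.root (τ i) - P.root j ∈ Submodule.span K (P.root '' X) := by
    have := neg_mem (add_mem h1 h)
    rw [h2] at this
    convert this using 1
    abel
  have hτi : (τ i : ι) ∉ X := fun h => hi ((hT.diagramPerm_mem_iff hτ i).1 h)
  by_contra hne
  have hne' : (τ i : ι) ≠ j := fun h => hne (Subtype.ext h.symm)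
  have := coeff_eq_zero_of_mem_span (b := b)
    (f := fun k => (if k = τ i then 1 else 0) - (if k = j then 1 else 0))
    (by simpa [sub_smul, Finset.sum_sub_distrib] using h3) hT.subset (τ i).2 hτi
  simp [hne'] at this

/-- If J is a union of components of X, then W(X) preserves the span of J, and so does −w_X. Thus τ
cannot move a black node to another component. -/
theorem diagramPerm_mem_of_orthogonal {J : Set ι} (hJX : J ⊆ X)
    (horth : ∀ i ∈ J, ∀ k ∈ X, k ∉ J → P.pairing i k = 0) (i : b.support) (hi : (i : ι) ∈ J) :
    (τ i : ι) ∈ J := by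
  have key : ∀ w ∈ reflectionSubgroup P X, ∀ x ∈ Submodule.span K (P.root '' J),
      w x ∈ Submodule.span K (P.root '' J) := by
    intro w hw
    induction hw using reflectionSubgroup_induction with
    | one => exact fun x hx => hx
    | refl_mul k hk w _ h =>
      intro x hx
      rw [LinearEquiv.mul_apply]
      have hy := h x hx
      generalize w x = y at hy
      induction hy using Submodule.span_induction with
      | mem y hy =>
        obtain ⟨j, hj, rfl⟩ := hy
        rw [RootPairing.reflection_apply_root]
        refine sub_mem (Submodule.subset_span ⟨j, hj, rfl⟩) ?_
        by_cases hkJ : k ∈ J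
        · exact Submodule.smul_mem _ _ (Submodule.subset_span ⟨k, hkJ, rfl⟩)
        · rw [horth j hj k hk hkJ, zero_smul]; exact zero_mem _
      | zero => simp
      | add y z _ _ hy hz => rw [map_add]; exact add_mem hy hz
      | smul a y _ hy => rw [map_smul]; exact Submodule.smul_mem _ _ hy
  refine mem_of_root_mem_span (hJX.trans hT.subset) (τ i).2 ?_
  rw [← neg_neg (P.root _), ← hT.longestElement_root hτ i (hJX hi)]
  exact neg_mem (key _ (longestElement_mem X) _ (Submodule.subset_span ⟨_, hi, rfl⟩))

/-- The functional λ = Σ cⱼ αⱼ∨ is divisible by m on the roots in X, so W(X) preserves its values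
modulo m on integral weights. At the fundamental weight ωᵢ one has λ(ωᵢ) = cᵢ and λ(w_X ωᵢ) = −c_{τ
i}. Suitable c tell apart the possible actions of τ on a component of X. -/
theorem dvd_add_diagramPerm {m : ℤ} {c : b.support → ℤ} (hc0 : ∀ i : b.support, (i : ι) ∉ X → c i = 0)
    (hc : ∀ j : b.support, (j : ι) ∈ X → m ∣ ∑ i : b.support, c i * b.cartanMatrix j i)
    (i : b.support) : m ∣ c i + c (τ i) := by
  classical
  obtain ⟨μ, hμ⟩ := exists_fundamental b i
  have hint : ∀ k, ∃ z : ℤ, P.coroot' k μ = z := coroot'_integral (b := b) fun j hj =>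
    ⟨if (⟨j, hj⟩ : b.support) = i then 1 else 0, by rw [hμ ⟨j, hj⟩]; split_ifs <;> simp⟩
  let c' : ι → ℤ := fun k => if h : k ∈ b.support then c ⟨k, h⟩ else 0
  have hc' : ∀ j : b.support, c' j = c j := fun j => by simp [c']
  obtain ⟨z, hz⟩ := exists_sum_coroot_apply_sub_eq (b := b) (c := c') (m := m)
    (longestElement_mem (P := P) X) (fun j hj => by
      have := hc ⟨j, hT.subset hj⟩ hj
      rw [← Finset.sum_coe_sort b.support]
      simp only [hc']; exact this) hint
  -- −w_X permutes the roots of the black nodes by τ, hence their coroots too.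
  have hnw : ∀ j : b.support, (j : ι) ∈ X →
      P.coroot' j (longestElement P X μ) = -P.coroot' (τ j) μ := by
    intro j hj
    have h1 : PermutesRoots P (LinearEquiv.neg K * longestElement P X) :=
      (permutesRoots_of_mem (longestElement_mem X)).neg
    have h2 : (LinearEquiv.neg K * longestElement P X : M ≃ₗ[K] M) (P.root (τ j)) =
        P.root j := by
      rw [LinearEquiv.mul_apply, hT.longestElement_root hτ _ (hT.diagramPerm_mem hτ j hj),
        hT.diagramPerm_diagramPerm hτ, LinearEquiv.neg_apply, neg_neg]
    have h3 := h1.coroot'_apply h2 μ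
    rw [LinearEquiv.mul_apply, LinearEquiv.neg_apply, map_neg] at h3
    rw [← h3, neg_neg]
  refine ⟨-z, ?_⟩
  have : ((c i + c (τ i) : ℤ) : K) = ((m * -z : ℤ) : K) := by
    rw [← Finset.sum_coe_sort b.support] at hz
    have h4 : ∀ j : b.support, ((c' j : ℤ) : K) * P.coroot' j (longestElement P X μ - μ) =
        -((if j = τ i then (c j : K) else 0) + (if j = i then (c j : K) else 0)) := by
      intro j
      rw [hc']
      by_cases hj : (j : ι) ∈ X
      · rw [map_sub, hnw j hj, hμ, hμ]
        have : τ j = i ↔ j = τ i :=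
          ⟨fun h => by rw [← h, hT.diagramPerm_diagramPerm hτ],
            fun h => by rw [h, hT.diagramPerm_diagramPerm hτ]⟩
        simp only [this]
        split_ifs <;> ring
      · simp [hc0 j hj]
    rw [Finset.sum_congr rfl fun j _ => h4 j, Finset.sum_neg_distrib, Finset.sum_add_distrib,
      Finset.sum_ite_eq' , Finset.sum_ite_eq'] at hz
    simp only [Finset.mem_univ, if_true] at hz
    push_cast
    rw [mul_neg, ← hz]; ring
  exact_mod_cast this

end DiagramPerm

end IsSplitInvolution

end SplitInvolution

end SymPair

end

/-! ### From θ to Θ; an involution without white nodes is trivial -/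

noncomputable section
namespace SymPair

set_option linter.unusedSectionVars false

open LieAlgebra LieAlgebra.IsKilling LieModule

section Lie

variable {L : Type*} [LieRing L] [LieAlgebra ℂ L] [FiniteDimensional ℂ L]
  [LieAlgebra.IsSemisimple ℂ L] {H : LieSubalgebra ℂ L} [H.IsCartanSubalgebra]

theorem mem_rootSpace_of_forall_lie {χ : H → ℂ} {x : L} (h : ∀ y : H, ⁅(y : L), x⁆ = χ y • x) :
    x ∈ rootSpace H χ :=
  weightSpace_le_genWeightSpace L χ (by rw [mem_weightSpace]; exact h)

theorem exists_root_eq_of_mem_rootSpace {μ : Dual ℂ H} (hμ : μ ≠ 0) {x : L}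
    (hx : x ∈ rootSpace H μ) (hx0 : x ≠ 0) : ∃ k : H.root, (rootSystem H).root k = μ := by
  have hne : genWeightSpace L (μ : H → ℂ) ≠ ⊥ := fun h => hx0 (by
    have : x ∈ (⊥ : LieSubmodule ℂ H L) := h ▸ hx
    simpa using this)
  let α : Weight ℂ H L := ⟨μ, hne⟩
  have hα : α.IsNonZero := fun h => hμ (by
    ext y; exact congrFun h y)
  refine ⟨⟨α, by simpa [LieSubalgebra.root] using hα⟩, ?_⟩
  ext y; rfl

theorem exists_mem_rootSpace_ne_zero (k : H.root) : ∃ x ∈ rootSpace H k.1, x ≠ 0 :=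
  k.1.exists_ne_zero

theorem mem_rootSpace_root {k : H.root} {x : L} :
    x ∈ rootSpace H ((rootSystem H).root k) ↔ x ∈ rootSpace H k.1 := Iff.rfl

theorem eq_of_mem_rootSpace {μ ν : H → ℂ} {x : L} (hx : x ∈ rootSpace H μ)
    (hx' : x ∈ rootSpace H ν) (hx0 : x ≠ 0) : μ = ν := by
  ext y
  have h1 := lie_eq_smul_of_mem_rootSpace hx y
  rw [lie_eq_smul_of_mem_rootSpace hx' y] at h1
  exact (smul_left_injective ℂ hx0 h1).symm

variable {b : (rootSystem H).Base} {θ : L ≃ₗ⁅ℂ⁆ L} (hi : ∀ x, θ (θ x) = x)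
  (hs : IsMaximallySplit b θ)

theorem bigTheta_apply (μ : Dual ℂ H) (y : H) :
    bigTheta hs μ y = μ ⟨θ y, hs.map_cartan y y.2⟩ := rfl

include hi in
theorem bigTheta_bigTheta (μ : Dual ℂ H) : bigTheta hs (bigTheta hs μ) = μ := by
  ext y
  rw [bigTheta_apply, bigTheta_apply]
  congr 1
  exact Subtype.ext (hi y)

/-- `Θ` as a linear automorphism. -/
def bigThetaEquiv : Dual ℂ H ≃ₗ[ℂ] Dual ℂ H :=
  LinearEquiv.ofInvolutive (bigTheta hs) (bigTheta_bigTheta hi hs)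

theorem bigThetaEquiv_apply (μ : Dual ℂ H) : bigThetaEquiv hi hs μ = bigTheta hs μ := rfl

include hi in
theorem map_mem_rootSpace {μ : Dual ℂ H} {x : L} (hx : x ∈ rootSpace H μ) :
    θ x ∈ rootSpace H (bigTheta hs μ) := by
  refine mem_rootSpace_of_forall_lie fun y => ?_
  have h := lie_eq_smul_of_mem_rootSpace hx ⟨θ y, hs.map_cartan y y.2⟩
  have h2 : ⁅θ (y : L), x⁆ = bigTheta hs μ y • x := h
  have h3 := congrArg θ h2
  rwa [LieEquiv.map_lie, hi, map_smul] at h3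

theorem permutesRoots_bigThetaEquiv : PermutesRoots (rootSystem H) (bigThetaEquiv hi hs) := by
  intro k
  obtain ⟨x, hx, hx0⟩ := exists_mem_rootSpace_ne_zero k
  have hx' : θ x ∈ rootSpace H (bigTheta hs ((rootSystem H).root k)) :=
    map_mem_rootSpace hi hs hx
  obtain ⟨j, hj⟩ := exists_root_eq_of_mem_rootSpace (μ := bigThetaEquiv hi hs ((rootSystem H).root k))
    (by rw [ne_eq, LinearEquiv.map_eq_zero_iff]; exact (rootSystem H).ne_zero k) hx'
    (by rwa [ne_eq, EmbeddingLike.map_eq_zero_iff])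
  exact ⟨j, hj.symm⟩

-- The transpose of Θ is the restriction of θ to the Cartan subalgebra, and it permutes the coroots
-- in the way Θ permutes the roots.
include hi in
theorem map_coroot {j k : H.root}
    (h : bigTheta hs ((rootSystem H).root j) = (rootSystem H).root k) :
    θ ((rootSystem H).coroot j) = (rootSystem H).coroot k := by
  have h2 : (⟨θ ((rootSystem H).coroot k), hs.map_cartan _ ((rootSystem H).coroot k).2⟩ : H) =
      (rootSystem H).coroot j := by
    refine sub_eq_zero.1 ((Module.forall_dual_apply_eq_zero_iff ℂ _).1 fun φ => ?_)
    rw [map_sub, sub_eq_zero]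
    exact (permutesRoots_bigThetaEquiv hi hs).coroot'_apply (i := j) (j := k) h φ
  have h3 := congrArg (fun y : H => θ y) h2
  simp only [hi] at h3
  exact h3.symm

theorem fixedSimpleRoots_subset : fixedSimpleRoots hs ⊆ b.support := fun _ h => h.1

include hi in
theorem fixed_of_mem {j : H.root} (hj : j ∈ fixedSimpleRoots hs) :
    (∀ x ∈ rootSpace H j.1, θ x = x) ∧ (∀ x ∈ rootSpace H (-(j.1 : H → ℂ)), θ x = x) :=
  hs.fixed j hj.1 (map_coroot hi hs hj.2)

theorem isSplitInvolution :
    IsSplitInvolution b (bigThetaEquiv hi hs) (fixedSimpleRoots hs) where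
  permutesRoots := permutesRoots_bigThetaEquiv hi hs
  involutive := bigTheta_bigTheta hi hs
  subset := fixedSimpleRoots_subset hs
  fixed := fun _ hj => hj.2
  moved := by
    intro j hj hjX k hk
    -- If θ fixes the coroot, then Θ fixes the root, and the node is black.
    have hne : θ ((rootSystem H).coroot j) ≠ (rootSystem H).coroot j := by
      intro h
      have h1 := map_coroot hi hs hk
      have : j = k := (rootSystem H).coroot.injective (Subtype.ext (by rw [← h1, h]))
      subst this
      exact hjX ⟨hj, hk⟩
    obtain ⟨β, hβ, h⟩ := (hs.moved j hj hne).1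
    obtain ⟨x, hx, hx0⟩ := exists_mem_rootSpace_ne_zero j
    have h1 := h x hx
    have h2 : θ x ∈ rootSpace H (bigTheta hs ((rootSystem H).root j)) :=
      map_mem_rootSpace hi hs hx
    have h3 := eq_of_mem_rootSpace h1 h2 (by rwa [ne_eq, EmbeddingLike.map_eq_zero_iff])
    have h4 : (rootSystem H).root k = -(rootSystem H).root β := by
      rw [← hk]
      ext y; exact (congrFun h3 y).symm
    rw [not_isPos_of_root_eq_neg h4]
    exact not_not.2 hβ

theorem killingForm_map_map (x y : L) :
    killingForm ℂ L (θ x) (θ y) = killingForm ℂ L x y :=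
  killingForm_of_equiv_apply θ x y

theorem killingForm_lie_left (e x y : L) :
    killingForm ℂ L ⁅e, x⁆ y = -killingForm ℂ L x ⁅e, y⁆ := by
  rw [← lie_skew, map_neg, LinearMap.neg_apply, LieModule.traceForm_apply_lie_apply]

theorem eq_zero_of_forall_killingForm {μ : H → ℂ} {x : L} (hx : x ∈ rootSpace H μ)
    (h : ∀ y ∈ rootSpace H (-μ), killingForm ℂ L x y = 0) : x = 0 := by
  simpa using mem_ker_killingForm_of_mem_rootSpace_of_forall_rootSpace_neg ℂ L H hx h

theorem exists_simpleTriple (k : H.root) : ∃ e f : L,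
    IsSl2Triple ((rootSystem H).coroot k : L) e f ∧ e ∈ rootSpace H k.1 ∧
      f ∈ rootSpace H (-(k.1 : H → ℂ)) := by
  obtain ⟨h, e, f, ht, he, hf⟩ := exists_isSl2Triple_of_weight_isNonZero
    (LieSubalgebra.isNonZero_coe_root k)
  have := ht.h_eq_coroot (LieSubalgebra.isNonZero_coe_root k) he hf
  subst this
  exact ⟨e, f, ht, he, hf⟩

-- This rules out diagrams with black nodes only. As Θ = 1, the map θ is trivial on the Cartan
-- subalgebra and preserves every root space. On positive root spaces it is trivial by induction on
-- the height, through the subtraction of a simple root; on the negative ones by duality for the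
-- Killing form.
include hi in
theorem forall_eq_of_fixed_eq_support (h : ∀ j ∈ b.support, j ∈ fixedSimpleRoots hs) (x : L) :
    θ x = x := by
  have hΘ : ∀ μ, bigTheta hs μ = μ := by
    intro μ
    have h1 : bigTheta hs = LinearMap.id := b.toWeightBasis.ext fun j => by
      rw [b.toWeightBasis_apply]; exact (h j j.2).2
    rw [h1]; rfl
  have hcartan : ∀ y : H, θ y = y := by
    intro y
    have : (⟨θ y, hs.map_cartan y y.2⟩ : H) = y := by
      refine sub_eq_zero.1 ((Module.forall_dual_apply_eq_zero_iff ℂ _).1 fun φ => ?_)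
      rw [map_sub, sub_eq_zero]
      exact LinearMap.congr_fun (hΘ φ) y
    exact congrArg Subtype.val this
  have hmap : ∀ {μ : Dual ℂ H} {x : L}, x ∈ rootSpace H μ → θ x ∈ rootSpace H μ := by
    intro μ x hx
    have := map_mem_rootSpace hi hs hx
    rwa [hΘ] at this
  have hpos : ∀ n : ℕ, ∀ k, b.IsPos k → (b.height k).natAbs ≤ n → ∀ x ∈ rootSpace H k.1, θ x = x := by
    intro n
    induction n with
    | zero =>
      intro k _ hn
      have := b.height_ne_zero k
      omega
    | succ n ih =>
      intro k hk hn x hx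
      obtain ⟨j, hj, hjk⟩ := hk.exists_mem_support_pos_pairingIn
      rw [RootPairing.zero_lt_pairingIn_iff'] at hjk
      rcases eq_or_ne k j with rfl | hne
      · exact (fixed_of_mem hi hs (h k hj)).1 x hx
      obtain ⟨i, hi'⟩ := (rootSystem H).root_sub_root_mem_of_pairingIn_pos hjk hne
      have hht := b.height_sub hi'
      rw [RootPairing.Base.height_one_of_mem_support hj] at hht
      have hipos : b.IsPos i := hk.sub hj hi'
      obtain ⟨e, f, ht, he, hf⟩ := exists_simpleTriple j
      have hf' : θ f = f := (fixed_of_mem hi hs (h j hj)).2 f hf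
      have hfx : ⁅f, x⁆ ∈ rootSpace H i.1 := by
        have h1 := lie_mem_genWeightSpace_of_mem_genWeightSpace hf hx
        have h2 : (-(j.1 : H → ℂ) + (k.1 : H → ℂ)) = (i.1 : H → ℂ) := by
          ext y
          have := LinearMap.congr_fun hi' y
          simp only [rootSystem_root_apply, LinearMap.sub_apply, Weight.toLinear_apply] at this
          simp [this]; ring
        rwa [h2] at h1
      rw [RootPairing.Base.isPos_iff] at hipos hk
      have hfix := ih i hipos (by omega) _ hfx
      by_contra hne'
      -- By induction θ fixes [fⱼ, x], so fⱼ annihilates θx − x. If nonzero, this would be a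
      -- primitive vector for the reversed triple, of weight −⟨αₖ, αⱼ∨⟩. Weights of primitive
      -- vectors are natural numbers, whereas j was chosen to make this one negative.
      have hprim : ht.symm.HasPrimitiveVectorWith (θ x - x)
          (-((rootSystem H).pairing k j)) :=
        { ne_zero := sub_ne_zero.2 hne'
          lie_h := by
            have hmem : θ x - x ∈ rootSpace H k.1 :=
              sub_mem (hmap (μ := (rootSystem H).root k) hx) hx
            have := lie_eq_smul_of_mem_rootSpace hmem ((rootSystem H).coroot j)
            rw [neg_lie, neg_smul]
            exact congrArg Neg.neg this
          lie_e := by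
            rw [lie_sub, ← hfix, LieEquiv.map_lie, hf', sub_self] }
      obtain ⟨m, hm⟩ := hprim.exists_nat
      have h0 : (((rootSystem H).pairingIn ℤ k j : ℤ) : ℂ) = (rootSystem H).pairing k j :=
        (rootSystem H).algebraMap_pairingIn ℤ k j
      rw [← h0] at hm
      have : -((rootSystem H).pairingIn ℤ k j) = m := by exact_mod_cast hm
      omega
  have hpos' : ∀ k, b.IsPos k → ∀ x ∈ rootSpace H k.1, θ x = x := fun k hk =>
    hpos _ k hk le_rfl
  have hroot : ∀ k : H.root, ∀ x ∈ rootSpace H k.1, θ x = x := by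
    intro k x hx
    by_cases hk : b.IsPos k
    · exact hpos' k hk x hx
    obtain ⟨k', hk'⟩ := exists_root_eq_neg (P := rootSystem H) k
    have hk'pos := (not_isPos_of_root_eq_neg (b := b) hk').2 hk
    rw [← sub_eq_zero]
    refine eq_zero_of_forall_killingForm (μ := k.1)
      (sub_mem (hmap (μ := (rootSystem H).root k) hx) hx) fun y hy => ?_
    have hy' : y ∈ rootSpace H k'.1 := by
      have : (-(k.1 : H → ℂ)) = (k'.1 : H → ℂ) := by
        ext y
        exact (LinearMap.congr_fun hk' y).symm
      rwa [this] at hy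
    rw [map_sub, LinearMap.sub_apply, sub_eq_zero]
    conv_lhs => rw [← hpos' k' hk'pos y hy']
    exact killingForm_map_map x y
  have htop : x ∈ ⨆ χ : H → ℂ, (rootSpace H χ).toSubmodule := by
    rw [← LieSubmodule.iSup_toSubmodule, iSup_genWeightSpace_eq_top]; trivial
  refine Submodule.iSup_induction _ (motive := fun x => θ x = x) htop (fun χ x hx => ?_)
    (by simp) fun x y hx hy => by rw [map_add, hx, hy]
  by_cases hx0 : x = 0
  · simp [hx0]
  by_cases hχ : χ = 0
  · subst hχ
    have : x ∈ H := by
      have h1 : x ∈ rootSpace H (0 : H → ℂ) := hx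
      rwa [rootSpace_zero_eq] at h1
    exact hcartan ⟨x, this⟩
  · have hne : genWeightSpace L χ ≠ ⊥ := fun h => hx0 (by
      have : x ∈ (⊥ : LieSubmodule ℂ H L) := h ▸ hx
      simpa using this)
    let α : Weight ℂ H L := ⟨χ, hne⟩
    have hα : α.IsNonZero := hχ
    exact hroot ⟨α, by simpa [LieSubalgebra.root] using hα⟩ x hx

end Lie

end SymPair

end

/-! ### The parity condition at white nodes fixed by τ -/

noncomputable section
namespace SymPair

set_option linter.unusedSectionVars false

open LieAlgebra LieAlgebra.IsKilling LieModule

section Parity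

variable {L : Type*} [LieRing L] [LieAlgebra ℂ L] [FiniteDimensional ℂ L]
  [LieAlgebra.IsSemisimple ℂ L] {H : LieSubalgebra ℂ L} [H.IsCartanSubalgebra]
  {b : (rootSystem H).Base} {θ : L ≃ₗ⁅ℂ⁆ L}

theorem killingForm_pow_ad (e : L) (m : ℕ) (x y : L) :
    killingForm ℂ L ((toEnd ℂ L L e ^ m) x) y =
      (-1) ^ m * killingForm ℂ L x ((toEnd ℂ L L e ^ m) y) := by
  induction m generalizing y with
  | zero => simp
  | succ m ih =>
    have h : (toEnd ℂ L L e ^ (m + 1)) y = (toEnd ℂ L L e ^ m) ⁅e, y⁆ := by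
      rw [pow_succ, Module.End.mul_apply, toEnd_apply_apply]
    rw [h, pow_succ', Module.End.mul_apply, toEnd_apply_apply, killingForm_lie_left, ih]
    ring

theorem map_pow_ad {e : L} (he : θ e = e) (m : ℕ) (x : L) :
    θ ((toEnd ℂ L L e ^ m) x) = (toEnd ℂ L L e ^ m) (θ x) := by
  induction m with
  | zero => simp
  | succ m ih =>
    rw [pow_succ', Module.End.mul_apply, Module.End.mul_apply, toEnd_apply_apply,
      toEnd_apply_apply, LieEquiv.map_lie, he, ih]

/-- The weights obtained from `μ` by adding `m` simple roots that belong to `X`. -/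
def shiftedWeights (X : Set H.root) (μ : Dual ℂ H) (m : ℕ) : Set (Dual ℂ H) :=
  {ν | ∃ c : H.root → ℕ, (∀ j ∉ X, c j = 0) ∧ ∑ j, c j = m ∧
    ν = μ + ∑ j, c j • (rootSystem H).root j}

theorem pow_ad_mem {X : Set H.root} {e : H.root → L} (he : ∀ j, e j ∈ rootSpace H j.1)
    (heX : ∀ j ∉ X, e j = 0) {μ : Dual ℂ H} {v : L} (hv : v ∈ rootSpace H μ) (m : ℕ) :
    (toEnd ℂ L L (∑ j, e j) ^ m) v ∈
      ⨆ ν ∈ shiftedWeights X μ m, (rootSpace H (ν : H → ℂ)).toSubmodule := by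
  induction m with
  | zero =>
    refine Submodule.mem_iSup_of_mem μ (Submodule.mem_iSup_of_mem ⟨0, by simp⟩ ?_)
    simpa using hv
  | succ m ih =>
    rw [pow_succ', Module.End.mul_apply, toEnd_apply_apply]
    revert ih
    generalize (toEnd ℂ L L (∑ j, e j) ^ m) v = u
    intro hu
    rw [← LieModule.toEnd_apply_apply ℂ L L, ← Submodule.mem_comap]
    refine (iSup₂_le fun ν hν x hx => ?_ :
      (⨆ ν ∈ shiftedWeights X μ m, (rootSpace H (ν : H → ℂ)).toSubmodule) ≤ _) hu
    rw [Submodule.mem_comap, toEnd_apply_apply, sum_lie]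
    refine Submodule.sum_mem _ fun j _ => ?_
    by_cases hj : j ∈ X
    · obtain ⟨c, hc, hcm, rfl⟩ := hν
      classical
      refine Submodule.mem_iSup_of_mem ((rootSystem H).root j + (μ + ∑ j, c j • (rootSystem H).root j))
        (Submodule.mem_iSup_of_mem ⟨c + Pi.single j 1, fun i hiX => ?_, ?_, ?_⟩ ?_)
      · have : i ≠ j := fun h => hiX (h ▸ hj)
        simp [hc i hiX, this]
      · simp only [Pi.add_apply, Finset.sum_add_distrib, hcm]
        rw [Finset.sum_pi_single']; simp
      · have : ∑ x, (Pi.single j 1 : H.root → ℕ) x • (rootSystem H).root x = (rootSystem H).root j := by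
          rw [Finset.sum_eq_single j]
          · simp
          · intro i _ hij; simp [hij]
          · simp
        simp only [Pi.add_apply, add_smul, Finset.sum_add_distrib, this]
        abel
      · exact lie_mem_genWeightSpace_of_mem_genWeightSpace (he j) hx
    · rw [heX j hj, zero_lie]; exact zero_mem _

theorem lie_eq_zero_of_support {i j : H.root} (hi : i ∈ b.support) (hj : j ∈ b.support)
    (hij : i ≠ j) {x y : L} (hx : x ∈ rootSpace H i.1) (hy : y ∈ rootSpace H (-(j.1 : H → ℂ))) :
    ⁅x, y⁆ = 0 := by
  by_contra hne
  have h1 : ⁅x, y⁆ ∈ rootSpace H ((i.1 : H → ℂ) + -(j.1 : H → ℂ)) :=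
    lie_mem_genWeightSpace_of_mem_genWeightSpace hx hy
  have h2 : ⁅x, y⁆ ∈ rootSpace H ((rootSystem H).root i - (rootSystem H).root j : Dual ℂ H) := by
    have : (((rootSystem H).root i - (rootSystem H).root j : Dual ℂ H) : H → ℂ) =
      (i.1 : H → ℂ) + -(j.1 : H → ℂ) := by
        ext y
        exact sub_eq_add_neg _ _
    rwa [this]
  obtain ⟨k, hk⟩ := exists_root_eq_of_mem_rootSpace
    (sub_ne_zero.2 fun h => hij ((rootSystem H).root.injective h)) h2 hne
  exact b.sub_notMem_range_root hi hj ⟨k, hk⟩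

variable (hi : ∀ x, θ (θ x) = x) (hs : IsMaximallySplit b θ)

include hi in
/-- If `T αᵢ ∈ -αᵢ + ℤ π_Θ` for a white node `i`, then `αᵢ(h)` is even, for the element `h` of the
span of the black coroots with `αⱼ(h) = 2` for the black nodes `j`. -/
theorem even_of_map_mem {i : H.root} (hib : i ∈ b.support) (hiX : i ∉ fixedSimpleRoots hs)
    (hi' : bigTheta hs ((rootSystem H).root i) + (rootSystem H).root i ∈
      Submodule.span ℂ ((rootSystem H).root '' fixedSimpleRoots hs))
    {n : H.root → ℤ} (hn : ∀ j ∉ fixedSimpleRoots hs, n j = 0)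
    (hn2 : ∀ j ∈ fixedSimpleRoots hs, ∑ k, n k * (rootSystem H).pairingIn ℤ j k = 2) :
    Even (∑ k, n k * (rootSystem H).pairingIn ℤ i k) := by
  classical
  set X := fixedSimpleRoots hs with hX
  have hXb : X ⊆ b.support := fixedSimpleRoots_subset hs
  rcases X.eq_empty_or_nonempty with h0 | ⟨j₀, hj₀⟩
  · have : ∀ k, n k = 0 := fun k => hn k (by simp [h0])
    simp [this]
  choose e f ht he hf using exists_simpleTriple (H := H)
  let h : H := ∑ k, n k • (rootSystem H).coroot k
  have hroot : ∀ j, (rootSystem H).root j h =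
      ((∑ k, n k * (rootSystem H).pairingIn ℤ j k : ℤ) : ℂ) := by
    intro j
    simp only [h, map_sum, Int.cast_sum]
    refine Finset.sum_congr rfl fun k _ => ?_
    have h0 : (((rootSystem H).pairingIn ℤ j k : ℤ) : ℂ) = (rootSystem H).pairing j k :=
      (rootSystem H).algebraMap_pairingIn ℤ j k
    rw [map_zsmul, Int.cast_mul, h0, zsmul_eq_mul]; rfl
  have hroot2 : ∀ j ∈ X, (rootSystem H).root j h = 2 := fun j hj => by
    rw [hroot, hn2 j hj]; norm_num
  let e' : H.root → L := fun j => if j ∈ X then e j else 0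
  have he' : ∀ j, e' j ∈ rootSpace H j.1 := fun j => by
    simp only [e']; split_ifs
    · exact he j
    · exact zero_mem _
  have heX : ∀ j ∉ X, e' j = 0 := fun j hj => by simp [e', hj]
  set E : L := ∑ j, e' j with hE
  let F : L := ∑ k, n k • f k
  have hθE : θ E = E := by
    rw [hE, map_sum]
    refine Finset.sum_congr rfl fun j _ => ?_
    by_cases hj : j ∈ X
    · exact (fixed_of_mem hi hs hj).1 _ (he' j)
    · rw [heX j hj, map_zero]
  have hEF : ⁅E, F⁆ = (h : L) := by
    simp only [F, hE, sum_lie, lie_sum, h]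
    rw [Finset.sum_comm]
    have : ((∑ k, n k • (rootSystem H).coroot k : H) : L) =
        ∑ k, n k • ((rootSystem H).coroot k : L) := by
      rw [AddSubmonoidClass.coe_finsetSum]; rfl
    rw [this]
    refine Finset.sum_congr rfl fun k _ => ?_
    by_cases hk : k ∈ X
    · rw [Finset.sum_eq_single k]
      · simp only [e', hk, if_true, lie_zsmul, (ht k).lie_e_f]
      · intro j _ hjk
        by_cases hj : j ∈ X
        · simp only [e', hk, if_true, lie_zsmul]
          rw [lie_eq_zero_of_support (hXb hk) (hXb hj) hjk.symm (he k) (hf j), smul_zero]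
        · rw [hn j hj, zero_smul, lie_zero]
      · simp
    · rw [heX k hk, hn k hk, zero_smul]
      exact Finset.sum_eq_zero fun j _ => zero_lie _
  have hhE : ⁅(h : L), E⁆ = 2 • E := by
    rw [hE, lie_sum, Finset.smul_sum]
    refine Finset.sum_congr rfl fun j _ => ?_
    by_cases hj : j ∈ X
    · have := lie_eq_smul_of_mem_rootSpace (he' j) h
      have h2 : (j.1 : H → ℂ) h = 2 := hroot2 j hj
      rw [h2] at this
      rw [two_smul] at this
      rw [two_smul]; exact this
    · rw [heX j hj]; simp
  have hhF : ⁅(h : L), F⁆ = -(2 • F) := by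
    rw [lie_sum, Finset.smul_sum, ← Finset.sum_neg_distrib]
    refine Finset.sum_congr rfl fun j _ => ?_
    by_cases hj : j ∈ X
    · have := lie_eq_smul_of_mem_rootSpace (hf j) h
      have h2 : (j.1 : H → ℂ) h = 2 := hroot2 j hj
      rw [Pi.neg_apply, h2, neg_smul, two_smul] at this
      have h3 : ⁅(h : L), f j⁆ = -(f j + f j) := this
      rw [lie_zsmul, h3, two_smul]; simp
    · rw [hn j hj]; simp
  have hh0 : (h : L) ≠ 0 := fun h0 => by
    have h1 : h = 0 := Subtype.ext h0
    have := hroot2 j₀ hj₀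
    rw [h1, map_zero] at this
    norm_num at this
  have ht' : IsSl2Triple (h : L) E F := ⟨hh0, hEF, hhE, hhF⟩
  obtain ⟨v, hv, hv0⟩ := exists_mem_rootSpace_ne_zero i
  have hprim : ht'.symm.HasPrimitiveVectorWith v (-((rootSystem H).root i h)) :=
    { ne_zero := hv0
      lie_h := by
        rw [neg_lie, neg_smul]
        exact congrArg Neg.neg (lie_eq_smul_of_mem_rootSpace hv h)
      lie_e := by
        rw [sum_lie]
        refine Finset.sum_eq_zero fun k _ => ?_
        by_cases hk : k ∈ X
        · have hik : i ≠ k := fun h => hiX (h ▸ hk)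
          rw [zsmul_lie, ← lie_skew, lie_eq_zero_of_support hib (hXb hk) hik hv (hf k)]
          simp
        · rw [hn k hk]; simp }
  obtain ⟨m, hm⟩ := hprim.exists_nat
  have hm' : ∑ k, n k * (rootSystem H).pairingIn ℤ i k = -m := by
    rw [hroot] at hm
    have : ((∑ k, n k * (rootSystem H).pairingIn ℤ i k : ℤ) : ℂ) = ((-m : ℤ) : ℂ) := by
      rw [← neg_neg ((∑ k, n k * (rootSystem H).pairingIn ℤ i k : ℤ) : ℂ), hm]; push_cast; rfl
    exact_mod_cast this
  have hne := hprim.pow_toEnd_f_ne_zero_of_eq_nat hm le_rfl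
  set u := (toEnd ℂ L L E ^ m) v with hu
  have hT := isSplitInvolution hi hs
  -- the vector `u` has weight `-Θ αᵢ`
  have hmem : u ∈ rootSpace H (-bigTheta hs ((rootSystem H).root i) : Dual ℂ H) := by
    have h1 := pow_ad_mem he' heX (μ := (rootSystem H).root i) hv m
    refine (iSup₂_le fun ν hν x hx => ?_ :
      (⨆ ν ∈ shiftedWeights X ((rootSystem H).root i) m, (rootSpace H (ν : H → ℂ)).toSubmodule) ≤
        (rootSpace H (-bigTheta hs ((rootSystem H).root i) : Dual ℂ H)).toSubmodule) h1
    by_cases hx0 : x = 0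
    · rw [hx0]; exact zero_mem _
    obtain ⟨c, hc, hcm, rfl⟩ := hν
    set s : Dual ℂ H := ∑ j, c j • (rootSystem H).root j with hs'
    have hsX : s ∈ Submodule.span ℂ ((rootSystem H).root '' X) :=
      Submodule.sum_mem _ fun j _ => by
        by_cases hj : j ∈ X
        · have hj' : (rootSystem H).root j ∈ Submodule.span ℂ ((rootSystem H).root '' X) :=
            Submodule.subset_span ⟨j, hj, rfl⟩
          exact Submodule.smul_of_tower_mem _ _ hj'
        · rw [hc j hj, zero_smul]; exact zero_mem _
    have hνX : (rootSystem H).root i + s ≠ 0 := fun h0 => by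
      have : (rootSystem H).root i ∈ Submodule.span ℂ ((rootSystem H).root '' X) := by
        rw [eq_neg_of_add_eq_zero_left h0]; exact neg_mem hsX
      exact hiX (mem_of_root_mem_span hXb hib this)
    obtain ⟨k, hk⟩ := exists_root_eq_of_mem_rootSpace hνX hx hx0
    -- A weight occurring in u has the form αᵢ + s, with s in the span of X fixed by Θ. The root
    -- −Θ(αᵢ + s) = −Θαᵢ − s will turn out to be αᵢ, which identifies αᵢ + s with −Θαᵢ.
    obtain ⟨k₁, hk₁⟩ := permutesRoots_bigThetaEquiv hi hs k
    obtain ⟨k₂, hk₂⟩ := exists_root_eq_neg (P := rootSystem H) k₁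
    have hΘs : bigTheta hs s = s := hT.apply_of_mem_span hsX
    have hk₂' : (rootSystem H).root k₂ = -bigTheta hs ((rootSystem H).root i) - s := by
      rw [hk₂, ← hk₁, hk, bigThetaEquiv_apply, map_add, hΘs]; abel
    -- both roots have coefficient `1` at `αᵢ`
    obtain ⟨a, ha, hapos, haneg⟩ := exists_int_coeff b k₂
    have hdiff : ∑ j ∈ b.support, (a j - if j = i then 1 else 0) • (rootSystem H).root j ∈
        Submodule.span ℂ ((rootSystem H).root '' X) := by
      have h2 : ∑ j ∈ b.support, (a j - if j = i then 1 else 0) • (rootSystem H).root j =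
          -(bigTheta hs ((rootSystem H).root i) + (rootSystem H).root i) - s := by
        simp only [sub_smul, Finset.sum_sub_distrib, ite_smul, one_smul, zero_smul,
          Finset.sum_ite_eq', hib, if_true]
        rw [← ha, hk₂']; abel
      rw [h2]
      exact sub_mem (neg_mem hi') hsX
    have hai : a i = 1 := by
      have := coeff_eq_zero_of_mem_span hdiff hXb hib hiX
      simpa [sub_eq_zero] using this
    have hpos : 0 ≤ a := by
      by_cases hp : b.IsPos k₂
      · exact hapos hp
      · have := haneg hp i
        rw [hai] at this; norm_num at this
    have haX : ∀ j ∈ b.support, j ∉ X → j ≠ i → a j = 0 := by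
      intro j hj hjX hji
      have := coeff_eq_zero_of_mem_span hdiff hXb hj hjX
      simpa [hji] using this
    -- the value at `h` shows that the other coefficients vanish
    have hval1 : (rootSystem H).root k₂ h = -m := by
      rw [hk₂', LinearMap.sub_apply, LinearMap.neg_apply]
      have h3 : bigTheta hs ((rootSystem H).root i) h = (rootSystem H).root i h := by
        rw [bigTheta_apply]
        congr 1
        apply Subtype.ext
        have : ((h : H) : L) = ∑ k, n k • ((rootSystem H).coroot k : L) := by
          simp only [h]
          rw [AddSubmonoidClass.coe_finsetSum]; rfl
        simp only
        rw [this, map_sum]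
        refine Finset.sum_congr rfl fun k _ => ?_
        by_cases hkX : k ∈ X
        · rw [map_zsmul, map_coroot hi hs hkX.2]
        · rw [hn k hkX]; simp
      have h4 : s h = 2 * m := by
        rw [hs', LinearMap.sum_apply, ← hcm]
        push_cast
        rw [Finset.mul_sum]
        refine Finset.sum_congr rfl fun j _ => ?_
        by_cases hj : j ∈ X
        · rw [LinearMap.smul_apply, hroot2 j hj]; simp; ring
        · rw [hc j hj]; simp
      rw [h3, h4, hm]; ring
    have hval2 : (rootSystem H).root k₂ h =
        (rootSystem H).root i h + 2 * ∑ j ∈ b.support.erase i, (a j : ℂ) := by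
      conv_lhs => rw [ha]
      rw [← Finset.add_sum_erase _ _ hib, LinearMap.add_apply, hai, one_smul, LinearMap.sum_apply,
        Finset.mul_sum]
      congr 1
      refine Finset.sum_congr rfl fun j hj => ?_
      rw [Finset.mem_erase] at hj
      rw [LinearMap.smul_apply]
      by_cases hjX : j ∈ X
      · rw [hroot2 j hjX]; simp; ring
      · rw [haX j hj.2 hjX hj.1]; simp
    have hsum : ∑ j ∈ b.support.erase i, a j = 0 := by
      have h5 : (rootSystem H).root i h = -m := by rw [← hm, neg_neg]
      rw [hval1, h5] at hval2
      have h6 : (∑ j ∈ b.support.erase i, (a j : ℂ)) = 0 := by linear_combination -hval2 / 2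
      exact_mod_cast h6
    have hk₂i : (rootSystem H).root k₂ = (rootSystem H).root i := by
      rw [ha, ← Finset.add_sum_erase _ _ hib, hai, one_smul, Finset.sum_eq_zero, add_zero]
      intro j hj
      rw [(Finset.sum_eq_zero_iff_of_nonneg fun j _ => hpos j).1 hsum j hj, zero_smul]
    have hfin : -bigTheta hs ((rootSystem H).root i) = (rootSystem H).root i + s := by
      exact sub_eq_iff_eq_add.1 (hk₂'.symm.trans hk₂i)
    rw [hfin]; exact hx
  -- the invariant form
  have hθu : θ u ∈ rootSpace H (-((rootSystem H).root i) : Dual ℂ H) := by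
    have := map_mem_rootSpace hi hs hmem
    rwa [map_neg, bigTheta_bigTheta hi] at this
  have hκ : killingForm ℂ L v (θ u) ≠ 0 := by
    intro h0
    refine hne ((EmbeddingLike.map_eq_zero_iff (f := θ)).1
      (eq_zero_of_forall_killingForm (μ := (-((rootSystem H).root i) : Dual ℂ H)) hθu
        fun y hy => ?_))
    have hy' : y ∈ rootSpace H i.1 := by
      have : (-((-((rootSystem H).root i) : Dual ℂ H) : H → ℂ)) = (i.1 : H → ℂ) := by
        ext z; exact neg_neg _
      rwa [this] at hy
    -- The root space is spanned by v, so θu would be orthogonal to all of it, hence zero.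
    have hrank := finrank_rootSpace_eq_one i.1 (LieSubalgebra.isNonZero_coe_root i)
    obtain ⟨c, hc⟩ := (finrank_eq_one_iff_of_nonzero' (⟨v, hv⟩ : rootSpace H i.1)
      (by simpa [Subtype.ext_iff] using hv0)).1 hrank ⟨y, hy'⟩
    have hcy : c • v = y := congrArg Subtype.val hc
    rw [← hcy, map_smul, LieModule.traceForm_comm, h0, smul_zero]
  -- κ(v, θEᵐv) = κ(Eᵐθv, v) = (−1)ᵐ κ(θv, Eᵐv) = (−1)ᵐ κ(v, θEᵐv), by the invariance of κ under ad
  -- E and under θ.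
  have hsymm : killingForm ℂ L v (θ u) = (-1) ^ m * killingForm ℂ L v (θ u) := by
    conv_lhs => rw [hu, map_pow_ad hθE, LieModule.traceForm_comm, killingForm_pow_ad,
      ← killingForm_map_map (θ := θ), hi, map_pow_ad hθE]
    rw [hu, map_pow_ad hθE]
  rw [hm']
  rcases Nat.even_or_odd m with hme | hmo
  · exact (by exact_mod_cast hme : Even (m : ℤ)).neg
  · rw [hmo.neg_one_pow, neg_one_mul] at hsymm
    exact absurd (self_eq_neg.1 hsymm) hκ

end Parity

end SymPair

end

/-! ### Matrices of finite type and forbidden subdiagrams -/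

noncomputable section
namespace SymPair

section FiniteType

/-- The `N × N` matrix `f` has diagonal entries `2`, nonpositive entries off the diagonal and is of
finite type, in the form of Vinberg's criterion: no nonzero vector `c ≥ 0` satisfies `f c ≤ 0` on its
support. -/
structure IsFiniteType (N : ℕ) (f : ℕ → ℕ → ℤ) : Prop where
  diag : ∀ i < N, f i i = 2
  nonpos : ∀ i < N, ∀ j < N, i ≠ j → f i j ≤ 0
  crit : ∀ c : ℕ → ℤ, (∀ i, 0 ≤ c i) → (∃ i < N, 0 < c i) →
    ∃ i < N, 0 < c i ∧ 0 < ∑ j ∈ Finset.range N, f i j * c j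

/-- A vector that can be attached to the node `x`, if `x` has coefficient `2`. -/
structure IsCap (N : ℕ) (f : ℕ → ℕ → ℤ) (x : ℕ) (c : ℕ → ℤ) : Prop where
  nonneg : ∀ i, 0 ≤ c i
  at_node : ∑ j ∈ Finset.range N, f x j * c j ≤ -2
  on_support : ∀ i < N, 0 < c i → ∑ j ∈ Finset.range N, f i j * c j + 2 * f i x ≤ 0

variable {N : ℕ} {f : ℕ → ℕ → ℤ}

theorem sum_mul_indicator {u : ℕ} (hu : u < N) (w : ℤ) (g : ℕ → ℤ) :
    ∑ j ∈ Finset.range N, g j * (if j = u then w else 0) = g u * w := by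
  rw [Finset.sum_eq_single_of_mem u (Finset.mem_range.2 hu)]
  · simp
  · intro j _ hj; simp [hj]

namespace IsFiniteType

variable (hf : IsFiniteType N f)
include hf

theorem sum_nonpos {c : ℕ → ℤ} (hc : ∀ i, 0 ≤ c i) {i : ℕ} (hi : i < N) (h0 : c i = 0) :
    ∑ j ∈ Finset.range N, f i j * c j ≤ 0 := by
  refine Finset.sum_nonpos fun j hj => ?_
  rw [Finset.mem_range] at hj
  by_cases hij : i = j
  · subst hij; simp [h0]
  · exact mul_nonpos_of_nonpos_of_nonneg (hf.nonpos i hi j hj hij) (hc j)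

/-- Two neighbours of coefficient 1 balance the coefficient 2 at the node: the row of each has 2 · 1
− 1 · 2 = 0 as an upper bound. -/
theorem isCap_fork {x u v : ℕ} (hu : u < N) (hv : v < N) (huv : u ≠ v)
    (h1 : f x u ≤ -1) (h2 : f x v ≤ -1) (h3 : f u x ≤ -1) (h4 : f v x ≤ -1) :
    IsCap N f x fun i => (if i = u then 1 else 0) + (if i = v then 1 else 0) where
  nonneg i := by split_ifs <;> norm_num
  at_node := by
    simp only [mul_add, Finset.sum_add_distrib]
    rw [sum_mul_indicator hu, sum_mul_indicator hv]; omega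
  on_support i hi hpos := by
    simp only [mul_add, Finset.sum_add_distrib]
    rw [sum_mul_indicator hu, sum_mul_indicator hv]
    by_cases h : i = u
    · subst h
      have := hf.diag i hi
      have := hf.nonpos i hi v hv huv
      omega
    · by_cases h' : i = v
      · subst h'
        have := hf.diag i hi
        have := hf.nonpos i hi u hu h
        omega
      · simp [h, h'] at hpos

theorem exists_isCap_double {x u : ℕ} (hu : u < N) (hxu : f x u ≤ -1) (hux : f u x ≤ -1)
    (h : f x u ≤ -2 ∨ f u x ≤ -2) :
    ∃ w : ℤ, IsCap N f x fun i => if i = u then w else 0 := by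
  -- The weight of the end node depends on the direction of the multiple edge: 1 if the large entry
  -- is in the row of x, otherwise 2.
  by_cases h2 : f x u ≤ -2
  · refine ⟨1, fun i => by split_ifs <;> norm_num, ?_, fun i hi hpos => ?_⟩
    · rw [sum_mul_indicator hu]; omega
    · rw [sum_mul_indicator hu]
      by_cases h : i = u
      · subst h
        have := hf.diag i hi
        omega
      · simp [h] at hpos
  · refine ⟨2, fun i => by split_ifs <;> norm_num, ?_, fun i hi hpos => ?_⟩
    · rw [sum_mul_indicator hu]; omega
    · rw [sum_mul_indicator hu]
      by_cases h : i = u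
      · subst h
        have := hf.diag i hi
        omega
      · simp [h] at hpos

/-- A path with simple edges cannot have branch nodes or multiple edges at both of its ends. -/
theorem false_of_isCap {a b : ℕ} (hab : a ≤ b) (hbN : b < N)
    (hpath : ∀ i, a ≤ i → i < b → f i (i + 1) ≤ -1 ∧ f (i + 1) i ≤ -1)
    {c d : ℕ → ℤ} (hc : IsCap N f a c) (hd : IsCap N f b d)
    (hc0 : ∀ i, a ≤ i → i ≤ b → c i = 0) (hd0 : ∀ i, a ≤ i → i ≤ b → d i = 0)
    (hcd : ∀ i, c i = 0 ∨ d i = 0) : False := by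
  -- Coefficient 2 along the path, continued by the two caps, is the pattern of the null vectors of
  -- affine diagrams; it violates the criterion.
  let p : ℕ → ℤ := fun i => if a ≤ i ∧ i ≤ b then 2 else 0
  obtain ⟨i, hi, hpos, hsum⟩ := hf.crit (fun i => p i + (c i + d i))
    (fun i => add_nonneg (by simp only [p]; split_ifs <;> norm_num)
      (add_nonneg (hc.nonneg i) (hd.nonneg i)))
    ⟨a, by omega, by simp [p, hab, hc0 a le_rfl hab, hd0 a le_rfl hab]⟩
  simp only [mul_add, Finset.sum_add_distrib] at hsum
  have hp0 : ∀ i, 0 ≤ p i := fun i => by simp only [p]; split_ifs <;> norm_num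
  have hterm : ∀ j ∈ Finset.range N, j ≠ i → f i j * p j ≤ 0 := fun j hj hji =>
    mul_nonpos_of_nonpos_of_nonneg (hf.nonpos i hi j (Finset.mem_range.1 hj) hji.symm) (hp0 j)
  -- All terms except the diagonal one are nonpositive, so any partial sum containing the diagonal
  -- term bounds the row from above. At most three nodes of the path are needed.
  have hle : ∀ s ⊆ Finset.range N, i ∈ s →
      ∑ j ∈ Finset.range N, f i j * p j ≤ ∑ j ∈ s, f i j * p j := fun s hs his => by
    rw [← Finset.sum_sdiff hs]
    have : ∑ j ∈ Finset.range N \ s, f i j * p j ≤ 0 := Finset.sum_nonpos fun j hj => by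
      rw [Finset.mem_sdiff] at hj
      exact hterm j hj.1 fun h => hj.2 (h ▸ his)
    omega
  by_cases hip : a ≤ i ∧ i ≤ b
  · have hpi : p i = 2 := by simp [p, hip]
    have h2 := hf.diag i hi
    by_cases hia : i = a
    · by_cases hib : i = b
      · have h1 := hle {i} (by simpa using hi) (by simp)
        rw [Finset.sum_singleton, hpi] at h1
        have := hc.at_node
        have := hd.at_node
        subst hia; subst hib
        omega
      · have h1 := hle {i, i + 1} (by
          intro j hj; simp only [Finset.mem_insert, Finset.mem_singleton] at hj
          rw [Finset.mem_range]; omega) (by simp)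
        have hp' : p (i + 1) = 2 := by simp [p]; omega
        rw [Finset.sum_pair (by omega), hpi, hp'] at h1
        have := (hpath i hip.1 (by omega)).1
        have := hc.at_node
        have := hf.sum_nonpos hd.nonneg hi (hd0 i hip.1 hip.2)
        subst hia
        omega
    · obtain ⟨k, rfl⟩ : ∃ k, i = k + 1 := ⟨i - 1, by omega⟩
      have hp' : p k = 2 := by simp [p]; omega
      have hk := (hpath k (by omega) (by omega)).2
      by_cases hib : k + 1 = b
      · have h1 := hle {k + 1, k} (by
          intro j hj; simp only [Finset.mem_insert, Finset.mem_singleton] at hj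
          rw [Finset.mem_range]; omega) (by simp)
        rw [Finset.sum_pair (by omega), hpi, hp'] at h1
        have := hd.at_node
        have := hf.sum_nonpos hc.nonneg hi (hc0 _ hip.1 hip.2)
        subst hib
        omega
      · have h1 := hle {k + 1, k, k + 2} (by
          intro j hj; simp only [Finset.mem_insert, Finset.mem_singleton] at hj
          rw [Finset.mem_range]; omega) (by simp)
        have hp'' : p (k + 2) = 2 := by simp [p]; omega
        rw [Finset.sum_insert (by simp), Finset.sum_pair (by omega), hpi, hp', hp''] at h1
        have := (hpath (k + 1) hip.1 (by omega)).1
        have := hf.sum_nonpos hd.nonneg hi (hd0 _ hip.1 hip.2)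
        have := hf.sum_nonpos hc.nonneg hi (hc0 _ hip.1 hip.2)
        simp only [add_assoc, Nat.reduceAdd] at *
        omega
  -- A node off the path belongs to exactly one cap. The end of the path carrying that cap
  -- contributes the term 2 f i x, which `on_support` takes into account.
  · have hpi : p i = 0 := by simp only [p]; rw [if_neg hip]
    rw [hpi, zero_add] at hpos
    have h1 : ∀ x, a ≤ x → x ≤ b → ∑ j ∈ Finset.range N, f i j * p j ≤ 2 * f i x := by
      intro x hax hxb
      have hix : i ≠ x := by rintro rfl; exact hip ⟨hax, hxb⟩
      have := hle {i, x} (by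
          intro j hj; simp only [Finset.mem_insert, Finset.mem_singleton] at hj
          rw [Finset.mem_range]; omega) (by simp)
      have hp' : p x = 2 := by simp [p]; omega
      rw [Finset.sum_pair hix, hpi, hp'] at this
      omega
    rcases hcd i with h | h
    · rw [h, zero_add] at hpos
      have := hd.on_support i hi hpos
      have := hf.sum_nonpos hc.nonneg hi h
      have := h1 b hab le_rfl
      omega
    · rw [h, add_zero] at hpos
      have := hc.on_support i hi hpos
      have := hf.sum_nonpos hd.nonneg hi h
      have := h1 a le_rfl hab
      omega

theorem false_of_fork_fork {a b u v u' v' : ℕ} (hab : a ≤ b) (hbN : b < N)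
    (hpath : ∀ i, a ≤ i → i < b → f i (i + 1) ≤ -1 ∧ f (i + 1) i ≤ -1)
    (hN : u < N ∧ v < N ∧ u' < N ∧ v' < N)
    (hne : u ≠ v ∧ u ≠ u' ∧ u ≠ v' ∧ v ≠ u' ∧ v ≠ v' ∧ u' ≠ v')
    (hout : (u < a ∨ b < u) ∧ (v < a ∨ b < v) ∧ (u' < a ∨ b < u') ∧ (v' < a ∨ b < v'))
    (h1 : f a u ≤ -1 ∧ f a v ≤ -1 ∧ f u a ≤ -1 ∧ f v a ≤ -1)
    (h2 : f b u' ≤ -1 ∧ f b v' ≤ -1 ∧ f u' b ≤ -1 ∧ f v' b ≤ -1) : False := by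
  refine hf.false_of_isCap hab hbN hpath
    (hf.isCap_fork hN.1 hN.2.1 hne.1 h1.1 h1.2.1 h1.2.2.1 h1.2.2.2)
    (hf.isCap_fork hN.2.2.1 hN.2.2.2 hne.2.2.2.2.2 h2.1 h2.2.1 h2.2.2.1 h2.2.2.2) ?_ ?_ ?_ <;>
  · intro i; split_ifs <;> omega

theorem false_of_fork_double {a b u v u' : ℕ} (hab : a ≤ b) (hbN : b < N)
    (hpath : ∀ i, a ≤ i → i < b → f i (i + 1) ≤ -1 ∧ f (i + 1) i ≤ -1)
    (hN : u < N ∧ v < N ∧ u' < N) (hne : u ≠ v ∧ u ≠ u' ∧ v ≠ u')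
    (hout : (u < a ∨ b < u) ∧ (v < a ∨ b < v) ∧ (u' < a ∨ b < u'))
    (h1 : f a u ≤ -1 ∧ f a v ≤ -1 ∧ f u a ≤ -1 ∧ f v a ≤ -1)
    (h2 : f b u' ≤ -1 ∧ f u' b ≤ -1 ∧ (f b u' ≤ -2 ∨ f u' b ≤ -2)) : False := by
  obtain ⟨w, hw⟩ := hf.exists_isCap_double hN.2.2 h2.1 h2.2.1 h2.2.2
  refine hf.false_of_isCap hab hbN hpath
    (hf.isCap_fork hN.1 hN.2.1 hne.1 h1.1 h1.2.1 h1.2.2.1 h1.2.2.2) hw ?_ ?_ ?_ <;>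
  · intro i; split_ifs <;> omega

theorem false_of_double_fork {a b u v u' : ℕ} (hab : a ≤ b) (hbN : b < N)
    (hpath : ∀ i, a ≤ i → i < b → f i (i + 1) ≤ -1 ∧ f (i + 1) i ≤ -1)
    (hN : u < N ∧ v < N ∧ u' < N) (hne : u ≠ v ∧ u ≠ u' ∧ v ≠ u')
    (hout : (u < a ∨ b < u) ∧ (v < a ∨ b < v) ∧ (u' < a ∨ b < u'))
    (h2 : f a u' ≤ -1 ∧ f u' a ≤ -1 ∧ (f a u' ≤ -2 ∨ f u' a ≤ -2))
    (h1 : f b u ≤ -1 ∧ f b v ≤ -1 ∧ f u b ≤ -1 ∧ f v b ≤ -1) : False := by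
  obtain ⟨w, hw⟩ := hf.exists_isCap_double hN.2.2 h2.1 h2.2.1 h2.2.2
  refine hf.false_of_isCap hab hbN hpath hw
    (hf.isCap_fork hN.1 hN.2.1 hne.1 h1.1 h1.2.1 h1.2.2.1 h1.2.2.2) ?_ ?_ ?_ <;>
  · intro i; split_ifs <;> omega

theorem false_of_double_double {a b u u' : ℕ} (hab : a ≤ b) (hbN : b < N)
    (hpath : ∀ i, a ≤ i → i < b → f i (i + 1) ≤ -1 ∧ f (i + 1) i ≤ -1)
    (hN : u < N ∧ u' < N) (hne : u ≠ u')
    (hout : (u < a ∨ b < u) ∧ (u' < a ∨ b < u'))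
    (h1 : f a u ≤ -1 ∧ f u a ≤ -1 ∧ (f a u ≤ -2 ∨ f u a ≤ -2))
    (h2 : f b u' ≤ -1 ∧ f u' b ≤ -1 ∧ (f b u' ≤ -2 ∨ f u' b ≤ -2)) : False := by
  obtain ⟨w, hw⟩ := hf.exists_isCap_double hN.1 h1.1 h1.2.1 h1.2.2
  obtain ⟨w', hw'⟩ := hf.exists_isCap_double hN.2 h2.1 h2.2.1 h2.2.2
  refine hf.false_of_isCap hab hbN hpath hw hw' ?_ ?_ ?_ <;>
  · intro i; split_ifs <;> omega

/-- A node of a triple edge has no other neighbours. -/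
theorem false_of_triple {x y v : ℕ} (hx : x < N) (hy : y < N) (hv : v < N) (hxy : x ≠ y)
    (hxv : x ≠ v) (hyv : y ≠ v) (h1 : f x y ≤ -1) (h2 : f y x ≤ -1) (h3 : f y v ≤ -1)
    (h4 : f v y ≤ -1) (h : f y v ≤ -3 ∨ f v y ≤ -3) : False := by
  -- The vector is (1, 2, w) on x, y, v, where w is 1 or 3 according to the direction of the triple
  -- edge: the null vectors of the affine diagrams extending G₂.
  obtain ⟨w, hw0, hw1, hw2⟩ : ∃ w : ℤ, 0 < w ∧ f y v * w ≤ -3 ∧ 2 * w + 2 * f v y ≤ 0 := by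
    by_cases h' : f y v ≤ -3
    · exact ⟨1, by omega, by omega, by omega⟩
    · exact ⟨3, by omega, by omega, by omega⟩
  obtain ⟨i, hi, hpos, hsum⟩ := hf.crit
    (fun i => (if i = x then 1 else 0) + ((if i = y then 2 else 0) + (if i = v then w else 0)))
    (fun i => by split_ifs <;> omega) ⟨x, hx, by simp [hxy, hxv]⟩
  simp only [mul_add, Finset.sum_add_distrib] at hsum
  rw [sum_mul_indicator hx, sum_mul_indicator hy, sum_mul_indicator hv] at hsum
  have hd := hf.diag i hi
  by_cases hix : i = x
  · subst hix
    have : f i v * w ≤ 0 := mul_nonpos_of_nonpos_of_nonneg (hf.nonpos i hi v hv hxv) hw0.le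
    omega
  by_cases hiy : i = y
  · subst hiy; omega
  by_cases hiv : i = v
  · subst hiv
    have := hf.nonpos i hi x hx hix
    rw [hd] at hsum; omega
  simp [hix, hiy, hiv] at hpos

/-- The restriction to a subset of the nodes. -/
theorem comp {m : ℕ} {g : ℕ → ℕ} (hg : ∀ i < m, g i < N)
    (hinj : ∀ i < m, ∀ j < m, g i = g j → i = j) :
    IsFiniteType m (fun i j => f (g i) (g j)) where
  diag i hi := hf.diag _ (hg i hi)
  nonpos i hi j hj hij := hf.nonpos _ (hg i hi) _ (hg j hj) fun h => hij (hinj i hi j hj h)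
  crit c hc := by
    rintro ⟨i₀, hi₀, hpos₀⟩
    have hsum : ∀ k,
        ∑ j ∈ Finset.range N, f k j * (∑ i ∈ Finset.range m, if j = g i then c i else 0) =
          ∑ i ∈ Finset.range m, f k (g i) * c i := by
      intro k
      simp only [Finset.mul_sum]
      rw [Finset.sum_comm]
      refine Finset.sum_congr rfl fun i hi => ?_
      exact sum_mul_indicator (hg i (Finset.mem_range.1 hi)) _ _
    have hval : ∀ k < m, (∑ i ∈ Finset.range m, if g k = g i then c i else 0) = c k := by
      intro k hk
      rw [Finset.sum_eq_single_of_mem k (Finset.mem_range.2 hk)]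
      · simp
      · intro i hi hik
        rw [if_neg]
        exact fun h => hik (hinj _ hk _ (Finset.mem_range.1 hi) h).symm
    obtain ⟨k, hk, hpos, hk'⟩ := hf.crit (fun k => ∑ i ∈ Finset.range m, if k = g i then c i else 0)
      (fun k => Finset.sum_nonneg fun i hi => by
        split_ifs
        · exact hc i
        · exact le_rfl)
      ⟨g i₀, hg i₀ hi₀, by rw [hval i₀ hi₀]; exact hpos₀⟩
    rw [hsum] at hk'
    obtain ⟨i, hi, hne⟩ := Finset.exists_ne_zero_of_sum_ne_zero hpos.ne'
    have hki : k = g i := by by_contra h; simp [h] at hne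
    subst hki
    have hi := Finset.mem_range.1 hi
    rw [hval i hi] at hpos
    exact ⟨i, hi, hpos, hk'⟩

theorem congr {f' : ℕ → ℕ → ℤ} (h : ∀ i < N, ∀ j < N, f i j = f' i j) : IsFiniteType N f' where
  diag i hi := by rw [← h i hi i hi]; exact hf.diag i hi
  nonpos i hi j hj hij := by rw [← h i hi j hj]; exact hf.nonpos i hi j hj hij
  crit c hc hc' := by
    obtain ⟨i, hi, hpos, hsum⟩ := hf.crit c hc hc'
    refine ⟨i, hi, hpos, ?_⟩
    have : ∑ j ∈ Finset.range N, f' i j * c j = ∑ j ∈ Finset.range N, f i j * c j :=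
      Finset.sum_congr rfl fun j hj => by rw [h i hi j (Finset.mem_range.1 hj)]
    rwa [this]

/-- Vinberg's criterion for an explicit vector. -/
theorem false_of_vector (c : List ℕ) (h0 : ∃ i < N, 0 < c.getD i 0)
    (h : ∀ i < N, 0 < c.getD i 0 → ∑ j ∈ Finset.range N, f i j * (c.getD j 0 : ℕ) ≤ 0) : False := by
  obtain ⟨i, hi, hpos, hsum⟩ := hf.crit (fun i => (c.getD i 0 : ℕ)) (fun i => by positivity)
    (by obtain ⟨i, hi, h⟩ := h0; exact ⟨i, hi, by exact_mod_cast h⟩)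
  exact absurd (h i hi (by exact_mod_cast hpos)) (not_le.2 hsum)

/-- The two entries of an edge. -/
theorem edge {i j : ℕ} (hi : i < N) (hj : j < N) (hij : i ≠ j) (h1 : f i j ≤ -1) (h2 : f j i ≤ -1) :
    (f i j = -1 ∧ -3 ≤ f j i) ∨ (f j i = -1 ∧ -3 ≤ f i j) := by
  have key : ∀ i < N, ∀ j < N, i ≠ j → ∀ x y : ℤ, 0 < x → 0 < y → 2 * x + f i j * y ≤ 0 →
      2 * y + f j i * x ≤ 0 → False := by
    intro i hi j hj hij x y hx hy h1 h2
    obtain ⟨k, hk, hpos, hsum⟩ := hf.crit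
      (fun k => (if k = i then x else 0) + (if k = j then y else 0))
      (fun k => by split_ifs <;> omega) ⟨i, hi, by simp [hij, hx]⟩
    simp only [mul_add, Finset.sum_add_distrib] at hsum
    rw [sum_mul_indicator hi, sum_mul_indicator hj] at hsum
    by_cases hki : k = i
    · subst hki; rw [hf.diag k hk] at hsum; omega
    by_cases hkj : k = j
    · subst hkj; rw [hf.diag k hk] at hsum; omega
    simp [hki, hkj] at hpos
  by_contra hcon
  -- What remains are edges whose entries have a product of at least 4. They are excluded by the
  -- vectors (1, 1) and (1, 2).
  by_cases h : f i j ≤ -2 ∧ f j i ≤ -2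
  · exact key i hi j hj hij 1 1 (by omega) (by omega) (by omega) (by omega)
  · by_cases h' : f i j = -1
    · exact key i hi j hj hij 1 2 (by omega) (by omega) (by omega) (by omega)
    · exact key j hj i hi hij.symm 1 2 (by omega) (by omega) (by omega) (by omega)

end IsFiniteType

end FiniteType

end SymPair

end

/-! ### Normal forms of Dynkin diagrams; attaching a node to a simply laced path -/

noncomputable section
namespace SymPair
set_option linter.unusedSectionVars false

section Dynkin

/-- The Cartan matrix of a path with `n` nodes, where the last edge has the entries `d₁`, `d₂`. -/
def pathM (n : ℕ) (d₁ d₂ : ℤ) (i j : ℕ) : ℤ :=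
  if i = j then 2
  else if i + 1 = j then if j + 1 = n then d₁ else -1
  else if j + 1 = i then if i + 1 = n then d₂ else -1
  else 0

/-- The matrix `g` on `n` nodes, with a further node number `n` attached to the node `k`. -/
def extM (g : ℕ → ℕ → ℤ) (n k : ℕ) (p q : ℤ) (i j : ℕ) : ℤ :=
  if i = n then (if j = n then 2 else if j = k then p else 0)
  else if j = n then (if i = k then q else 0)
  else g i j

/-- The simply laced path with `m` nodes and a further node attached to the node `k`. -/
def forkM (m k : ℕ) : ℕ → ℕ → ℤ := extM (pathM m (-1) (-1)) m k (-1) (-1)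

/-- The Cartan matrix of type `F₄`. -/
def fourM (i j : ℕ) : ℤ :=
  if i = j then 2 else if i = 1 ∧ j = 2 then -2 else if i + 1 = j ∨ j + 1 = i then -1 else 0

/-- The Cartan matrices of the connected Dynkin diagrams, with the number of their nodes. -/
inductive DynkinForm : ℕ → (ℕ → ℕ → ℤ) → Prop
  | A (n : ℕ) (hn : 1 ≤ n) : DynkinForm n (pathM n (-1) (-1))
  | B (n : ℕ) (hn : 2 ≤ n) : DynkinForm n (pathM n (-2) (-1))
  | C (n : ℕ) (hn : 3 ≤ n) : DynkinForm n (pathM n (-1) (-2))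
  | D (n : ℕ) (hn : 3 ≤ n) : DynkinForm (n + 1) (forkM n (n - 2))
  | E₆ : DynkinForm 6 (forkM 5 2)
  | E₇ : DynkinForm 7 (forkM 6 3)
  | E₈ : DynkinForm 8 (forkM 7 4)
  | F₄ : DynkinForm 4 fourM
  | G₂ : DynkinForm 2 (pathM 2 (-3) (-1))

/-- Up to the numbering of the nodes, `f` is the Cartan matrix of a connected Dynkin diagram. -/
def IsDynkin (N : ℕ) (f : ℕ → ℕ → ℤ) : Prop :=
  ∃ g, DynkinForm N g ∧ ∃ σ : ℕ → ℕ, (∀ i < N, σ i < N) ∧ (∀ i < N, ∀ j < N, σ i = σ j → i = j) ∧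
    ∀ i < N, ∀ j < N, f (σ i) (σ j) = g i j

variable {N n k : ℕ} {f g : ℕ → ℕ → ℤ} {p q : ℤ}

theorem DynkinForm.isDynkin (h : DynkinForm N g) (hfg : ∀ i < N, ∀ j < N, f i j = g i j) :
    IsDynkin N f :=
  ⟨g, h, id, fun _ h => h, fun _ _ _ _ h => h, hfg⟩

theorem DynkinForm.isDynkin_list (h : DynkinForm N g) (l : List ℕ)
    (hl : (∀ i < N, l.getD i 0 < N) ∧ (∀ i < N, ∀ j < N, l.getD i 0 = l.getD j 0 → i = j) ∧
      ∀ i < N, ∀ j < N, f (l.getD i 0) (l.getD j 0) = g i j) : IsDynkin N f :=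
  ⟨g, h, fun i => l.getD i 0, hl⟩

theorem IsDynkin.of_comp {τ : ℕ → ℕ} (h : IsDynkin N fun i j => f (τ i) (τ j))
    (hτ : ∀ i < N, τ i < N) (hτ' : ∀ i < N, ∀ j < N, τ i = τ j → i = j) : IsDynkin N f := by
  obtain ⟨g, hg, σ, h1, h2, h3⟩ := h
  exact ⟨g, hg, fun i => τ (σ i), fun i hi => hτ _ (h1 i hi),
    fun i hi j hj hij => h2 i hi j hj (hτ' _ (h1 i hi) _ (h1 j hj) hij), h3⟩

theorem IsDynkin.congr (h : IsDynkin N f) (hfg : ∀ i < N, ∀ j < N, g i j = f i j) :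
    IsDynkin N g := by
  obtain ⟨f', hf', σ, h1, h2, h3⟩ := h
  exact ⟨f', hf', σ, h1, h2, fun i hi j hj => by rw [hfg _ (h1 i hi) _ (h1 j hj), h3 i hi j hj]⟩

theorem pathM_shift (n m t : ℕ) (i j : ℕ) : pathM n (-1) (-1) (t + i) (t + j) = pathM m (-1) (-1) i j := by
  simp only [pathM, ite_self]; split_ifs <;> omega

theorem extM_comp (g : ℕ → ℕ → ℤ) {n m k : ℕ} {s : ℕ → ℕ} (hs : ∀ i < m, s i ≠ n)
    (hs' : ∀ i < m, s i = s k → i = k) (p q : ℤ) (i : ℕ)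
    (hi : i < m + 1) (j : ℕ) (hj : j < m + 1) :
    extM g n (s k) p q (if i < m then s i else n) (if j < m then s j else n) =
      extM (fun i j => g (s i) (s j)) m k p q i j := by
  by_cases h1 : i < m <;> by_cases h2 : j < m
  · simp [extM, h1, h2, h1.ne, h2.ne, hs i h1, hs j h2]
  · have : s i = s k ↔ i = k := ⟨hs' i h1, fun h => h ▸ rfl⟩
    simp [extM, h1, h1.ne, show j = m by omega, hs i h1, this]
  · have : s j = s k ↔ j = k := ⟨hs' j h2, fun h => h ▸ rfl⟩
    simp [extM, h2, h2.ne, show i = m by omega, hs j h2, this]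
  · simp [extM, show i = m by omega, show j = m by omega]

/-- The last `m` nodes together with the further node. -/
theorem IsFiniteType.extM_shift {n m t k : ℕ} (hf : IsFiniteType (n + 1) (extM g n (t + k) p q))
    (hm : t + m ≤ n) :
    IsFiniteType (m + 1) (extM (fun i j => g (t + i) (t + j)) m k p q) := by
  refine (hf.comp (m := m + 1) (g := fun i => if i < m then t + i else n) ?_ ?_).congr
    (extM_comp g (s := fun i => t + i) (fun i hi => by omega) (fun i hi h => by omega) p q)
  · intro i hi; split_ifs <;> omega
  · intro i hi j hj; split_ifs <;> omega

/-- Attaching a node to the second half of a path by a simple edge. -/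
theorem isDynkin_extM_path_of_le (hk : k < n) (hk2 : n ≤ 2 * k + 1)
    (hf : IsFiniteType (n + 1) (extM (pathM n (-1) (-1)) n k (-1) (-1))) :
    IsDynkin (n + 1) (extM (pathM n (-1) (-1)) n k (-1) (-1)) := by
  -- The diagram has arms of lengths k, m and 1, with m ≤ k. The values 0 and 1 of m give the types
  -- A and D, the value 2 gives type E as long as k ≤ 4.
  obtain ⟨m, rfl⟩ : ∃ m, n = k + 1 + m := ⟨n - 1 - k, by omega⟩
  match m, hf, hk, hk2 with
  | 0, hf, hk, hk2 =>
    refine (DynkinForm.A _ (by omega)).isDynkin fun i hi j hj => ?_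
    simp only [extM, pathM]; split_ifs <;> omega
  | 1, hf, hk, hk2 =>
    exact (DynkinForm.D _ (by omega)).isDynkin fun i hi j hj => rfl
  | 2, hf, hk, hk2 =>
    by_cases h2 : k = 2
    · subst h2; exact DynkinForm.E₆.isDynkin fun i hi j hj => rfl
    by_cases h3 : k = 3
    · subst h3; exact DynkinForm.E₇.isDynkin fun i hi j hj => rfl
    by_cases h4 : k = 4
    · subst h4; exact DynkinForm.E₈.isDynkin fun i hi j hj => rfl
    -- Without the first t nodes this is the affine diagram of type E₈, and the vector is its null
    -- vector.
    obtain ⟨t, rfl⟩ : ∃ t, k = t + 5 := ⟨k - 5, by omega⟩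
    have := hf.extM_shift (t := t) (m := 8) (k := 5) (by omega)
    simp only [pathM_shift _ 8] at this
    exact (this.false_of_vector [1, 2, 3, 4, 5, 6, 4, 2, 3] (by decide) (by decide)).elim
  | m + 3, hf, hk, hk2 =>
    -- Two arms have length at least 3, so the affine diagram of type E₇ is contained in this one.
    obtain ⟨t, rfl⟩ : ∃ t, k = t + 3 := ⟨k - 3, by omega⟩
    have := hf.extM_shift (t := t) (m := 7) (k := 3) (by omega)
    simp only [pathM_shift _ 7] at this
    exact (this.false_of_vector [1, 2, 3, 4, 3, 2, 1, 2] (by decide) (by decide)).elim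

theorem pathM_reverse {n i j : ℕ} (hi : i < n) (hj : j < n) :
    pathM n (-1) (-1) (n - 1 - i) (n - 1 - j) = pathM n (-1) (-1) i j := by
  simp only [pathM, ite_self]; grind

theorem extM_path_reverse (hk : k < n) (p q : ℤ) (i : ℕ) (hi : i < n + 1) (j : ℕ) (hj : j < n + 1) :
    extM (pathM n (-1) (-1)) n k p q (if i < n then n - 1 - i else n) (if j < n then n - 1 - j else n) =
      extM (pathM n (-1) (-1)) n (n - 1 - k) p q i j := by
  have := extM_comp (pathM n (-1) (-1)) (n := n) (m := n) (k := n - 1 - k) (s := fun i => n - 1 - i)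
    (fun i hi => by omega) (fun i hi h => by omega) p q i hi j hj
  rw [show n - 1 - (n - 1 - k) = k by omega] at this
  rw [this]
  by_cases h1 : i < n <;> by_cases h2 : j < n
  · simp [extM, h1.ne, h2.ne, pathM_reverse h1 h2]
  all_goals simp [extM, show ¬ i < n → i = n by omega, show ¬ j < n → j = n by omega, *]

/-- Reversal of the path reduces everything to attachments in its second half. -/
theorem isDynkin_extM_path_of_reverse (hk : k < n)
    (h : ∀ k, k < n → n ≤ 2 * k + 1 → IsFiniteType (n + 1) (extM (pathM n (-1) (-1)) n k p q) →
      IsDynkin (n + 1) (extM (pathM n (-1) (-1)) n k p q))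
    (hf : IsFiniteType (n + 1) (extM (pathM n (-1) (-1)) n k p q)) :
    IsDynkin (n + 1) (extM (pathM n (-1) (-1)) n k p q) := by
  by_cases hk2 : n ≤ 2 * k + 1
  · exact h k hk hk2 hf
  have h1 : ∀ i < n + 1, (if i < n then n - 1 - i else n) < n + 1 := by
    intro i hi; split_ifs <;> omega
  have h2 : ∀ i < n + 1, ∀ j < n + 1, (if i < n then n - 1 - i else n) =
      (if j < n then n - 1 - j else n) → i = j := by
    intro i hi j hj; split_ifs <;> omega
  refine IsDynkin.of_comp (τ := fun i => if i < n then n - 1 - i else n) ?_ h1 h2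
  exact (h (n - 1 - k) (by omega) (by omega)
    ((hf.comp h1 h2).congr (extM_path_reverse hk p q))).congr (extM_path_reverse hk p q)

theorem isDynkin_extM_path (hk : k < n)
    (hf : IsFiniteType (n + 1) (extM (pathM n (-1) (-1)) n k (-1) (-1))) :
    IsDynkin (n + 1) (extM (pathM n (-1) (-1)) n k (-1) (-1)) :=
  isDynkin_extM_path_of_reverse hk (fun _ => isDynkin_extM_path_of_le) hf

/-- The possible entries of a double edge. -/
def IsDouble (p q : ℤ) : Prop := (p = -1 ∧ q = -2) ∨ (p = -2 ∧ q = -1)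

/-- At the end of the path the double edge produces type B or C. Elsewhere its node is also a branch
node with two neighbours on the path, which is forbidden. -/
theorem isDynkin_extM_path_double (hpq : IsDouble p q) (hk : k < n)
    (hf : IsFiniteType (n + 1) (extM (pathM n (-1) (-1)) n k p q)) :
    IsDynkin (n + 1) (extM (pathM n (-1) (-1)) n k p q) := by
  refine isDynkin_extM_path_of_reverse hk (fun k hk hk2 hf => ?_) hf
  by_cases hkn : k + 1 = n
  · rcases hpq with ⟨rfl, rfl⟩ | ⟨rfl, rfl⟩
    · refine (DynkinForm.B _ (by omega)).isDynkin fun i hi j hj => ?_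
      simp only [extM, pathM]; split_ifs <;> omega
    -- In rank two both directions of the double edge count as type B, with the nodes exchanged.
    · by_cases hn : n = 1
      · subst hn
        obtain rfl : k = 0 := by omega
        exact (DynkinForm.B 2 le_rfl).isDynkin_list [1, 0] (by decide)
      refine (DynkinForm.C _ (by omega)).isDynkin fun i hi j hj => ?_
      simp only [extM, pathM]; split_ifs <;> omega
  · refine (hf.false_of_fork_double (a := k) (b := k) (u := k - 1) (v := k + 1) (u' := n) le_rfl
      (by omega) (by omega) (by omega) (by omega) (by omega) ?_ ?_).elim
    · simp only [extM, pathM]; refine ⟨?_, ?_, ?_, ?_⟩ <;> (split_ifs <;> omega)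
    · unfold IsDouble at hpq
      simp only [extM, pathM]; refine ⟨?_, ?_, ?_⟩ <;> (split_ifs <;> omega)

end Dynkin

end SymPair

end

/-! ### Attaching a node to a path ending in a double edge -/

noncomputable section
namespace SymPair
set_option linter.unusedSectionVars false

section Dynkin

variable {n k : ℕ} {p q d₁ d₂ : ℤ} {g : ℕ → ℕ → ℤ}

/-- A path cannot have a multiple edge at one end and a multiple edge or a branch at the other. This
leaves simple edges at the two extreme nodes: at the first they lengthen the path, at the last they
give C₃ or F₄, or else an affine diagram. The hypothesis `hn2` fixes the numbering in rank two,
where types B and C coincide. -/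
theorem isDynkin_extM_doublePath (hd : IsDouble d₁ d₂) (hn : 2 ≤ n) (hn2 : n = 2 → d₁ = -2) (hk : k < n)
    (hpq : IsDouble p q ∨ (p = -1 ∧ q = -1))
    (hf : IsFiniteType (n + 1) (extM (pathM n d₁ d₂) n k p q)) :
    IsDynkin (n + 1) (extM (pathM n d₁ d₂) n k p q) := by
  rcases hpq with hpq | ⟨rfl, rfl⟩
  · by_cases hkn : k + 1 = n
    · refine (hf.false_of_double_double (a := k) (b := k) (u := n - 2) (u' := n) le_rfl
        (by omega) (by omega) (by omega) (by omega) (by omega) ?_ ?_).elim <;>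
      · unfold IsDouble at hpq hd
        simp only [extM, pathM]; refine ⟨?_, ?_, ?_⟩ <;> grind
    · refine (hf.false_of_double_double (a := k) (b := n - 2) (u := n) (u' := n - 1) (by omega)
        (by omega) ?_ (by omega) (by omega) (by omega) ?_ ?_).elim
      · intro i hi hi'
        simp only [extM, pathM]; refine ⟨?_, ?_⟩ <;> grind
      all_goals
        unfold IsDouble at hpq hd
        simp only [extM, pathM]; refine ⟨?_, ?_, ?_⟩ <;> grind
  · by_cases hk0 : k = 0
    · subst hk0
      have hform : DynkinForm (n + 1) (pathM (n + 1) d₁ d₂) := by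
        rcases hd with ⟨rfl, rfl⟩ | ⟨rfl, rfl⟩
        · exact DynkinForm.C _ (by omega)
        · exact DynkinForm.B _ (by omega)
      refine ⟨_, hform, fun i => if i = 0 then n else i - 1, ?_, ?_, ?_⟩
      · intro i hi; dsimp only; split_ifs <;> omega
      · intro i hi j hj; dsimp only; split_ifs <;> omega
      · intro i hi j hj
        by_cases h1 : i = 0 <;> by_cases h2 : j = 0
        · subst h1; subst h2; simp [extM, pathM]
        all_goals simp only [h1, h2, extM, pathM]; grind
    by_cases hkn : k + 1 = n
    · by_cases h2 : n = 2
      · subst h2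
        obtain rfl := hn2 rfl
        obtain rfl : d₂ = -1 := by unfold IsDouble at hd; omega
        obtain rfl : k = 1 := by omega
        exact (DynkinForm.C 3 le_rfl).isDynkin_list [2, 1, 0] (by decide)
      by_cases h3 : n = 3
      · subst h3
        obtain rfl : k = 2 := by omega
        rcases hd with ⟨rfl, rfl⟩ | ⟨rfl, rfl⟩
        · exact DynkinForm.F₄.isDynkin_list [3, 2, 1, 0] (by decide)
        · exact DynkinForm.F₄.isDynkin_list [0, 1, 2, 3] (by decide)
      -- The last four nodes and the new one form one of the two affine diagrams that extend F₄.
      obtain ⟨t, rfl⟩ : ∃ t, n = t + 4 := ⟨n - 4, by omega⟩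
      obtain rfl : k = t + 3 := by omega
      have hpath : (fun i j => pathM (t + 4) d₁ d₂ (t + i) (t + j)) = pathM 4 d₁ d₂ := by
        funext i j
        simp only [pathM]; split_ifs <;> omega
      have := hf.extM_shift (t := t) (m := 4) (k := 3) (by omega)
      rw [hpath] at this
      rcases hd with ⟨rfl, rfl⟩ | ⟨rfl, rfl⟩
      · exact (this.false_of_vector [1, 2, 3, 4, 2] (by decide) (by decide)).elim
      · exact (this.false_of_vector [1, 2, 3, 2, 1] (by decide) (by decide)).elim
    · refine (hf.false_of_fork_double (a := k) (b := n - 2) (u := k - 1) (v := n) (u' := n - 1)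
        (by omega) (by omega) ?_ (by omega) (by omega) (by omega) ?_ ?_).elim
      · intro i hi hi'
        simp only [extM, pathM]; refine ⟨?_, ?_⟩ <;> grind
      · simp only [extM, pathM]; refine ⟨?_, ?_, ?_, ?_⟩ <;> grind
      · unfold IsDouble at hd
        simp only [extM, pathM]; refine ⟨?_, ?_, ?_⟩ <;> grind

end Dynkin

end SymPair

end

/-! ### Attaching a node to an exceptional diagram -/

noncomputable section
namespace SymPair
set_option linter.unusedSectionVars false

section Dynkin

variable {n k : ℕ} {p q d₁ d₂ : ℤ} {g : ℕ → ℕ → ℤ}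

/-- A finite check over the node and the kind of the edge, as for the other exceptional types. Every
excluded diagram has an explicit nonnegative vector whose image is nonpositive on its support. Only
a simple edge at the end of a long arm is allowed and leads to E₇. -/
theorem isDynkin_extM_E₆ (hk : k < 6) (hpq : IsDouble p q ∨ (p = -1 ∧ q = -1))
    (hf : IsFiniteType 7 (extM (forkM 5 2) 6 k p q)) : IsDynkin 7 (extM (forkM 5 2) 6 k p q) := by
  rcases hpq with (⟨rfl, rfl⟩ | ⟨rfl, rfl⟩) | ⟨rfl, rfl⟩ <;> interval_cases k
  · exact (hf.false_of_vector [2, 2, 2, 1, 0, 1, 1] (by decide) (by decide)).elim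
  · exact (hf.false_of_vector [0, 2, 2, 1, 0, 1, 1] (by decide) (by decide)).elim
  · exact (hf.false_of_vector [0, 1, 2, 0, 0, 1, 1] (by decide) (by decide)).elim
  · exact (hf.false_of_vector [0, 1, 2, 2, 0, 1, 1] (by decide) (by decide)).elim
  · exact (hf.false_of_vector [0, 1, 2, 2, 2, 1, 1] (by decide) (by decide)).elim
  · exact (hf.false_of_vector [0, 1, 2, 1, 0, 2, 1] (by decide) (by decide)).elim
  · exact (hf.false_of_vector [2, 2, 2, 1, 0, 1, 2] (by decide) (by decide)).elim
  · exact (hf.false_of_vector [0, 2, 2, 1, 0, 1, 2] (by decide) (by decide)).elim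
  · exact (hf.false_of_vector [0, 1, 2, 0, 0, 1, 2] (by decide) (by decide)).elim
  · exact (hf.false_of_vector [0, 1, 2, 2, 0, 1, 2] (by decide) (by decide)).elim
  · exact (hf.false_of_vector [0, 1, 2, 2, 2, 1, 2] (by decide) (by decide)).elim
  · exact (hf.false_of_vector [0, 1, 2, 1, 0, 2, 2] (by decide) (by decide)).elim
  · exact DynkinForm.E₇.isDynkin_list [6, 0, 1, 2, 3, 4, 5] (by decide)
  · exact (hf.false_of_vector [1, 2, 2, 1, 0, 1, 1] (by decide) (by decide)).elim
  · exact (hf.false_of_vector [0, 1, 2, 1, 0, 1, 1] (by decide) (by decide)).elim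
  · exact (hf.false_of_vector [0, 1, 2, 2, 1, 1, 1] (by decide) (by decide)).elim
  · exact DynkinForm.E₇.isDynkin_list [6, 4, 3, 2, 1, 0, 5] (by decide)
  · exact (hf.false_of_vector [1, 2, 3, 2, 1, 2, 1] (by decide) (by decide)).elim

theorem isDynkin_extM_E₇ (hk : k < 7) (hpq : IsDouble p q ∨ (p = -1 ∧ q = -1))
    (hf : IsFiniteType 8 (extM (forkM 6 3) 7 k p q)) : IsDynkin 8 (extM (forkM 6 3) 7 k p q) := by
  rcases hpq with (⟨rfl, rfl⟩ | ⟨rfl, rfl⟩) | ⟨rfl, rfl⟩ <;> interval_cases k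
  · exact (hf.false_of_vector [2, 2, 2, 2, 1, 0, 1, 1] (by decide) (by decide)).elim
  · exact (hf.false_of_vector [0, 2, 2, 2, 1, 0, 1, 1] (by decide) (by decide)).elim
  · exact (hf.false_of_vector [0, 0, 2, 2, 1, 0, 1, 1] (by decide) (by decide)).elim
  · exact (hf.false_of_vector [0, 0, 0, 2, 1, 0, 1, 1] (by decide) (by decide)).elim
  · exact (hf.false_of_vector [0, 0, 1, 2, 2, 0, 1, 1] (by decide) (by decide)).elim
  · exact (hf.false_of_vector [0, 0, 1, 2, 2, 2, 1, 1] (by decide) (by decide)).elim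
  · exact (hf.false_of_vector [0, 0, 1, 2, 1, 0, 2, 1] (by decide) (by decide)).elim
  · exact (hf.false_of_vector [2, 2, 2, 2, 1, 0, 1, 2] (by decide) (by decide)).elim
  · exact (hf.false_of_vector [0, 2, 2, 2, 1, 0, 1, 2] (by decide) (by decide)).elim
  · exact (hf.false_of_vector [0, 0, 2, 2, 1, 0, 1, 2] (by decide) (by decide)).elim
  · exact (hf.false_of_vector [0, 0, 0, 2, 1, 0, 1, 2] (by decide) (by decide)).elim
  · exact (hf.false_of_vector [0, 0, 1, 2, 2, 0, 1, 2] (by decide) (by decide)).elim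
  · exact (hf.false_of_vector [0, 0, 1, 2, 2, 2, 1, 2] (by decide) (by decide)).elim
  · exact (hf.false_of_vector [0, 0, 1, 2, 1, 0, 2, 2] (by decide) (by decide)).elim
  · exact DynkinForm.E₈.isDynkin_list [7, 0, 1, 2, 3, 4, 5, 6] (by decide)
  · exact (hf.false_of_vector [1, 2, 2, 2, 1, 0, 1, 1] (by decide) (by decide)).elim
  · exact (hf.false_of_vector [0, 1, 2, 2, 1, 0, 1, 1] (by decide) (by decide)).elim
  · exact (hf.false_of_vector [0, 0, 1, 2, 1, 0, 1, 1] (by decide) (by decide)).elim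
  · exact (hf.false_of_vector [0, 0, 1, 2, 2, 1, 1, 1] (by decide) (by decide)).elim
  · exact (hf.false_of_vector [1, 2, 3, 4, 3, 2, 2, 1] (by decide) (by decide)).elim
  · exact (hf.false_of_vector [0, 1, 2, 3, 2, 1, 2, 1] (by decide) (by decide)).elim

theorem isDynkin_extM_E₈ (hk : k < 8) (hpq : IsDouble p q ∨ (p = -1 ∧ q = -1))
    (hf : IsFiniteType 9 (extM (forkM 7 4) 8 k p q)) : IsDynkin 9 (extM (forkM 7 4) 8 k p q) := by
  rcases hpq with (⟨rfl, rfl⟩ | ⟨rfl, rfl⟩) | ⟨rfl, rfl⟩ <;> interval_cases k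
  · exact (hf.false_of_vector [2, 2, 2, 2, 2, 1, 0, 1, 1] (by decide) (by decide)).elim
  · exact (hf.false_of_vector [0, 2, 2, 2, 2, 1, 0, 1, 1] (by decide) (by decide)).elim
  · exact (hf.false_of_vector [0, 0, 2, 2, 2, 1, 0, 1, 1] (by decide) (by decide)).elim
  · exact (hf.false_of_vector [0, 0, 0, 2, 2, 1, 0, 1, 1] (by decide) (by decide)).elim
  · exact (hf.false_of_vector [0, 0, 0, 0, 2, 1, 0, 1, 1] (by decide) (by decide)).elim
  · exact (hf.false_of_vector [0, 0, 0, 1, 2, 2, 0, 1, 1] (by decide) (by decide)).elim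
  · exact (hf.false_of_vector [0, 0, 0, 1, 2, 2, 2, 1, 1] (by decide) (by decide)).elim
  · exact (hf.false_of_vector [0, 0, 0, 1, 2, 1, 0, 2, 1] (by decide) (by decide)).elim
  · exact (hf.false_of_vector [2, 2, 2, 2, 2, 1, 0, 1, 2] (by decide) (by decide)).elim
  · exact (hf.false_of_vector [0, 2, 2, 2, 2, 1, 0, 1, 2] (by decide) (by decide)).elim
  · exact (hf.false_of_vector [0, 0, 2, 2, 2, 1, 0, 1, 2] (by decide) (by decide)).elim
  · exact (hf.false_of_vector [0, 0, 0, 2, 2, 1, 0, 1, 2] (by decide) (by decide)).elim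
  · exact (hf.false_of_vector [0, 0, 0, 0, 2, 1, 0, 1, 2] (by decide) (by decide)).elim
  · exact (hf.false_of_vector [0, 0, 0, 1, 2, 2, 0, 1, 2] (by decide) (by decide)).elim
  · exact (hf.false_of_vector [0, 0, 0, 1, 2, 2, 2, 1, 2] (by decide) (by decide)).elim
  · exact (hf.false_of_vector [0, 0, 0, 1, 2, 1, 0, 2, 2] (by decide) (by decide)).elim
  · exact (hf.false_of_vector [2, 3, 4, 5, 6, 4, 2, 3, 1] (by decide) (by decide)).elim
  · exact (hf.false_of_vector [1, 2, 2, 2, 2, 1, 0, 1, 1] (by decide) (by decide)).elim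
  · exact (hf.false_of_vector [0, 1, 2, 2, 2, 1, 0, 1, 1] (by decide) (by decide)).elim
  · exact (hf.false_of_vector [0, 0, 1, 2, 2, 1, 0, 1, 1] (by decide) (by decide)).elim
  · exact (hf.false_of_vector [0, 0, 0, 1, 2, 1, 0, 1, 1] (by decide) (by decide)).elim
  · exact (hf.false_of_vector [0, 0, 0, 1, 2, 2, 1, 1, 1] (by decide) (by decide)).elim
  · exact (hf.false_of_vector [0, 1, 2, 3, 4, 3, 2, 2, 1] (by decide) (by decide)).elim
  · exact (hf.false_of_vector [0, 0, 1, 2, 3, 2, 1, 2, 1] (by decide) (by decide)).elim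

theorem isDynkin_extM_F₄ (hk : k < 4) (hpq : IsDouble p q ∨ (p = -1 ∧ q = -1))
    (hf : IsFiniteType 5 (extM (fourM) 4 k p q)) : IsDynkin 5 (extM (fourM) 4 k p q) := by
  rcases hpq with (⟨rfl, rfl⟩ | ⟨rfl, rfl⟩) | ⟨rfl, rfl⟩ <;> interval_cases k
  · exact (hf.false_of_vector [2, 2, 1, 0, 1] (by decide) (by decide)).elim
  · exact (hf.false_of_vector [0, 2, 1, 0, 1] (by decide) (by decide)).elim
  · exact (hf.false_of_vector [0, 2, 2, 0, 1] (by decide) (by decide)).elim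
  · exact (hf.false_of_vector [0, 2, 2, 2, 1] (by decide) (by decide)).elim
  · exact (hf.false_of_vector [2, 2, 1, 0, 2] (by decide) (by decide)).elim
  · exact (hf.false_of_vector [0, 2, 1, 0, 2] (by decide) (by decide)).elim
  · exact (hf.false_of_vector [0, 2, 2, 0, 2] (by decide) (by decide)).elim
  · exact (hf.false_of_vector [0, 2, 2, 2, 2] (by decide) (by decide)).elim
  · exact (hf.false_of_vector [2, 3, 2, 1, 1] (by decide) (by decide)).elim
  · exact (hf.false_of_vector [1, 2, 1, 0, 1] (by decide) (by decide)).elim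
  · exact (hf.false_of_vector [0, 2, 2, 1, 1] (by decide) (by decide)).elim
  · exact (hf.false_of_vector [2, 4, 3, 2, 1] (by decide) (by decide)).elim

end Dynkin

end SymPair

end

/-! ### Attaching a node to a diagram of type D; the inductive step -/

noncomputable section
namespace SymPair
set_option linter.unusedSectionVars false

section Dynkin

variable {N n k : ℕ} {p q d₁ d₂ : ℤ} {g : ℕ → ℕ → ℤ}

theorem forkM_swap (hn : 3 ≤ n) (i : ℕ) (hi : i < n + 1) (j : ℕ) (hj : j < n + 1) :
    forkM n (n - 2) (if i = n - 1 then n else if i = n then n - 1 else i)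
      (if j = n - 1 then n else if j = n then n - 1 else j) = forkM n (n - 2) i j := by
  have h1 : n - 1 ≠ n := by omega
  have h2 : n - 1 ≠ n - 2 := by omega
  have h3 : n - 2 + 1 = n - 1 := by omega
  have h4 : n ≠ n - 1 := by omega
  by_cases hi1 : i = n - 1 <;> by_cases hj1 : j = n - 1 <;> by_cases hi2 : i = n <;>
    by_cases hj2 : j = n <;> simp only [forkM, extM, pathM, hi1, hj1, hi2, hj2] <;> grind

/-- The exchange of the two short legs. -/
theorem isDynkin_extM_fork_of_swap (hn : 3 ≤ n)
    (h : IsFiniteType (n + 2) (extM (forkM n (n - 2)) (n + 1) (n - 1) p q) →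
      IsDynkin (n + 2) (extM (forkM n (n - 2)) (n + 1) (n - 1) p q))
    (hf : IsFiniteType (n + 2) (extM (forkM n (n - 2)) (n + 1) n p q)) :
    IsDynkin (n + 2) (extM (forkM n (n - 2)) (n + 1) n p q) := by
  let s : ℕ → ℕ := fun i => if i = n - 1 then n else if i = n then n - 1 else i
  have hs : s (n - 1) = n := by simp [s]
  have hs' : ∀ i < n + 1, s i < n + 1 := by
    intro i hi; simp only [s]; split_ifs <;> omega
  have hs'' : ∀ i j, s i = s j → i = j := by
    intro i j; simp only [s]; split_ifs <;> omega
  have key : ∀ i < n + 2, ∀ j < n + 2, extM (forkM n (n - 2)) (n + 1) n p q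
      (if i < n + 1 then s i else n + 1) (if j < n + 1 then s j else n + 1) =
      extM (forkM n (n - 2)) (n + 1) (n - 1) p q i j := by
    intro i hi j hj
    have := extM_comp (forkM n (n - 2)) (n := n + 1) (m := n + 1) (k := n - 1) (s := s)
      (fun i hi => (hs' i hi).ne) (fun i _ h => hs'' _ _ h) p q i hi j hj
    rw [hs] at this
    rw [this]
    by_cases h1 : i < n + 1 <;> by_cases h2 : j < n + 1
    · simp [extM, h1.ne, h2.ne, s, forkM_swap hn i h1 j h2]
    all_goals simp [extM, show ¬ i < n + 1 → i = n + 1 by omega, show ¬ j < n + 1 → j = n + 1 by omega, *]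
  have h1 : ∀ i < n + 2, (if i < n + 1 then s i else n + 1) < n + 2 := by
    intro i hi
    split_ifs with h
    · exact (hs' i h).trans (by omega)
    · omega
  have h2 : ∀ i < n + 2, ∀ j < n + 2, (if i < n + 1 then s i else n + 1) =
      (if j < n + 1 then s j else n + 1) → i = j := by
    intro i hi j hj
    split_ifs with h h' h'
    · exact hs'' i j
    · have := hs' i h; omega
    · have := hs' j h'; omega
    · omega
  exact IsDynkin.of_comp (τ := fun i => if i < n + 1 then s i else n + 1)
    ((h ((hf.comp h1 h2).congr key)).congr key) h1 h2

/-- On the long leg the branch node forbids a second branch or a double edge, so a node can only be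
added at the free end, by a simple edge. On a short leg a double edge is forbidden as well, and a
simple edge yields a path with one node attached, already treated. -/
theorem isDynkin_extM_fork (hn : 3 ≤ n) (hk : k < n + 1)
    (hpq : IsDouble p q ∨ (p = -1 ∧ q = -1))
    (hf : IsFiniteType (n + 2) (extM (forkM n (n - 2)) (n + 1) k p q)) :
    IsDynkin (n + 2) (extM (forkM n (n - 2)) (n + 1) k p q) := by
  by_cases hk2 : k ≤ n - 2
  · have hp1 : p ≤ -1 ∧ q ≤ -1 := by unfold IsDouble at hpq; omega
    have hpath : ∀ i, k ≤ i → i < n - 2 →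
        extM (forkM n (n - 2)) (n + 1) k p q i (i + 1) ≤ -1 ∧
        extM (forkM n (n - 2)) (n + 1) k p q (i + 1) i ≤ -1 := by
      intro i hi hi'
      simp only [forkM, extM, pathM]; refine ⟨?_, ?_⟩ <;> grind
    have hfork : extM (forkM n (n - 2)) (n + 1) k p q (n - 2) (n - 1) ≤ -1 ∧
        extM (forkM n (n - 2)) (n + 1) k p q (n - 2) n ≤ -1 ∧
        extM (forkM n (n - 2)) (n + 1) k p q (n - 1) (n - 2) ≤ -1 ∧
        extM (forkM n (n - 2)) (n + 1) k p q n (n - 2) ≤ -1 := by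
      simp only [forkM, extM, pathM]; refine ⟨?_, ?_, ?_, ?_⟩ <;> grind
    rcases hpq with hpq | ⟨rfl, rfl⟩
    · refine (hf.false_of_double_fork (a := k) (b := n - 2) (u := n - 1) (v := n) (u' := n + 1)
        (by omega) (by omega) hpath (by omega) (by omega) (by omega) ?_ hfork).elim
      unfold IsDouble at hpq
      simp only [forkM, extM, pathM]; refine ⟨?_, ?_, ?_⟩ <;> grind
    by_cases hk0 : k = 0
    · subst hk0
      refine ⟨_, DynkinForm.D (n + 1) (by omega), fun i => if i = 0 then n + 1 else i - 1, ?_, ?_, ?_⟩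
      · intro i hi; dsimp only; split_ifs <;> omega
      · intro i hi j hj; dsimp only; split_ifs <;> omega
      · intro i hi j hj
        by_cases h1 : i = 0 <;> by_cases h2 : j = 0 <;> by_cases h3 : i = n + 1 <;>
          by_cases h4 : j = n + 1
        all_goals
          simp only [h1, h2, h3, h4, forkM, extM, pathM]
          clear hpath hfork hf
          grind (splits := 20)
    · refine (hf.false_of_fork_fork (a := k) (b := n - 2) (u := k - 1) (v := n + 1) (u' := n - 1)
        (v' := n) (by omega) (by omega) hpath (by omega) (by omega) (by omega) ?_ hfork).elim
      simp only [forkM, extM, pathM]; refine ⟨?_, ?_, ?_, ?_⟩ <;> grind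
  have hlast : IsFiniteType (n + 2) (extM (forkM n (n - 2)) (n + 1) (n - 1) p q) →
      IsDynkin (n + 2) (extM (forkM n (n - 2)) (n + 1) (n - 1) p q) := by
    intro hf
    rcases hpq with hpq | ⟨rfl, rfl⟩
    · refine (hf.false_of_fork_double (a := n - 2) (b := n - 1) (u := n - 3) (v := n) (u' := n + 1)
        (by omega) (by omega) ?_ (by omega) (by omega) (by omega) ?_ ?_).elim
      · intro i hi hi'
        obtain rfl : i = n - 2 := by omega
        simp only [forkM, extM, pathM]; refine ⟨?_, ?_⟩ <;> grind
      · simp only [forkM, extM, pathM]; refine ⟨?_, ?_, ?_, ?_⟩ <;> grind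
      · unfold IsDouble at hpq
        simp only [forkM, extM, pathM]; refine ⟨?_, ?_, ?_⟩ <;> grind
    -- Exchange of the numbers n and n + 1 puts the new node at the end of the path. The old short
    -- leg n becomes the node attached to n − 2.
    · have h1 : ∀ i < n + 2, (if i = n then n + 1 else if i = n + 1 then n else i) < n + 2 := by
        intro i hi; split_ifs <;> omega
      have h2 : ∀ i < n + 2, ∀ j < n + 2, (if i = n then n + 1 else if i = n + 1 then n else i) =
          (if j = n then n + 1 else if j = n + 1 then n else j) → i = j := by
        intro i hi j hj; split_ifs <;> omega
      have key : ∀ i < n + 2, ∀ j < n + 2, extM (forkM n (n - 2)) (n + 1) (n - 1) (-1) (-1)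
          (if i = n then n + 1 else if i = n + 1 then n else i)
          (if j = n then n + 1 else if j = n + 1 then n else j) =
          extM (pathM (n + 1) (-1) (-1)) (n + 1) (n - 2) (-1) (-1) i j := by
        intro i hi j hj
        by_cases hi1 : i = n <;> by_cases hj1 : j = n <;> by_cases hi2 : i = n + 1 <;>
          by_cases hj2 : j = n + 1
        all_goals simp only [forkM, extM, pathM, hi1, hj1, hi2, hj2]; grind
      exact IsDynkin.of_comp (τ := fun i => if i = n then n + 1 else if i = n + 1 then n else i)
        ((isDynkin_extM_path (n := n + 1) (by omega) ((hf.comp h1 h2).congr key)).congr key) h1 h2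
  obtain rfl | rfl : k = n - 1 ∨ k = n := by omega
  · exact hlast hf
  · exact isDynkin_extM_fork_of_swap hn hlast hf

theorem DynkinForm.exists_neighbour (h : DynkinForm n g) (hn : 2 ≤ n) (hk : k < n) :
    ∃ x < n, x ≠ k ∧ g x k ≤ -1 ∧ g k x ≤ -1 := by
  have hpath : ∀ d₁ d₂ : ℤ, d₁ ≤ -1 → d₂ ≤ -1 → ∀ n k, 2 ≤ n → k < n →
      ∃ x < n, x ≠ k ∧ pathM n d₁ d₂ x k ≤ -1 ∧ pathM n d₁ d₂ k x ≤ -1 := by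
    intro d₁ d₂ h1 h2 n k hn hk
    refine ⟨if k + 1 < n then k + 1 else k - 1, by grind, by grind, ?_, ?_⟩ <;>
    · simp only [pathM]; grind
  have hfork : ∀ m l k, 2 ≤ m → l < m → k < m + 1 →
      ∃ x < m + 1, x ≠ k ∧ forkM m l x k ≤ -1 ∧ forkM m l k x ≤ -1 := by
    intro m l k hm hl hk
    by_cases hkm : k = m
    · exact ⟨l, by omega, by omega, by simp [forkM, extM, hkm, hl.ne], by simp [forkM, extM, hkm, hl.ne]⟩
    · obtain ⟨x, hx, hxk, h1, h2⟩ := hpath (-1) (-1) le_rfl le_rfl m k hm (by omega)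
      exact ⟨x, by omega, hxk, by simpa [forkM, extM, hkm, hx.ne] using h1,
        by simpa [forkM, extM, hkm, hx.ne] using h2⟩
  cases h with
  | A n hn' => exact hpath _ _ (by norm_num) (by norm_num) _ _ hn hk
  | B n hn' => exact hpath _ _ (by norm_num) (by norm_num) _ _ hn hk
  | C n hn' => exact hpath _ _ (by norm_num) (by norm_num) _ _ hn hk
  | D n hn' => exact hfork _ _ _ (by omega) (by omega) hk
  | E₆ => exact hfork _ _ _ (by omega) (by omega) hk
  | E₇ => exact hfork _ _ _ (by omega) (by omega) hk
  | E₈ => exact hfork _ _ _ (by omega) (by omega) hk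
  | F₄ => interval_cases k <;> decide
  | G₂ => exact hpath _ _ (by norm_num) (by norm_num) _ _ hn hk

/-- A finite type matrix which arises from a connected Dynkin diagram by attaching a node to a single
node belongs to a connected Dynkin diagram. -/
theorem DynkinForm.isDynkin_extM (h : DynkinForm n g) (hk : k < n) (hp : p ≤ -1) (hq : q ≤ -1)
    (hf : IsFiniteType (n + 1) (extM g n k p q)) : IsDynkin (n + 1) (extM g n k p q) := by
  have hpn : extM g n k p q n k = p := by simp [extM, hk.ne]
  have hqn : extM g n k p q k n = q := by simp [extM, hk.ne]
  have hedge := hf.edge (i := n) (j := k) (by omega) (by omega) (by omega) (by rwa [hpn]) (by rwa [hqn])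
  rw [hpn, hqn] at hedge
  by_cases ht : p ≤ -3 ∨ q ≤ -3
  -- A node of a triple edge has no other neighbour, so a triple edge can only be attached to a
  -- single node.
  · by_cases hn : 2 ≤ n
    · obtain ⟨x, hx, hxk, h1, h2⟩ := h.exists_neighbour hn hk
      exact (hf.false_of_triple (x := x) (y := k) (v := n) (by omega) (by omega) (by omega) hxk
        (by omega) (by omega) (by simpa [extM, hx.ne, hk.ne] using h1)
        (by simpa [extM, hx.ne, hk.ne] using h2) (by rwa [hqn]) (by rwa [hpn])
        (by rw [hpn, hqn]; exact ht.symm)).elim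
    · cases h with
      | A n hn' =>
        obtain rfl : n = 1 := by omega
        obtain rfl : k = 0 := by omega
        obtain ⟨rfl, rfl⟩ | ⟨rfl, rfl⟩ : (p = -1 ∧ q = -3) ∨ (p = -3 ∧ q = -1) := by omega
        · exact DynkinForm.G₂.isDynkin_list [0, 1] (by decide)
        · exact DynkinForm.G₂.isDynkin_list [1, 0] (by decide)
      | _ => omega
  have hpq : IsDouble p q ∨ (p = -1 ∧ q = -1) := by unfold IsDouble; omega
  cases h with
  | A n hn' =>
    rcases hpq with hpq | ⟨rfl, rfl⟩
    · exact isDynkin_extM_path_double hpq hk hf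
    · exact isDynkin_extM_path hk hf
  | B n hn' => exact isDynkin_extM_doublePath (Or.inr ⟨rfl, rfl⟩) hn' (fun _ => rfl) hk hpq hf
  | C n hn' => exact isDynkin_extM_doublePath (Or.inl ⟨rfl, rfl⟩) (by omega) (by omega) hk hpq hf
  | D n hn' => exact isDynkin_extM_fork hn' hk hpq hf
  | E₆ => exact isDynkin_extM_E₆ hk hpq hf
  | E₇ => exact isDynkin_extM_E₇ hk hpq hf
  | E₈ => exact isDynkin_extM_E₈ hk hpq hf
  | F₄ => exact isDynkin_extM_F₄ hk hpq hf
  | G₂ =>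
    refine (hf.false_of_triple (x := 2) (y := k) (v := 1 - k) (by omega) (by omega) (by omega)
      (by omega) (by omega) (by omega) (by rwa [hpn]) (by rwa [hqn]) ?_ ?_ ?_).elim <;>
    · interval_cases k <;> simp [extM, pathM]

end Dynkin

end SymPair

end

/-! ### The classification of connected Dynkin diagrams -/

noncomputable section
namespace SymPair
set_option linter.unusedSectionVars false

section Classification

/-- Vinberg's criterion for a matrix with arbitrary finite index set. -/
structure IsFiniteTypeMatrix {κ : Type*} [Fintype κ] (A : κ → κ → ℤ) : Prop where
  diag : ∀ i, A i i = 2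
  nonpos : ∀ i j, i ≠ j → A i j ≤ 0
  eq_zero_symm : ∀ i j, A i j = 0 → A j i = 0
  crit : ∀ c : κ → ℤ, (∀ i, 0 ≤ c i) → (∃ i, 0 < c i) → ∃ i, 0 < c i ∧ 0 < ∑ j, A i j * c j

/-- The Dynkin diagram as a graph. -/
def dynkinGraph {κ : Type*} (A : κ → κ → ℤ) : SimpleGraph κ where
  Adj i j := i ≠ j ∧ (A i j ≠ 0 ∨ A j i ≠ 0)
  symm := ⟨fun _ _ h => ⟨h.1.symm, h.2.symm⟩⟩
  loopless := ⟨fun _ h => h.1 rfl⟩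

namespace IsFiniteTypeMatrix

variable {κ : Type*} [Fintype κ] {A : κ → κ → ℤ}

theorem sum_extend {κ' : Type*} [Fintype κ'] (φ : κ' ↪ κ) (c : κ' → ℤ) (k : κ) :
    ∑ j, A k j * Function.extend φ c 0 j = ∑ j, A k (φ j) * c j := by
  classical
  rw [← Finset.sum_subset (Finset.subset_univ (Finset.univ.map φ)), Finset.sum_map]
  · simp [φ.injective.extend_apply]
  · intro j _ hj
    rw [Function.extend_apply', Pi.zero_apply, mul_zero]
    rintro ⟨a, rfl⟩
    exact hj (by simp)

theorem comp (hA : IsFiniteTypeMatrix A) {κ' : Type*} [Fintype κ'] (φ : κ' ↪ κ) :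
    IsFiniteTypeMatrix fun i j => A (φ i) (φ j) where
  diag i := hA.diag _
  nonpos i j hij := hA.nonpos _ _ fun h => hij (φ.injective h)
  eq_zero_symm i j h := hA.eq_zero_symm _ _ h
  crit c hc := by
    rintro ⟨i₀, h₀⟩
    obtain ⟨k, hk, hs⟩ := hA.crit (Function.extend φ c 0)
      (fun i => by
        by_cases h : ∃ a, φ a = i
        · obtain ⟨a, rfl⟩ := h; rw [φ.injective.extend_apply]; exact hc a
        · rw [Function.extend_apply' _ _ _ h]; exact le_rfl)
      ⟨φ i₀, by rwa [φ.injective.extend_apply]⟩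
    rw [sum_extend] at hs
    by_cases h : ∃ a, φ a = k
    · obtain ⟨a, rfl⟩ := h
      rw [φ.injective.extend_apply] at hk
      exact ⟨a, hk, hs⟩
    · rw [Function.extend_apply' _ _ _ h] at hk
      exact absurd hk (lt_irrefl _)

theorem isFiniteType (hA : IsFiniteTypeMatrix A) {N : ℕ} {G : ℕ → κ}
    (hG : ∀ i < N, ∀ j < N, G i = G j → i = j) : IsFiniteType N fun i j => A (G i) (G j) where
  diag i _ := hA.diag _
  nonpos i hi j hj hij := hA.nonpos _ _ fun h => hij (hG i hi j hj h)
  crit c hc := by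
    rintro ⟨i₀, hi₀, h₀⟩
    obtain ⟨k, hk, hs⟩ := (hA.comp ⟨fun i : Fin N => G i, fun i j h => Fin.ext (hG _ i.2 _ j.2 h)⟩).crit
      (fun i => c i) (fun i => hc i) ⟨⟨i₀, hi₀⟩, h₀⟩
    refine ⟨k, k.2, hk, ?_⟩
    rw [Finset.sum_range]
    exact hs

/-- There is no subset of the nodes all of whose elements have two neighbours in the subset. -/
theorem false_of_two_neighbours (hA : IsFiniteTypeMatrix A) {S : Set κ} (hS : S.Nonempty)
    (h : ∀ i ∈ S, ∃ j ∈ S, ∃ k ∈ S, j ≠ k ∧ (dynkinGraph A).Adj i j ∧ (dynkinGraph A).Adj i k) :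
    False := by
  classical
  obtain ⟨i₀, h₀⟩ := hS
  obtain ⟨i, hi, hs⟩ := hA.crit (fun i => if i ∈ S then 1 else 0)
    (fun i => by split_ifs <;> norm_num) ⟨i₀, by simp [h₀]⟩
  have hi : i ∈ S := by by_contra h'; simp [h'] at hi
  obtain ⟨j, hj, k, hk, hjk, hij, hik⟩ := h i hi
  have hadj : ∀ j, (dynkinGraph A).Adj i j → A i j ≤ -1 := by
    intro j hj
    have h1 := hA.nonpos i j hj.1
    have h2 : A i j ≠ 0 := fun h => hj.2.elim (fun h' => h' h) fun h' => h' (hA.eq_zero_symm _ _ h)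
    omega
  have hsub : ({i, j, k} : Finset κ) ⊆ Finset.univ := Finset.subset_univ _
  rw [← Finset.sum_sdiff hsub, Finset.sum_insert (by simp [hij.1, hik.1]), Finset.sum_pair hjk] at hs
  have hle : ∑ x ∈ Finset.univ \ {i, j, k}, A i x * (if x ∈ S then 1 else 0) ≤ 0 := by
    refine Finset.sum_nonpos fun x hx => mul_nonpos_of_nonpos_of_nonneg (hA.nonpos _ _ ?_) ?_
    · rintro rfl; simp at hx
    · split_ifs <;> norm_num
  have := hA.diag i
  have := hadj j hij
  have := hadj k hik
  simp only [hi, hj, hk, if_true, mul_one] at hs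
  omega

/-- Each node of a cycle has two neighbours on the cycle. -/
theorem isAcyclic (hA : IsFiniteTypeMatrix A) : (dynkinGraph A).IsAcyclic := by
  intro v p hp
  refine hA.false_of_two_neighbours (S := {x | x ∈ p.support}) ⟨v, by simp⟩ fun i hi => ?_
  obtain ⟨j, k, hjk, h⟩ := Set.ncard_eq_two.1 (hp.ncard_neighborSet_toSubgraph_eq_two hi)
  have hj : p.toSubgraph.Adj i j := by
    have : j ∈ p.toSubgraph.neighborSet i := by rw [h]; simp
    exact this
  have hk : p.toSubgraph.Adj i k := by
    have : k ∈ p.toSubgraph.neighborSet i := by rw [h]; simp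
    exact this
  exact ⟨j, p.mem_verts_toSubgraph.1 hj.snd_mem, k, p.mem_verts_toSubgraph.1 hk.snd_mem, hjk,
    hj.adj_sub, hk.adj_sub⟩

/-- Two neighbours of v are joined by a path through v and, since the complement of v is connected,
by another one that avoids v. A graph without cycles does not allow this. -/
theorem neighbour_unique (hA : IsFiniteTypeMatrix A) {v x y : κ}
    (hconn : ((dynkinGraph A).induce {v}ᶜ).Connected) (hx : (dynkinGraph A).Adj v x)
    (hy : (dynkinGraph A).Adj v y) : x = y := by
  by_contra hxy
  obtain ⟨p, hp⟩ := hconn.exists_isPath ⟨x, hx.1.symm⟩ ⟨y, hy.1.symm⟩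
  let φ := (SimpleGraph.Embedding.induce (G := dynkinGraph A) ({v}ᶜ : Set κ))
  have hp' : (p.map φ.toHom).IsPath := SimpleGraph.Walk.IsPath.map φ.injective hp
  have hq : (SimpleGraph.Walk.cons hx.symm (SimpleGraph.Walk.cons hy SimpleGraph.Walk.nil)).IsPath := by
    simp [SimpleGraph.Walk.cons_isPath_iff, hxy, hy.1, hx.1.symm]
  have hpq : p.map φ.toHom = _ := congrArg Subtype.val
    ((hA.isAcyclic.subsingleton_path x y).elim ⟨p.map φ.toHom, hp'⟩ ⟨_, hq⟩)
  have hmem : v ∈ (p.map φ.toHom).support :=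
    hpq ▸ (by simp : v ∈ (SimpleGraph.Walk.cons hx.symm (SimpleGraph.Walk.cons hy .nil)).support)
  rw [SimpleGraph.Walk.support_map, List.mem_map] at hmem
  obtain ⟨⟨z, hz⟩, -, hzv⟩ := hmem
  exact hz hzv

/-- The classification of connected Dynkin diagrams. -/
theorem exists_dynkinForm (n : ℕ) : ∀ {κ : Type*} [Fintype κ] {A : κ → κ → ℤ},
    IsFiniteTypeMatrix A → (dynkinGraph A).Connected → Fintype.card κ = n →
    ∃ g, DynkinForm n g ∧ ∃ e : Fin n ≃ κ, ∀ i j, A (e i) (e j) = g i j := by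
  induction n with
  | zero =>
    intro κ _ A hA hconn hcard
    have := hconn.nonempty
    exact absurd hcard Fintype.card_ne_zero
  | succ n ih =>
    intro κ _ A hA hconn hcard
    classical
    by_cases hn : n = 0
    · subst hn
      refine ⟨_, DynkinForm.A 1 le_rfl, (Fintype.equivFinOfCardEq hcard).symm, fun i j => ?_⟩
      obtain rfl : j = i := by omega
      rw [hA.diag]; simp [pathM]
    have : Nontrivial κ := Fintype.one_lt_card_iff_nontrivial.1 (by omega)
    -- A node with connected complement has exactly one neighbour, so the matrix is of the form
    -- `extM`, over a smaller diagram known by induction.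
    obtain ⟨v, hv⟩ := hconn.exists_connected_induce_compl_singleton_of_finite_nontrivial
    obtain ⟨g, hg, e, he⟩ := ih (κ := ↥({v}ᶜ : Set κ)) (A := fun i j => A i.1 j.1)
      (hA.comp (Function.Embedding.subtype _)) (by
        convert hv using 1
        ext i j
        simp [dynkinGraph, Subtype.ext_iff])
      (by
        rw [Fintype.card_compl_set]; simp [hcard])
    obtain ⟨x, hx⟩ : ∃ x, (dynkinGraph A).Adj v x := by
      obtain ⟨y, hy⟩ := exists_ne v
      obtain ⟨w⟩ := hconn.preconnected v y
      cases w with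
      | nil => exact absurd rfl hy
      | cons h _ => exact ⟨_, h⟩
    have hle : ∀ {i j}, (dynkinGraph A).Adj i j → A i j ≤ -1 := by
      intro i j h
      have h1 := hA.nonpos i j h.1
      have h2 : A i j ≠ 0 := fun h0 => h.2.elim (fun h' => h' h0) fun h' => h' (hA.eq_zero_symm _ _ h0)
      omega
    have hxv : x ∈ ({v}ᶜ : Set κ) := hx.1.symm
    set k : Fin n := e.symm ⟨x, hxv⟩ with hk
    have hek : (e k : κ) = x := by simp [hk]
    let G : ℕ → κ := fun i => if h : i < n then e ⟨i, h⟩ else v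
    have hGlt : ∀ i (h : i < n), G i = e ⟨i, h⟩ := fun i h => by simp [G, h]
    have hGn : G n = v := by simp [G]
    have hGinj : ∀ i < n + 1, ∀ j < n + 1, G i = G j → i = j := by
      intro i hi j hj hij
      by_cases h1 : i < n <;> by_cases h2 : j < n
      · rw [hGlt i h1, hGlt j h2] at hij
        simpa using e.injective (Subtype.ext hij)
      · rw [hGlt i h1, show j = n by omega, hGn] at hij
        exact absurd hij (e ⟨i, h1⟩).2
      · rw [hGlt j h2, show i = n by omega, hGn] at hij
        exact absurd hij.symm (e ⟨j, h2⟩).2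
      · omega
    have hoff : ∀ i (h : i < n), i ≠ k → A v (e ⟨i, h⟩) = 0 ∧ A (e ⟨i, h⟩) v = 0 := by
      intro i h hik
      by_contra hcon
      have hadj : (dynkinGraph A).Adj v (e ⟨i, h⟩) := by
        refine ⟨fun h' => (e ⟨i, h⟩).2 h'.symm, ?_⟩
        tauto
      have := hA.neighbour_unique hv hx hadj
      rw [← hek] at this
      exact hik (congrArg Fin.val (e.injective (Subtype.ext this))).symm
    have key : ∀ i < n + 1, ∀ j < n + 1,
        A (G i) (G j) = extM g n k (A v x) (A x v) i j := by
      intro i hi j hj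
      by_cases h1 : i < n <;> by_cases h2 : j < n
      · rw [hGlt i h1, hGlt j h2, he]
        simp [extM, h1.ne, h2.ne]
      · obtain rfl : j = n := by omega
        rw [hGlt i h1, hGn]
        by_cases hik : i = k
        · subst hik
          simp [extM, h1.ne, hek]
        · simp [extM, h1.ne, hik, hoff i h1 hik]
      · obtain rfl : i = n := by omega
        rw [hGlt j h2, hGn]
        by_cases hik : j = k
        · subst hik
          simp [extM, h2.ne, hek]
        · simp [extM, h2.ne, hik, hoff j h2 hik]
      · obtain rfl : i = n := by omega
        obtain rfl : j = i := by omega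
        rw [hA.diag]; simp [extM]
    obtain ⟨g', hg', σ, hσ, hσinj, hσ'⟩ := (hg.isDynkin_extM k.2 (hle hx) (hle hx.symm)
      ((hA.isFiniteType hGinj).congr key)).congr key
    have hbij : Function.Bijective fun i : Fin (n + 1) => G (σ i) := by
      rw [Fintype.bijective_iff_injective_and_card]
      refine ⟨fun i j hij => Fin.ext (hσinj _ i.2 _ j.2 (hGinj _ (hσ _ i.2) _ (hσ _ j.2) hij)), ?_⟩
      rw [hcard, Fintype.card_fin]
    exact ⟨g', hg', Equiv.ofBijective _ hbij, fun i j => hσ' i i.2 j j.2⟩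

end IsFiniteTypeMatrix

variable {ι K M N : Type*} [Finite ι] [Field K] [CharZero K] [AddCommGroup M] [Module K M]
  [AddCommGroup N] [Module K N] {P : RootPairing ι K M N} [P.IsRootSystem] [P.IsCrystallographic]
  [P.IsReduced]

/-- The product of the Cartan matrix A with a positive diagonal matrix D is positive definite. If Ac
were nonpositive on the support of c ≥ 0, then cᵀDAc would be nonpositive. -/
theorem isFiniteTypeMatrix_cartanMatrix (b : P.Base) :
    IsFiniteTypeMatrix b.cartanMatrix where
  diag i := by simp
  nonpos i j hij := b.cartanMatrix_le_zero_of_ne i j hij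
  eq_zero_symm i j h := b.cartanMatrix_apply_eq_zero_iff_symm.1 h
  crit c hc := by
    classical
    rintro ⟨i₀, h₀⟩
    by_contra! hcon
    obtain ⟨d, hd, hpos⟩ := b.exists_cartanMatrix_diagaonal_mul_posDef
    have hlt := hpos.dotProduct_mulVec_pos (x := c) (fun h => by simp [h] at h₀)
    rw [← Matrix.mulVec_mulVec] at hlt
    refine absurd hlt (not_lt.2 (Finset.sum_nonpos fun i _ => ?_))
    simp only [Pi.star_apply, star_trivial, Matrix.mulVec_diagonal]
    rcases (hc i).eq_or_lt with h | h
    · simp [← h]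
    · exact mul_nonpos_of_nonneg_of_nonpos (hc i)
        (mul_nonpos_of_nonneg_of_nonpos (hd i).le (hcon i h))

theorem exists_dynkinForm_of_isIrreducible [P.IsIrreducible] (b : P.Base) :
    ∃ (n : ℕ) (g : ℕ → ℕ → ℤ), DynkinForm n g ∧ ∃ e : Fin n ≃ b.support,
      ∀ i j, b.cartanMatrix (e i) (e j) = g i j := by
  classical
  have := Fintype.ofFinite ι
  have hconn : (dynkinGraph b.cartanMatrix).Connected := by
    have : Nonempty b.support := by
      have : Nonempty ι := by
        by_contra h
        rw [not_nonempty_iff] at h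
        have := RootPairing.IsIrreducible.nontrivial (P := P)
        have := RootPairing.IsRootSystem.span_root_eq_top (P := P)
        rw [Set.range_eq_empty, Submodule.span_empty] at this
        exact bot_ne_top this
      exact b.support_nonempty.to_subtype
    refine SimpleGraph.Connected.mk fun i j => ?_
    refine b.induction_on_cartanMatrix (fun k => (dynkinGraph b.cartanMatrix).Reachable i k)
      (SimpleGraph.Reachable.refl i) fun k l hk hkl => ?_
    by_cases h : k = l
    · exact h ▸ hk
    · exact hk.trans (SimpleGraph.Adj.reachable ⟨h, Or.inr hkl⟩)
  obtain ⟨g, hg, e, he⟩ := IsFiniteTypeMatrix.exists_dynkinForm _ (isFiniteTypeMatrix_cartanMatrix b)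
    hconn rfl
  exact ⟨_, g, hg, e, he⟩

end Classification

end SymPair

end

/-! ### Satake data; the diagrams of type A -/

noncomputable section
namespace SymPair
set_option linter.unusedSectionVars false

section SatakeDatum

/-- The combinatorial constraints on the set `X` of black nodes and the diagram automorphism `τ` of a
split involution, for the Cartan matrix `C` of size `n`. -/
structure SatakeDatum (n : ℕ) (C : ℕ → ℕ → ℤ) (X : ℕ → Prop) (τ : ℕ → ℕ) : Prop where
  mem_lt : ∀ i, X i → i < n
  map_lt : ∀ i < n, τ i < n
  map_map : ∀ i < n, τ (τ i) = i
  cartan : ∀ i < n, ∀ j < n, C (τ i) (τ j) = C i j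
  map_mem : ∀ i < n, (X (τ i) ↔ X i)
  orthogonal : ∀ J : ℕ → Prop, (∀ i, J i → X i) → (∀ i, J i → ∀ k, X k → ¬ J k → C i k = 0) →
    ∀ i, J i → J (τ i)
  dvd : ∀ (m : ℤ) (c : ℕ → ℤ), (∀ i, ¬ X i → c i = 0) →
    (∀ j, X j → m ∣ ∑ i ∈ Finset.range n, C j i * c i) → ∀ i < n, m ∣ c i + c (τ i)
  even : ∀ i < n, ¬ X i → τ i = i → ∀ c : ℕ → ℤ, (∀ i, ¬ X i → c i = 0) →
    (∀ j, X j → ∑ k ∈ Finset.range n, C j k * c k = 2) → Even (∑ k ∈ Finset.range n, C i k * c k)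

variable {n m k : ℕ} {C : ℕ → ℕ → ℤ} {X : ℕ → Prop} {τ : ℕ → ℕ}

theorem sum_pathM {j : ℕ} (hj : j < n) (c : ℕ → ℤ) :
    ∑ i ∈ Finset.range n, pathM n (-1) (-1) j i * c i =
      2 * c j - (if 0 < j then c (j - 1) else 0) - (if j + 1 < n then c (j + 1) else 0) := by
  have h : ∀ i, pathM n (-1) (-1) j i * c i = c i * (if i = j then 2 else 0) +
      (c i * (if i = j - 1 then (if 0 < j then -1 else 0) else 0) +
        c i * (if i = j + 1 then -1 else 0)) := by
    intro i
    simp only [pathM, ite_self]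
    split_ifs <;> omega
  simp only [h, Finset.sum_add_distrib]
  rw [sum_mul_indicator hj, sum_mul_indicator (by omega : j - 1 < n)]
  by_cases hj' : j + 1 < n
  · rw [sum_mul_indicator hj']
    split_ifs <;> ring
  · rw [Finset.sum_eq_zero (s := Finset.range n) (f := fun i => c i * (if i = j + 1 then -1 else 0))]
    · split_ifs <;> ring
    · intro i hi
      rw [Finset.mem_range] at hi
      rw [if_neg (by omega), mul_zero]

theorem sum_forkM_of_lt {j : ℕ} (hj : j < m) (c : ℕ → ℤ) :
    ∑ i ∈ Finset.range (m + 1), forkM m k j i * c i =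
      2 * c j - (if 0 < j then c (j - 1) else 0) - (if j + 1 < m then c (j + 1) else 0) -
        (if j = k then c m else 0) := by
  rw [Finset.sum_range_succ, ← sum_pathM hj, sub_eq_add_neg]
  congr 1
  · refine Finset.sum_congr rfl fun i hi => ?_
    rw [Finset.mem_range] at hi
    simp [forkM, extM, hj.ne, hi.ne]
  · simp only [forkM, extM, hj.ne, if_false, if_true]
    split_ifs <;> ring

theorem sum_forkM_self (hk : k < m) (c : ℕ → ℤ) :
    ∑ i ∈ Finset.range (m + 1), forkM m k m i * c i = 2 * c m - c k := by
  rw [Finset.sum_range_succ]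
  have h : ∀ i ∈ Finset.range m, forkM m k m i * c i = c i * (if i = k then -1 else 0) := by
    intro i hi
    rw [Finset.mem_range] at hi
    simp only [forkM, extM, hi.ne, if_false, if_true]
    split_ifs <;> ring
  rw [Finset.sum_congr rfl h, sum_mul_indicator hk]
  simp only [forkM, extM, if_true]
  ring

theorem exists_maximal_interval (hX : ∀ i, X i → i < n) {i : ℕ} (hi : X i) :
    ∃ a b, a ≤ i ∧ i ≤ b ∧ (∀ k, a ≤ k → k ≤ b → X k) ∧ (a = 0 ∨ ¬ X (a - 1)) ∧ ¬ X (b + 1) := by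
  classical
  have h1 : ∃ a, a ≤ i ∧ ∀ k, a ≤ k → k ≤ i → X k := ⟨i, le_rfl, fun k h h' => by
    obtain rfl : k = i := by omega
    exact hi⟩
  have h2 : ∃ b, i ≤ b ∧ ¬ X (b + 1) := ⟨i + n, by omega, fun h => by have := hX _ h; omega⟩
  obtain ⟨ha, ha'⟩ := Nat.find_spec h1
  obtain ⟨hb, hb'⟩ := Nat.find_spec h2
  refine ⟨Nat.find h1, Nat.find h2, ha, hb, fun k hk hk' => ?_, ?_, hb'⟩
  · by_cases hki : k ≤ i
    · exact ha' k hk hki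
    · obtain ⟨l, rfl⟩ : ∃ l, k = l + 1 := ⟨k - 1, by omega⟩
      by_contra hcon
      exact Nat.find_min h2 (m := l) (by omega) ⟨by omega, hcon⟩
  · by_contra! hcon
    refine Nat.find_min h1 (m := Nat.find h1 - 1) (by omega) ⟨by omega, fun k hk hk' => ?_⟩
    by_cases hk2 : k = Nat.find h1 - 1
    · exact hk2 ▸ hcon.2
    · exact ha' k (by omega) hk'

namespace SatakeDatum

variable (hd : SatakeDatum n C X τ)
include hd

theorem map_injective {i j : ℕ} (hi : i < n) (hj : j < n) (h : τ i = τ j) : i = j := by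
  rw [← hd.map_map i hi, h, hd.map_map j hj]

/-- A component of type `A` of the black nodes whose nodes are fixed by `τ` is a single node. -/
theorem eq_of_interval {a b : ℕ} (hab : a ≤ b) (hb : b < n) (hX : ∀ i, a ≤ i → i ≤ b → X i)
    (hpath : ∀ j, a ≤ j → j ≤ b → ∀ i, a ≤ i → i ≤ b → C j i = pathM n (-1) (-1) j i)
    (hout : ∀ j, X j → j < a ∨ b < j → ∀ i, a ≤ i → i ≤ b → C j i = 0) (hτ : τ a = a) : b = a := by
  -- The coefficients 1, 2, 3, … along a component with k nodes are divisible by k + 1 on its roots.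
  -- If τ fixes the first node, then k + 1 divides 2, so k = 1.
  let c : ℕ → ℤ := fun i => if a ≤ i ∧ i ≤ b then (i : ℤ) - a + 1 else 0
  have hc0 : ∀ i, ¬ (a ≤ i ∧ i ≤ b) → c i = 0 := fun i hi => by simp only [c]; rw [if_neg hi]
  have key := hd.dvd ((b : ℤ) - a + 2) c
    (fun i hi => hc0 i fun h => hi (hX i h.1 h.2)) (fun j hj => ?_) a (by omega)
  · have hca : c a = 1 := by simp [c, hab]
    rw [hτ, hca] at key
    have := Int.le_of_dvd (by norm_num) key
    omega
  · by_cases hj' : a ≤ j ∧ j ≤ b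
    · have : ∑ i ∈ Finset.range n, C j i * c i = ∑ i ∈ Finset.range n, pathM n (-1) (-1) j i * c i := by
        refine Finset.sum_congr rfl fun i _ => ?_
        by_cases hi : a ≤ i ∧ i ≤ b
        · rw [hpath j hj'.1 hj'.2 i hi.1 hi.2]
        · rw [hc0 i hi, mul_zero, mul_zero]
      rw [this, sum_pathM (by omega)]
      have h1 : (2 * c j - (if 0 < j then c (j - 1) else 0) - (if j + 1 < n then c (j + 1) else 0)) =
          if j = b then (b : ℤ) - a + 2 else 0 := by
        simp only [c]
        split_ifs <;> omega
      rw [h1]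
      split_ifs
      · exact dvd_rfl
      · exact dvd_zero _
    · rw [Finset.sum_eq_zero]
      · exact dvd_zero _
      · intro i _
        by_cases hi : a ≤ i ∧ i ≤ b
        · rw [hout j hj (by omega) i hi.1 hi.2, zero_mul]
        · rw [hc0 i hi, mul_zero]

open Classical in
/-- If no two black nodes are joined, then a white node fixed by `τ` has an even number of black
neighbours. -/
theorem even_of_isolated (hdiag : ∀ i < n, C i i = 2) (hiso : ∀ j, X j → ∀ i, X i → i ≠ j → C j i = 0)
    {i : ℕ} (hi : i < n) (hiX : ¬ X i) (hτ : τ i = i) :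
    Even (∑ k ∈ Finset.range n, C i k * (if X k then 1 else 0)) := by
  refine hd.even i hi hiX hτ (fun k => if X k then 1 else 0) (fun k hk => if_neg hk) fun j hj => ?_
  rw [Finset.sum_eq_single_of_mem j (Finset.mem_range.2 (hd.mem_lt j hj))]
  · rw [hdiag j (hd.mem_lt j hj), if_pos hj]; norm_num
  · intro k _ hk
    split_ifs with h
    · rw [hiso j hj k h hk, zero_mul]
    · rw [mul_zero]

/-- A black node without black neighbours is a component of its own, and τ preserves components. -/
theorem fixed_of_isolated {i : ℕ} (hi : X i) (h : ∀ k, X k → k ≠ i → C i k = 0) : τ i = i :=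
  hd.orthogonal (fun k => k = i) (fun _ hk => hk ▸ hi) (fun _ hj l hl hlj => hj ▸ h l hl (hj ▸ hlj)) i rfl

end SatakeDatum

/-- The matrix `C` is that of a path, up to multiplicities of edges. -/
def IsPathLike (n : ℕ) (C : ℕ → ℕ → ℤ) : Prop :=
  ∀ i < n, ∀ j < n, i ≠ j → (C i j ≠ 0 ↔ (i + 1 = j ∨ j + 1 = i))

/-- Adjacency and injectivity determine τ from the image of the first edge, and the bounds leave
only the two symmetries of the path. -/
theorem SatakeDatum.eq_id_or_reverse (hd : SatakeDatum n C X τ) (hC : IsPathLike n C) :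
    (∀ i < n, τ i = i) ∨ (∀ i < n, τ i = n - 1 - i) := by
  have hadj : ∀ i, i + 1 < n → τ i + 1 = τ (i + 1) ∨ τ (i + 1) + 1 = τ i := by
    intro i hi
    have h1 := (hC i (by omega) (i + 1) hi (by omega)).2 (Or.inl rfl)
    rw [← hd.cartan i (by omega) (i + 1) hi] at h1
    exact (hC _ (hd.map_lt _ (by omega)) _ (hd.map_lt _ hi)
      fun h => by have := hd.map_injective (by omega) hi h; omega).1 h1
  have hinj : ∀ i, i + 2 < n → τ i ≠ τ (i + 2) := fun i hi h => by
    have := hd.map_injective (by omega) hi h; omega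
  by_cases hn : n ≤ 1
  · left
    intro i hi
    have := hd.map_lt i hi
    omega
  have h0 := hadj 0 (by omega)
  rw [zero_add] at h0
  rcases h0 with h0 | h0
  · have key : ∀ i, i + 1 < n → τ i = τ 0 + i ∧ τ (i + 1) = τ 0 + (i + 1) := by
      intro i
      induction i with
      | zero => intro h; rw [zero_add]; omega
      | succ i ih =>
        intro h
        have := ih (by omega)
        have := hadj (i + 1) h
        have := hinj i h
        simp only [add_assoc, Nat.reduceAdd] at *
        omega
    have h1 := key (n - 2) (by omega)
    rw [show n - 2 + 1 = n - 1 by omega] at h1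
    have h2 := hd.map_lt (n - 1) (by omega)
    left
    intro i hi
    by_cases hi0 : i + 1 < n
    · have := (key i hi0).1; omega
    · obtain rfl : i = n - 1 := by omega
      omega
  · have key : ∀ i, i + 1 < n → τ i + i = τ 0 ∧ τ (i + 1) + (i + 1) = τ 0 := by
      intro i
      induction i with
      | zero => intro h; rw [zero_add]; omega
      | succ i ih =>
        intro h
        have := ih (by omega)
        have := hadj (i + 1) h
        have := hinj i h
        simp only [add_assoc, Nat.reduceAdd] at *
        omega
    have h1 := key (n - 2) (by omega)
    rw [show n - 2 + 1 = n - 1 by omega] at h1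
    have h2 := hd.map_lt 0 (by omega)
    right
    intro i hi
    by_cases hi0 : i + 1 < n
    · have := (key i hi0).1; omega
    · obtain rfl : i = n - 1 := by omega
      omega

theorem isPathLike_pathM {d₁ d₂ : ℤ} (h1 : d₁ ≠ 0) (h2 : d₂ ≠ 0) : IsPathLike n (pathM n d₁ d₂) := by
  intro i hi j hj hij
  simp only [pathM]
  grind

section TypeA

variable (hd : SatakeDatum n (pathM n (-1) (-1)) X τ)
include hd

theorem SatakeDatum.not_consecutive_path (hτ : ∀ i < n, τ i = i) (i : ℕ) (hi : X i) : ¬ X (i + 1) := by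
  intro hi'
  obtain ⟨a, b, hai, hib, hX, ha, hb⟩ := exists_maximal_interval hd.mem_lt hi
  have hbn := hd.mem_lt b (hX b (by omega) le_rfl)
  have hb1 : i + 1 ≤ b := by
    by_contra h
    obtain rfl : b = i := by omega
    exact hb hi'
  have := hd.eq_of_interval (by omega) hbn hX (fun _ _ _ _ _ _ => rfl) ?_ (hτ a (by omega))
  · omega
  · intro j hj hj' k hk hk'
    have h1 : j ≠ b + 1 := fun h => hb (h ▸ hj)
    have h2 : a = 0 ∨ j ≠ a - 1 := ha.imp_right fun h h' => h (h' ▸ hj)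
    simp only [pathM]; split_ifs <;> omega

/-- The types `AI` and `AII`. -/
theorem SatakeDatum.path_of_eq_id (hτ : ∀ i < n, τ i = i) (hne : ∃ i < n, ¬ X i) :
    (∀ i, ¬ X i) ∨ (Odd n ∧ 3 ≤ n ∧ ∀ i < n, (X i ↔ Even i)) := by
  classical
  have hiso := hd.not_consecutive_path hτ
  -- A white node has an even number of black neighbours, hence both or none. As the black nodes are
  -- isolated, this fixes the whole pattern once the colour of the first node is known.
  have hev : ∀ i < n, ¬ X i → ((0 < i ∧ X (i - 1)) ↔ X (i + 1)) := by
    intro i hi hiX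
    have h := hd.even_of_isolated (fun i _ => by simp [pathM]) ?_ hi hiX (hτ i hi)
    · rw [sum_pathM hi, if_neg hiX] at h
      have h2 : X (i + 1) → i + 1 < n := hd.mem_lt _
      by_cases h3 : X (i + 1) <;> by_cases h4 : X (i - 1) <;> by_cases h5 : 0 < i <;>
        simp [h3, h4, h5, h2] at h ⊢
    · intro j hj k hk hkj
      have h1 : k ≠ j + 1 := fun h => hiso j hj (h ▸ hk)
      have h2 : j ≠ k + 1 := fun h => hiso k hk (h ▸ hj)
      simp only [pathM]; split_ifs <;> omega
  by_cases h0 : X 0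
  · right
    have key : ∀ i, i < n → (X i ↔ Even i) := by
      intro i
      induction i using Nat.strong_induction_on with
      | _ i ih =>
        intro hi
        match i, ih, hi with
        | 0, _, _ => simpa using h0
        | 1, _, _ => simpa using hiso 0 h0
        | i + 2, ih, hi =>
          have h1 := ih i (by omega) (by omega)
          have h2 := ih (i + 1) (by omega) (by omega)
          by_cases hx : X (i + 1)
          · have h3 := hiso _ hx
            rw [iff_false_left h3]
            rw [h2] at hx
            intro h; rw [Nat.even_add_one] at hx
            exact hx (by simpa [Nat.even_add] using h)
          · have h3 := hev (i + 1) (by omega) hx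
            rw [← h3, Nat.add_sub_cancel, h1]
            simp [Nat.even_add]
    obtain ⟨j, hj, hjX⟩ := hne
    -- For even n the last node would be white, with a single black neighbour.
    have hn : Odd n := by
      by_contra hn
      rw [Nat.not_odd_iff_even, Nat.even_iff] at hn
      have h1 := key (n - 1) (by omega)
      have h2 := key (n - 2) (by omega)
      rw [Nat.even_iff] at h1 h2
      have h5 := hev (n - 1) (by omega) (fun h => by have := h1.1 h; omega)
      rw [show n - 1 - 1 = n - 2 by omega] at h5
      have := hd.mem_lt _ (h5.1 ⟨by omega, h2.2 (by omega)⟩)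
      omega
    refine ⟨hn, ?_, key⟩
    have : j ≠ 0 := fun h => hjX (h ▸ h0)
    rw [Nat.odd_iff] at hn
    omega
  · left
    have key : ∀ i, i < n → ¬ X i ∧ ¬ X (i + 1) := by
      intro i
      induction i with
      | zero =>
        intro h
        exact ⟨h0, fun h' => absurd ((hev 0 h h0).2 h').1 (lt_irrefl 0)⟩
      | succ i ih =>
        intro h
        have h1 := ih (by omega)
        exact ⟨h1.2, fun h' => h1.1 (by simpa using ((hev (i + 1) h h1.2).2 h').2)⟩
    exact fun i hi => (key i (hd.mem_lt i hi)).1 hi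

/-- The types `AIII` and `AIV`. -/
theorem SatakeDatum.path_of_eq_reverse (hn : 2 ≤ n) (hτ : ∀ i < n, τ i = n - 1 - i)
    (hne : ∃ i < n, ¬ X i) :
    ∃ r, 1 ≤ r ∧ 2 * r ≤ n + 1 ∧ ∀ i < n, (X i ↔ (r ≤ i ∧ i + r + 1 ≤ n)) := by
  -- A component of X is an interval preserved by the reversal, hence symmetric about the centre.
  -- Two such intervals overlap, so there is only one component.
  have key : ∀ i, X i → ∃ a, a ≤ i ∧ i + a + 1 ≤ n ∧ (∀ k, a ≤ k → k + a + 1 ≤ n → X k) ∧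
      (a = 0 ∨ ¬ X (a - 1)) ∧ ¬ X (n - a) := by
    intro i hi
    obtain ⟨a, b, hai, hib, hX, ha, hb⟩ := exists_maximal_interval hd.mem_lt hi
    have hbn := hd.mem_lt b (hX b (by omega) le_rfl)
    have horth := hd.orthogonal (fun k => a ≤ k ∧ k ≤ b) (fun k hk => hX k hk.1 hk.2) (by
      intro k _ j hj hj'
      have h1 : j ≠ b + 1 := fun h => hb (h ▸ hj)
      have h2 : a = 0 ∨ j ≠ a - 1 := ha.imp_right fun h h' => h (h' ▸ hj)
      simp only [pathM]; split_ifs <;> omega)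
    have h1 := horth a ⟨le_rfl, by omega⟩
    have h2 := horth b ⟨by omega, le_rfl⟩
    rw [hτ a (by omega)] at h1
    rw [hτ b (by omega)] at h2
    refine ⟨a, hai, by omega, fun k hk hk' => hX k hk (by omega), ha, ?_⟩
    rwa [show n - a = b + 1 by omega]
  by_cases hX : ∃ i, X i
  · obtain ⟨i, hi⟩ := hX
    obtain ⟨a, h1, h2, h3, h4, h5⟩ := key i hi
    have h6 : ∀ j < n, (X j ↔ (a ≤ j ∧ j + a + 1 ≤ n)) := by
      refine fun j hj => ⟨fun hjX => ?_, fun h => h3 j h.1 h.2⟩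
      obtain ⟨a', h1', h2', h3', h4', h5'⟩ := key j hjX
      by_cases haa : a' < a
      · rcases h4 with h4 | h4
        · omega
        · exact absurd (h3' (a - 1) (by omega) (by omega)) h4
      · omega
    refine ⟨a, ?_, by omega, h6⟩
    by_contra ha
    obtain ⟨j, hj, hjX⟩ := hne
    exact hjX ((h6 j hj).2 (by omega))
  -- Without black nodes, r takes its largest value, for which the interval is empty.
  · refine ⟨(n + 1) / 2, by omega, by omega, fun i hi => ?_⟩
    have : ¬ X i := fun h => hX ⟨i, h⟩
    simp only [this, false_iff]
    omega

end TypeA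

end SatakeDatum

end SymPair

end

/-! ### Type D: automorphisms of the diagram and black nodes on the long leg -/

noncomputable section
namespace SymPair
set_option linter.unusedSectionVars false

section TypeD

variable {m : ℕ} {X : ℕ → Prop} {τ : ℕ → ℕ}

theorem forkM_ne_zero_iff (hm : 3 ≤ m) {i j : ℕ} (hi : i < m + 1) (hj : j < m + 1) (hij : i ≠ j) :
    forkM m (m - 2) i j ≠ 0 ↔ (i < m ∧ j < m ∧ (i + 1 = j ∨ j + 1 = i)) ∨ (i = m ∧ j + 2 = m) ∨
      (j = m ∧ i + 2 = m) := by
  simp only [forkM, extM, pathM]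
  grind

theorem forkM_eq_pathM {i j : ℕ} (hi : i < m) (hj : j < m) (n k : ℕ) :
    forkM m k i j = pathM n (-1) (-1) i j := by
  simp only [forkM, extM, pathM, hi.ne, hj.ne, if_false, ite_self]

theorem forkM_self {i : ℕ} (k : ℕ) : forkM m k i i = 2 := by
  simp only [forkM, extM, pathM, ite_self]; grind

variable (hm : 3 ≤ m) (hd : SatakeDatum (m + 1) (forkM m (m - 2)) X τ)
include hm hd

theorem SatakeDatum.fork_adj {i j : ℕ} (hi : i < m + 1) (hj : j < m + 1) (hij : i ≠ j)
    (h : (i < m ∧ j < m ∧ (i + 1 = j ∨ j + 1 = i)) ∨ (i = m ∧ j + 2 = m) ∨ (j = m ∧ i + 2 = m)) :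
    τ i ≠ τ j ∧ ((τ i < m ∧ τ j < m ∧ (τ i + 1 = τ j ∨ τ j + 1 = τ i)) ∨ (τ i = m ∧ τ j + 2 = m) ∨
      (τ j = m ∧ τ i + 2 = m)) := by
  have hne : τ i ≠ τ j := fun h => hij (hd.map_injective hi hj h)
  refine ⟨hne, (forkM_ne_zero_iff hm (hd.map_lt i hi) (hd.map_lt j hj) hne).1 ?_⟩
  rw [hd.cartan i hi j hj]
  exact (forkM_ne_zero_iff hm hi hj hij).2 h

/-- The branch node is the only one with three neighbours. -/
theorem SatakeDatum.fork_branch : τ (m - 2) = m - 2 := by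
  have h1 := hd.fork_adj hm (i := m - 2) (j := m - 3) (by omega) (by omega) (by omega) (by omega)
  have h2 := hd.fork_adj hm (i := m - 2) (j := m - 1) (by omega) (by omega) (by omega) (by omega)
  have h3 := hd.fork_adj hm (i := m - 2) (j := m) (by omega) (by omega) (by omega) (by omega)
  have h4 : τ (m - 3) ≠ τ (m - 1) := fun h => by
    have := hd.map_injective (by omega) (by omega) h; omega
  have h5 : τ (m - 3) ≠ τ m := fun h => by
    have := hd.map_injective (by omega) (by omega) h; omega
  have h6 : τ (m - 1) ≠ τ m := fun h => by
    have := hd.map_injective (by omega) (by omega) h; omega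
  omega

/-- For m = 3 the three legs are equivalent, and `h0` distinguishes the one that τ fixes. For larger
m only one leg has more than one node, so it is preserved. -/
theorem SatakeDatum.fork_eq_id_or_swap (h0 : m = 3 → τ 0 = 0) :
    (∀ i < m + 1, τ i = i) ∨ ((∀ i, i + 2 ≤ m → τ i = i) ∧ τ (m - 1) = m ∧ τ m = m - 1) := by
  have hb := hd.fork_branch hm
  have h1 := hd.fork_adj hm (i := m - 2) (j := m - 3) (by omega) (by omega) (by omega) (by omega)
  have h2 := hd.fork_adj hm (i := m - 2) (j := m - 1) (by omega) (by omega) (by omega) (by omega)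
  have h3 := hd.fork_adj hm (i := m - 2) (j := m) (by omega) (by omega) (by omega) (by omega)
  have h4 : τ (m - 3) ≠ τ (m - 1) := fun h => by
    have := hd.map_injective (by omega) (by omega) h; omega
  have h5 : τ (m - 3) ≠ τ m := fun h => by
    have := hd.map_injective (by omega) (by omega) h; omega
  have h6 : τ (m - 1) ≠ τ m := fun h => by
    have := hd.map_injective (by omega) (by omega) h; omega
  have h7 : τ (m - 3) = m - 3 := by
    by_cases h3 : m = 3
    · subst h3; exact h0 rfl
    have h8 := hd.fork_adj hm (i := m - 3) (j := m - 4) (by omega) (by omega) (by omega) (by omega)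
    have h9 : τ (m - 4) ≠ τ (m - 2) := fun h => by
      have := hd.map_injective (by omega) (by omega) h; omega
    omega
  -- Induction along the long leg, away from the branch node.
  have key : ∀ d, d + 3 ≤ m → τ (m - 3 - d) = m - 3 - d ∧ τ (m - 2 - d) = m - 2 - d := by
    intro d
    induction d with
    | zero => intro _; exact ⟨h7, hb⟩
    | succ d ih =>
      intro h
      have := ih (by omega)
      have h8 := hd.fork_adj hm (i := m - 3 - d) (j := m - 3 - (d + 1)) (by omega) (by omega)
        (by omega) (by omega)
      have h9 : τ (m - 3 - (d + 1)) ≠ τ (m - 2 - d) := fun h => by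
        have := hd.map_injective (by omega) (by omega) h; omega
      rw [show m - 2 - (d + 1) = m - 3 - d by omega]
      omega
  have hlow : ∀ i, i + 2 ≤ m → τ i = i := by
    intro i hi
    by_cases hi3 : i + 3 ≤ m
    · have := (key (m - 3 - i) (by omega)).1
      rwa [show m - 3 - (m - 3 - i) = i by omega] at this
    · obtain rfl : i = m - 2 := by omega
      exact hb
  by_cases h8 : τ m = m
  · left
    intro i hi
    by_cases hi2 : i + 2 ≤ m
    · exact hlow i hi2
    · by_cases him : i = m
      · rw [him, h8]
      · obtain rfl : i = m - 1 := by omega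
        omega
  · right
    exact ⟨hlow, by omega, by omega⟩

/-- Black nodes on the long leg are isolated, as long as they do not belong to a component that
contains the branch node and the last node. -/
theorem SatakeDatum.fork_not_consecutive {i : ℕ} (hi : X i) (him : i + 1 < m) (hτ : ∀ j ≤ i, τ j = j)
    (h : ¬ X m ∨ ∃ k, i < k ∧ k + 2 ≤ m ∧ ¬ X k) : ¬ X (i + 1) := by
  intro hi'
  obtain ⟨a, b, hai, hib, hX, ha, hb⟩ := exists_maximal_interval hd.mem_lt hi
  have hbn := hd.mem_lt b (hX b (by omega) le_rfl)
  have hb1 : i + 1 ≤ b := by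
    by_contra h
    obtain rfl : b = i := by omega
    exact hb hi'
  -- In either case the component is of type A: the node m is white, or the interval does not reach
  -- the branch node m − 2.
  have hbm : ¬ X m ∧ b < m ∨ b + 2 < m := by
    rcases h with h | ⟨k, hik, hkm, hk⟩
    · left
      refine ⟨h, ?_⟩
      by_contra hb'
      exact h (hX m (by omega) (by omega))
    · right
      by_contra hb'
      exact hk (hX k (by omega) (by omega))
  have := hd.eq_of_interval (by omega) hbn hX
    (fun j _ hj k _ hk => forkM_eq_pathM (by omega) (by omega) _ _) ?_ (hτ a (by omega))
  · omega
  · intro j hj hj' k hk hk'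
    have h1 : j ≠ b + 1 := fun h => hb (h ▸ hj)
    have h2 : a = 0 ∨ j ≠ a - 1 := ha.imp_right fun h h' => h (h' ▸ hj)
    have h3 : j = m → b + 2 < m := by
      rintro rfl
      rcases hbm with h | h
      · exact absurd hj h.1
      · exact h
    by_contra hne
    have := (forkM_ne_zero_iff hm (hd.mem_lt j hj) (by omega) (by omega)).1 hne
    omega

end TypeD

end SymPair

end

/-! ### Type D: the possible sets of black nodes -/

noncomputable section
namespace SymPair
set_option linter.unusedSectionVars false

section TypeD

variable {m s : ℕ} {X : ℕ → Prop} {τ : ℕ → ℕ}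

theorem alternating_of_even {N : ℕ} (hiso : ∀ i, i + 1 < N → X i → ¬ X (i + 1))
    (hev : ∀ i, i + 1 < N → ¬ X i → ((0 < i ∧ X (i - 1)) ↔ X (i + 1))) :
    (∀ i < N, ¬ X i) ∨ (∀ i < N, (X i ↔ Even i)) := by
  by_cases h0 : X 0
  · right
    intro i
    induction i using Nat.strong_induction_on with
    | _ i ih =>
      intro hi
      match i, ih, hi with
      | 0, _, _ => simpa using h0
      | 1, _, hi => simpa using hiso 0 hi h0
      | i + 2, ih, hi =>
        have h1 := ih i (by omega) (by omega)
        have h2 := ih (i + 1) (by omega) (by omega)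
        rw [Nat.even_iff] at h1 h2 ⊢
        by_cases hx : X (i + 1)
        · have h3 := hiso _ hi hx
          rw [iff_false_left h3]
          have := h2.1 hx
          omega
        · have h3 := hev (i + 1) hi hx
          rw [← h3, Nat.add_sub_cancel, h1]
          omega
  · left
    have key : ∀ i, i + 1 < N → ¬ X i ∧ ¬ X (i + 1) := by
      intro i
      induction i with
      | zero => exact fun h => ⟨h0, fun h' => absurd ((hev 0 h h0).2 h').1 (lt_irrefl 0)⟩
      | succ i ih =>
        intro h
        have h1 := ih (by omega)
        exact ⟨h1.2, fun h' => h1.1 (by simpa using ((hev (i + 1) h h1.2).2 h').2)⟩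
    intro i hi
    by_cases hi' : i + 1 < N
    · exact (key i hi').1
    · match i, hi, hi' with
      | 0, _, _ => exact h0
      | i + 1, hi, _ => exact (key i hi).2

theorem forall_white_of_even
    (h : ∀ i < s, ¬ X i → ((0 < i ∧ X (i - 1)) ↔ (i + 1 < s ∧ X (i + 1))))
    (hs : ¬ X (s - 1)) : ∀ i < s, ¬ X i := by
  have key : ∀ d, d < s → ¬ X (s - 1 - d) ∧ (0 < d → ¬ X (s - d)) := by
    intro d
    induction d with
    | zero => exact fun _ => ⟨hs, fun h => absurd h (lt_irrefl 0)⟩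
    | succ d ih =>
      intro hd
      have h1 := ih (by omega)
      have h2 := h (s - 1 - d) (by omega) h1.1
      rw [show s - 1 - d - 1 = s - 1 - (d + 1) by omega, show s - 1 - d + 1 = s - d by omega] at h2
      refine ⟨fun h3 => ?_, fun _ => ?_⟩
      · have h4 := h2.1 ⟨by omega, h3⟩
        exact h1.2 (by omega) h4.2
      · rw [show s - (d + 1) = s - 1 - d by omega]; exact h1.1
  intro i hi
  have := (key (s - 1 - i) (by omega)).1
  rwa [show s - 1 - (s - 1 - i) = i by omega] at this

open Classical in
/-- The coefficients of the sum of the positive coroots for a component of type `D` with the nodes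
`s, …, l + 2`, and `1` at the other black nodes. -/
def forkWeight (X : ℕ → Prop) (l s : ℕ) (q : ℤ) (i : ℕ) : ℤ :=
  if i < s then if X i then 1 else 0
  else if i ≤ l then ((i : ℤ) - s + 1) * (2 * l + 4 - s - i)
  else if i ≤ l + 2 then q else 0

section Component

variable {l : ℕ} (hl : 1 ≤ l) (hd : SatakeDatum (l + 3) (forkM (l + 2) l) X τ)
  (hτ : ∀ i ≤ l, τ i = i) (hs : 1 ≤ s) (hsl : s ≤ l) (hX : ∀ i, s ≤ i → i ≤ l + 2 → X i)
  (hsX : ¬ X (s - 1))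
include hl hd hτ hs hsl hX hsX

/-- The black nodes below s are isolated, and those from s on form a component of type D. The parity
condition with the weights `forkWeight` counts only the isolated neighbours below s, because the
weight at s is even. -/
theorem SatakeDatum.fork_even_below {i : ℕ} (hi : i < s) (hiX : ¬ X i) :
    (0 < i ∧ X (i - 1)) ↔ (i + 1 < s ∧ X (i + 1)) := by
  classical
  have hiso : ∀ j, j + 1 < s → X j → ¬ X (j + 1) := fun j hj hjX =>
    hd.fork_not_consecutive (m := l + 2) (by omega) hjX (by omega)
      (fun k hk => hτ k (by omega)) (Or.inr ⟨s - 1, by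
        by_contra h
        obtain rfl : j = s - 1 := by omega
        exact hsX hjX, by omega, hsX⟩)
  -- The coefficient at the two last nodes is N(N − 1)/2, where N = l + 3 − s is the number of nodes
  -- of the component.
  obtain ⟨q, hq⟩ : ∃ q : ℤ, ((l : ℤ) + 3 - s) * (l + 2 - s) = 2 * q := by
    have h := Int.even_mul_succ_self ((l : ℤ) + 2 - s)
    obtain ⟨q, hq⟩ := h.two_dvd
    exact ⟨q, by rw [← hq]; ring⟩
  set c := forkWeight X l s q with hc
  have hlow : ∀ j < s, c j = if X j then 1 else 0 := fun j hj => by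
    simp only [hc, forkWeight, if_pos hj]
  -- The formula also holds at s − 1: both sides vanish, since this node is white. The row sum at s
  -- then needs no separate treatment.
  have hmid : ∀ j, s ≤ j + 1 → j ≤ l → c j = ((j : ℤ) - s + 1) * (2 * l + 4 - s - j) := by
    intro j hj hjl
    by_cases hjs : j < s
    · obtain rfl : j = s - 1 := by omega
      rw [hlow _ hjs, if_neg hsX]
      push_cast [hs]
      ring
    · simp only [hc, forkWeight, if_neg hjs, if_pos hjl]
  have hq1 : c (l + 1) = q := by
    simp only [hc, forkWeight]
    rw [if_neg (by omega), if_neg (by omega), if_pos (by omega)]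
  have hq2 : c (l + 2) = q := by
    simp only [hc, forkWeight]
    rw [if_neg (by omega), if_neg (by omega), if_pos (by omega)]
  have hev := hd.even i (by omega) hiX (hτ i (by omega)) c ?_ ?_
  · rw [sum_forkM_of_lt (by omega), if_pos (by omega : i + 1 < l + 2), if_neg (by omega : i ≠ l),
      hlow i hi, if_neg hiX] at hev
    have h1 : 0 < i → c (i - 1) = if X (i - 1) then 1 else 0 := fun h => hlow _ (by omega)
    by_cases his : i + 1 < s
    · rw [hlow _ his] at hev
      by_cases h2 : 0 < i
      · rw [if_pos h2, h1 h2] at hev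
        by_cases h3 : X (i - 1) <;> by_cases h4 : X (i + 1) <;> simp [h2, h3, h4, his] at hev ⊢
      · by_cases h4 : X (i + 1) <;> simp [h2, h4] at hev ⊢
    · obtain rfl : s = i + 1 := by omega
      have h5 : Even (c (i + 1)) := by
        rw [hmid _ (by omega) (by omega)]
        refine Even.mul_left ⟨(l : ℤ) + 2 - (i + 1), ?_⟩ _
        push_cast
        ring
      by_cases h2 : 0 < i
      · rw [if_pos h2, h1 h2] at hev
        by_cases h3 : X (i - 1)
        · simp [h3, h5, Int.even_sub] at hev
        · simp [h3]
      · simp [h2]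
  · intro j hj
    have h1 : ¬ (s ≤ j ∧ j ≤ l + 2) := fun h => hj (hX j h.1 h.2)
    by_cases h2 : j < s
    · rw [hlow j h2, if_neg hj]
    · simp only [hc, forkWeight]
      rw [if_neg h2, if_neg (by omega), if_neg (by omega)]
  · intro j hj
    by_cases hjs : j < s
    · have hj1 : j + 1 < s := by
        by_contra h
        obtain rfl : j = s - 1 := by omega
        exact hsX hj
      have h1 := hiso j hj1 hj
      rw [sum_forkM_of_lt (by omega), if_pos (by omega : j + 1 < l + 2), if_neg (by omega : j ≠ l),
        hlow j hjs, hlow _ hj1, if_pos hj, if_neg h1]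
      by_cases h2 : 0 < j
      · have h3 : ¬ X (j - 1) := fun h => hiso (j - 1) (by omega) h
          (by rwa [show j - 1 + 1 = j by omega])
        rw [if_pos h2, hlow _ (by omega), if_neg h3]; norm_num
      · rw [if_neg h2]; norm_num
    · obtain ⟨j, rfl⟩ : ∃ k, j = k + 1 := ⟨j - 1, by omega⟩
      have hjl := hd.mem_lt _ hj
      by_cases h1 : j + 1 < l
      · rw [sum_forkM_of_lt (by omega), if_pos (by omega), if_pos (by omega), if_neg (by omega),
          Nat.add_sub_cancel, hmid _ (by omega) (by omega), hmid _ (by omega) (by omega),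
          hmid _ (by omega) (by omega)]
        push_cast
        ring
      by_cases h2 : j + 1 = l
      · subst h2
        rw [sum_forkM_of_lt (by omega), if_pos (by omega), if_pos (by omega), if_pos rfl,
          Nat.add_sub_cancel, hmid _ (by omega) (by omega), hmid _ (by omega) (by omega), hq1, hq2]
        push_cast at hq ⊢
        linear_combination hq
      by_cases h3 : j = l
      · subst h3
        rw [sum_forkM_of_lt (by omega), if_pos (by omega), if_neg (by omega), if_neg (by omega),
          Nat.add_sub_cancel, hq1, hmid _ (by omega) (by omega)]
        linear_combination -hq
      · obtain rfl : j = l + 1 := by omega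
        rw [show l + 1 + 1 = l + 2 by rfl, sum_forkM_self (by omega), hq2, hmid _ (by omega) (by omega)]
        linear_combination -hq

end Component

variable (hm : 3 ≤ m) (hd : SatakeDatum (m + 1) (forkM m (m - 2)) X τ)
include hm hd

open Classical in
/-- The number of black neighbours of a white node on the long leg, if the black nodes are isolated. -/
theorem SatakeDatum.fork_even_of_isolated (hτ : ∀ i, i + 2 ≤ m → τ i = i)
    (hiso : ∀ i, i + 1 < m → X i → ¬ X (i + 1)) (hm2 : X m → ¬ X (m - 2)) {i : ℕ} (hi : i + 2 ≤ m)
    (hiX : ¬ X i) :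
    Even ((if 0 < i ∧ X (i - 1) then 1 else 0) + (if X (i + 1) then 1 else 0) +
      (if i + 2 = m ∧ X m then 1 else 0) : ℤ) := by
  have h := hd.even_of_isolated (fun i _ => forkM_self _) ?_ (by omega) hiX (hτ i hi)
  · rw [sum_forkM_of_lt (by omega), if_pos (by omega : i + 1 < m), if_neg hiX] at h
    have h1 : i = m - 2 ↔ i + 2 = m := by omega
    rw [Int.even_iff] at h ⊢
    by_cases h2 : 0 < i <;> by_cases h3 : i + 2 = m <;> simp only [h1, h2, h3, if_true, if_false,
      true_and, false_and] at h ⊢ <;> omega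
  · intro j hj k hk hkj
    by_contra hne
    have h1 : k ≠ j + 1 ∨ m ≤ j + 1 := by
      by_contra! h; exact hiso j (by omega) hj (h.1 ▸ hk)
    have h2 : j ≠ k + 1 ∨ m ≤ k + 1 := by
      by_contra! h; exact hiso k (by omega) hk (h.1 ▸ hj)
    have h3 : k = m → j ≠ m - 2 := by rintro rfl rfl; exact hm2 hk hj
    have h4 : j = m → k ≠ m - 2 := by rintro rfl rfl; exact hm2 hj hk
    have := (forkM_ne_zero_iff hm (hd.mem_lt j hj) (hd.mem_lt k hk) (Ne.symm hkj)).1 hne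
    omega

/-- The Satake diagrams of type `D`, up to the exchange of the last two nodes. -/
theorem SatakeDatum.fork_classify
    (hτ : (∀ i < m + 1, τ i = i) ∨ ((∀ i, i + 2 ≤ m → τ i = i) ∧ τ (m - 1) = m ∧ τ m = m - 1))
    (hX : X m → X (m - 1)) (hne : ∃ i < m + 1, ¬ X i) :
    (∃ r, 1 ≤ r ∧ r + 1 ≤ m ∧ ∀ i < m + 1, (X i ↔ r ≤ i)) ∨
    (∀ i, ¬ X i) ∨
    ((∀ i < m + 1, τ i = i) ∧ Odd m ∧ ∀ i < m + 1, (X i ↔ Even i)) ∨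
    ((τ (m - 1) = m ∧ τ m = m - 1) ∧ Even m ∧ ∀ i < m + 1, (X i ↔ Even i ∧ i + 2 ≤ m)) := by
  have hlow : ∀ i, i + 2 ≤ m → τ i = i := by
    rcases hτ with h | h
    · exact fun i hi => h i (by omega)
    · exact h.1
  by_cases hXm : X m
  · have hXm1 := hX hXm
    by_cases hXb : X (m - 2)
    · left
      obtain ⟨a, b, ham, hmb, hab, ha, hb⟩ := exists_maximal_interval hd.mem_lt hXm
      have hbn := hd.mem_lt b (hab b (by omega) le_rfl)
      obtain rfl : b = m := by omega
      have ha1 : 1 ≤ a := by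
        by_contra h
        obtain ⟨j, hj, hjX⟩ := hne
        exact hjX (hab j (by omega) (by omega))
      have ha2 : ¬ X (a - 1) := ha.resolve_left (by omega)
      obtain ⟨a', hab', ha'⟩ : ∃ a', a' + 2 ≤ b ∧ (∀ k, a' ≤ k → k ≤ b → X k) ∧ a' = a := by
        refine ⟨a, ?_, hab, rfl⟩
        by_contra h
        by_cases h1 : a = b
        · exact ha2 (by rwa [h1])
        · exact ha2 (by rwa [show a - 1 = b - 2 by omega])
      obtain ⟨l, rfl⟩ : ∃ l, b = l + 2 := ⟨b - 2, by omega⟩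
      have hal : a ≤ l := by omega
      have hwhite := forall_white_of_even (fun i hi hiX =>
        hd.fork_even_below (l := l) (s := a) (by omega) (fun j hj => hlow j (by omega)) ha1 hal
          hab ha2 hi hiX) ha2
      refine ⟨a, ha1, by omega, fun i hi => ⟨fun h => ?_, fun h => hab i h (by omega)⟩⟩
      by_contra h'
      exact hwhite i (by omega) h
    · left
      have hiso : ∀ i, i + 1 < m → X i → ¬ X (i + 1) := by
        intro i hi hiX
        by_cases him : i + 2 < m
        · exact hd.fork_not_consecutive hm hiX (by omega) (fun k hk => hlow k (by omega))
            (Or.inr ⟨m - 2, by omega, by omega, hXb⟩)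
        · exact absurd (show X (m - 2) by rwa [show m - 2 = i by omega]) hXb
      have hwhite : ∀ i < m - 1, ¬ X i := forall_white_of_even (s := m - 1) (fun i hi hiX => by
        have h := hd.fork_even_of_isolated hm hlow hiso (fun _ => hXb) (by omega) hiX
        -- The branch node sees the two black nodes m − 1 and m. They cancel modulo 2, so its
        -- remaining neighbour is white.
        by_cases him : i + 2 = m
        · rw [show i + 1 = m - 1 by omega] at h ⊢
          by_cases h1 : 0 < i ∧ X (i - 1)
          · simp [h1, hXm1, him, hXm] at h
            exact absurd h (by decide)
          · simp [h1]
        · have h2 : i + 1 < m - 1 := by omega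
          by_cases h1 : 0 < i ∧ X (i - 1) <;> by_cases h3 : X (i + 1) <;>
            simp [h1, h3, him, h2] at h ⊢) (by rwa [show m - 1 - 1 = m - 2 by omega])
      refine ⟨m - 1, by omega, by omega, fun i hi => ⟨fun h => ?_, fun h => ?_⟩⟩
      · by_contra h'
        exact hwhite i (by omega) h
      · obtain rfl | rfl : i = m - 1 ∨ i = m := by omega
        exacts [hXm1, hXm]
  · right
    have hiso : ∀ i, i + 1 < m → X i → ¬ X (i + 1) := fun i hi hiX =>
      hd.fork_not_consecutive hm hiX hi (fun k hk => hlow k (by omega)) (Or.inl hXm)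
    have hev : ∀ i, i + 1 < m → ¬ X i → ((0 < i ∧ X (i - 1)) ↔ X (i + 1)) := by
      intro i hi hiX
      have h := hd.fork_even_of_isolated hm hlow hiso (fun h => absurd h hXm) (by omega) hiX
      by_cases h1 : 0 < i ∧ X (i - 1) <;> by_cases h3 : X (i + 1) <;>
        simp [h1, h3, hXm] at h ⊢
    rcases alternating_of_even hiso hev with h | h
    · left
      intro i hi
      have := hd.mem_lt i hi
      by_cases him : i = m
      · exact hXm (him ▸ hi)
      · exact h i (by omega) hi
    · right
      by_cases hm' : X (m - 1)
      · left
        have hodd : Odd m := by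
          have := (h (m - 1) (by omega)).1 hm'
          rw [Nat.even_iff] at this
          rw [Nat.odd_iff]; omega
        refine ⟨?_, hodd, fun i hi => ?_⟩
        -- The nodes m − 1 and m have different colours, so τ cannot exchange them.
        · refine hτ.resolve_right fun h' => hXm ?_
          rw [← h'.2.1, hd.map_mem _ (by omega)]
          exact hm'
        · by_cases him : i = m
          · subst him
            simp [hXm, Nat.not_even_iff_odd.2 hodd]
          · exact h i (by omega)
      · right
        have hev' : Even m := by
          have := (h (m - 1) (by omega)).not.1 hm'
          rw [Nat.even_iff] at this ⊢
          omega
        refine ⟨?_, hev', fun i hi => ?_⟩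
        -- If τ fixed the white node m, its only neighbour m − 2, which is black, would violate
        -- parity.
        · refine (hτ.resolve_left fun h' => ?_).2
          have h1 := hd.even_of_isolated (fun i _ => forkM_self _) ?_ (by omega : m < m + 1) hXm
            (h' m (by omega))
          · rw [sum_forkM_self (by omega), if_neg hXm, if_pos ((h (m - 2) (by omega)).2
              (by rw [Nat.even_iff] at hev' ⊢; omega))] at h1
            exact absurd h1 (by decide)
          · intro j hj k hk hkj
            by_contra hne
            have h1 : k ≠ j + 1 ∨ m ≤ j + 1 := by
              by_contra! h; exact hiso j (by omega) hj (h.1 ▸ hk)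
            have h2 : j ≠ k + 1 ∨ m ≤ k + 1 := by
              by_contra! h; exact hiso k (by omega) hk (h.1 ▸ hj)
            have h3 : k ≠ m := fun h => hXm (h ▸ hk)
            have h4 : j ≠ m := fun h => hXm (h ▸ hj)
            have := (forkM_ne_zero_iff hm (hd.mem_lt j hj) (hd.mem_lt k hk) (Ne.symm hkj)).1 hne
            omega
        · by_cases him : i < m
          · rw [h i him, Nat.even_iff]
            rw [Nat.even_iff] at hev'
            omega
          · obtain rfl : i = m := by omega
            simp [hXm]

end TypeD

end SymPair

end

/-! ### Opposition in type D; the diagrams of type E₆ -/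

noncomputable section
namespace SymPair
set_option linter.unusedSectionVars false

section Lists

variable {n : ℕ} {C : ℕ → ℕ → ℤ} {X : ℕ → Prop} {τ : ℕ → ℕ} (hd : SatakeDatum n C X τ)
include hd

theorem SatakeDatum.dvd_list (m : ℤ) (l : List ℤ) (hl : l.length ≤ n)
    (h0 : ∀ i < n, ¬ X i → l.getD i 0 = 0)
    (h : ∀ j < n, X j → m ∣ ∑ i ∈ Finset.range n, C j i * l.getD i 0) (i : ℕ) (hi : i < n) :
    m ∣ l.getD i 0 + l.getD (τ i) 0 := by
  refine hd.dvd m (fun i => l.getD i 0) (fun i hiX => ?_) (fun j hj => h j (hd.mem_lt j hj) hj) i hi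
  by_cases hin : i < n
  · exact h0 i hin hiX
  · exact List.getD_eq_default _ _ (by omega)

theorem SatakeDatum.even_list (l : List ℤ) (hl : l.length ≤ n)
    (h0 : ∀ i < n, ¬ X i → l.getD i 0 = 0)
    (h : ∀ j < n, X j → ∑ i ∈ Finset.range n, C j i * l.getD i 0 = 2) {i : ℕ} (hi : i < n)
    (hiX : ¬ X i) (hτ : τ i = i) : Even (∑ k ∈ Finset.range n, C i k * l.getD k 0) := by
  refine hd.even i hi hiX hτ (fun i => l.getD i 0) (fun i hiX => ?_)
    (fun j hj => h j (hd.mem_lt j hj) hj)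
  by_cases hin : i < n
  · exact h0 i hin hiX
  · exact List.getD_eq_default _ _ (by omega)

end Lists

section TypeD

variable {m : ℕ} {X : ℕ → Prop} {τ : ℕ → ℕ}
  (hd : SatakeDatum (m + 1) (forkM m (m - 2)) X τ)
include hd

/-- Whether `τ` fixes the two last nodes, if these belong to a component of type `D`. -/
theorem SatakeDatum.fork_parity (hm : 3 ≤ m) {r : ℕ} (hr : r + 1 ≤ m)
    (hX : ∀ i < m + 1, (X i ↔ r ≤ i)) :
    (τ m = m → Even (m + 1 - r)) ∧ (τ m = m - 1 → Odd (m + 1 - r)) := by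
  obtain ⟨l, rfl⟩ : ∃ l, m = l + 2 := ⟨m - 2, by omega⟩
  -- Four times a spin fundamental coweight of the black component, with coefficients 2, 4, 6, … and
  -- finally N − 2 and N, where N = m + 1 − r. Divisibility by 4 of 2N, or of 2N − 2 if the last
  -- nodes are exchanged, determines the parity of N.
  let c : ℕ → ℤ := fun i => if i < r then 0 else if i ≤ l then 2 * ((i : ℤ) - r + 1)
    else if i = l + 1 then (l : ℤ) + 1 - r else if i = l + 2 then (l : ℤ) + 3 - r else 0
  have key := hd.dvd 4 c ?_ ?_ (l + 2) (by omega)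
  · have h1 : c (l + 2) = (l : ℤ) + 3 - r := by simp [c]; omega
    have h2 : c (l + 1) = (l : ℤ) + 1 - r := by simp [c]; omega
    refine ⟨fun h => ?_, fun h => ?_⟩
    · rw [h, h1] at key
      rw [Nat.even_iff]; omega
    · rw [h, show l + 2 - 1 = l + 1 by omega, h1, h2] at key
      rw [Nat.odd_iff]; omega
  · intro i hi
    by_cases hi' : i < l + 2 + 1
    · have := (hX i hi').not.1 hi
      simp only [c]; rw [if_pos (by omega)]
    · simp only [c]; split_ifs <;> omega
  · intro j hj
    have hjl := hd.mem_lt j hj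
    have hjr := (hX j hjl).1 hj
    have hmid : ∀ i, r ≤ i + 1 → i ≤ l → c i = 2 * ((i : ℤ) - r + 1) := by
      intro i hi hil
      simp only [c]
      split_ifs <;> omega
    have h1 : c (l + 1) = (l : ℤ) + 1 - r := by simp [c]; omega
    have h2 : c (l + 2) = (l : ℤ) + 3 - r := by simp [c]; omega
    by_cases hjm : j = l + 2
    · subst hjm
      rw [sum_forkM_self (by omega), Nat.add_sub_cancel, h2, hmid l (by omega) le_rfl]
      exact ⟨1, by ring⟩
    rw [sum_forkM_of_lt (by omega), Nat.add_sub_cancel]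
    refine ⟨0, ?_⟩
    by_cases hjm : j = l + 1
    · subst hjm
      rw [if_pos (by omega), if_neg (by omega), if_neg (by omega), Nat.add_sub_cancel, h1,
        hmid l (by omega) le_rfl]
      ring
    have hprev : (if 0 < j then c (j - 1) else 0) = 2 * ((j : ℤ) - r) := by
      split_ifs with h
      · rw [hmid _ (by omega) (by omega)]; push_cast [h]; ring
      · omega
    rw [hprev, if_pos (by omega), hmid j (by omega) (by omega)]
    by_cases hjl' : j = l
    · subst hjl'
      rw [if_pos rfl, h1, h2]; ring
    · rw [if_neg hjl', hmid (j + 1) (by omega) (by omega)]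
      push_cast; ring

/-- Opposition in type D₄ is trivial. Two functionals modulo 2, supported on the outer nodes {0, 2}
and {0, 3}, take different pairs of values at the four nodes, and τ preserves them. -/
theorem SatakeDatum.fork_four_eq_id (hm : m = 3) (hX : ∀ i < 4, X i) : ∀ i < 4, τ i = i := by
  subst hm
  have h1 := fun i (hi : i < 4) => hd.map_lt i hi
  have h2 := hd.dvd_list 2 [1, 0, 1, 0] (by simp) (fun i hi h => absurd (hX i hi) h)
    (fun j hj _ => by interval_cases j <;> decide)
  have h3 := hd.dvd_list 2 [1, 0, 0, 1] (by simp) (fun i hi h => absurd (hX i hi) h)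
    (fun j hj _ => by interval_cases j <;> decide)
  intro i hi
  have h6 := h1 i hi
  have h7 := h2 i hi
  have h8 := h3 i hi
  generalize τ i = t at *
  interval_cases i <;> interval_cases t <;>
    first
    | rfl
    | exact absurd h7 (by decide)
    | exact absurd h8 (by decide)

end TypeD

section TypeE

theorem forkM_five_ne_zero_iff {i j : ℕ} (hi : i < 6) (hj : j < 6) (hij : i ≠ j) :
    forkM 5 2 i j ≠ 0 ↔ (i < 5 ∧ j < 5 ∧ (i + 1 = j ∨ j + 1 = i)) ∨ (i = 5 ∧ j = 2) ∨
      (j = 5 ∧ i = 2) := by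
  simp only [forkM, extM, pathM]
  grind

variable {X : ℕ → Prop} {τ : ℕ → ℕ} (hd : SatakeDatum 6 (forkM 5 2) X τ)
include hd

theorem SatakeDatum.E₆_eq_id_or_flip :
    (∀ i < 6, τ i = i) ∨ (τ 0 = 4 ∧ τ 1 = 3 ∧ τ 2 = 2 ∧ τ 3 = 1 ∧ τ 4 = 0 ∧ τ 5 = 5) := by
  have adj : ∀ i < 6, ∀ j < 6, i ≠ j →
      (i < 5 ∧ j < 5 ∧ (i + 1 = j ∨ j + 1 = i)) ∨ (i = 5 ∧ j = 2) ∨ (j = 5 ∧ i = 2) →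
      (τ i < 5 ∧ τ j < 5 ∧ (τ i + 1 = τ j ∨ τ j + 1 = τ i)) ∨ (τ i = 5 ∧ τ j = 2) ∨
        (τ j = 5 ∧ τ i = 2) := by
    intro i hi j hj hij h
    refine (forkM_five_ne_zero_iff (hd.map_lt i hi) (hd.map_lt j hj)
      (fun h => hij (hd.map_injective hi hj h))).1 ?_
    rw [hd.cartan i hi j hj]
    exact (forkM_five_ne_zero_iff hi hj hij).2 h
  have inj : ∀ i < 6, ∀ j < 6, i ≠ j → τ i ≠ τ j := fun i hi j hj hij h => hij (hd.map_injective hi hj h)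
  have h21 := adj 2 (by omega) 1 (by omega) (by omega) (by omega)
  have h23 := adj 2 (by omega) 3 (by omega) (by omega) (by omega)
  have h25 := adj 2 (by omega) 5 (by omega) (by omega) (by omega)
  have i13 := inj 1 (by omega) 3 (by omega) (by omega)
  have i15 := inj 1 (by omega) 5 (by omega) (by omega)
  have i35 := inj 3 (by omega) 5 (by omega) (by omega)
  have h2 : τ 2 = 2 := by omega
  have h10 := adj 1 (by omega) 0 (by omega) (by omega) (by omega)
  have h34 := adj 3 (by omega) 4 (by omega) (by omega) (by omega)
  have i02 := inj 0 (by omega) 2 (by omega) (by omega)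
  have i42 := inj 4 (by omega) 2 (by omega) (by omega)
  have h5 : τ 5 = 5 := by omega
  by_cases h1 : τ 1 = 1
  · left
    have h3 : τ 3 = 3 := by omega
    intro i hi
    interval_cases i <;> omega
  · right
    have h3 : τ 1 = 3 := by omega
    omega

/-- The Satake diagrams of type `E₆` without arrows. -/
theorem SatakeDatum.E₆_of_eq_id (hτ : ∀ i < 6, τ i = i) (hne : ∃ i < 6, ¬ X i) :
    (∀ i, ¬ X i) ∨ (∀ i < 6, (X i ↔ i = 1 ∨ i = 2 ∨ i = 3 ∨ i = 5)) := by
  have h6 : ∀ i < 6, τ i = i := hτ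
  -- As τ is the identity, cᵢ + c_{τ i} is 2cᵢ. The lists used below come from coweights of
  -- components of type A₂, A₃, A₄ and D₅, whose opposition is not trivial.
  have false_of_dvd : ∀ (m : ℤ) (l : List ℤ), l.length ≤ 6 →
      (∀ i < 6, ¬ X i → l.getD i 0 = 0) →
      (∀ j < 6, X j → m ∣ ∑ i ∈ Finset.range 6, forkM 5 2 j i * l.getD i 0) →
      (∃ i < 6, ¬ m ∣ 2 * l.getD i 0) → False := by
    rintro m l hl h0 h1 ⟨i, hi, h2⟩
    have := hd.dvd_list m l hl h0 h1 i hi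
    rw [hτ i hi, ← two_mul] at this
    exact h2 this
  by_cases h25 : X 2 ∧ X 5
  · obtain ⟨h2, h5⟩ := h25
    by_cases h1 : X 1 <;> by_cases h3 : X 3
    · by_cases h0 : X 0 <;> by_cases h4 : X 4
      · obtain ⟨i, hi, hiX⟩ := hne
        exact absurd (by interval_cases i <;> assumption) hiX
      · exact (false_of_dvd 4 [2, 4, 6, 3, 0, 5] (by simp)
          (by intro i hi h; interval_cases i <;> first | rfl | exact absurd (by assumption) h)
          (by intro j hj h; interval_cases j <;> first | decide | exact absurd h (by assumption))
          ⟨5, by norm_num, by decide⟩).elim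
      · exact (false_of_dvd 4 [0, 3, 6, 4, 2, 5] (by simp)
          (by intro i hi h; interval_cases i <;> first | rfl | exact absurd (by assumption) h)
          (by intro j hj h; interval_cases j <;> first | decide | exact absurd h (by assumption))
          ⟨5, by norm_num, by decide⟩).elim
      · right
        intro i hi
        interval_cases i <;> simp [*]
    · by_cases h0 : X 0
      · exact (false_of_dvd 5 [1, 2, 3, 0, 0, 4] (by simp)
          (by intro i hi h; interval_cases i <;> first | rfl | exact absurd (by assumption) h)
          (by intro j hj h; interval_cases j <;> first | decide | exact absurd h (by assumption))
          ⟨0, by norm_num, by decide⟩).elim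
      · exact (false_of_dvd 4 [0, 1, 2, 0, 0, 3] (by simp)
          (by intro i hi h; interval_cases i <;> first | rfl | exact absurd (by assumption) h)
          (by intro j hj h; interval_cases j <;> first | decide | exact absurd h (by assumption))
          ⟨1, by norm_num, by decide⟩).elim
    · by_cases h4 : X 4
      · exact (false_of_dvd 5 [0, 0, 3, 2, 1, 4] (by simp)
          (by intro i hi h; interval_cases i <;> first | rfl | exact absurd (by assumption) h)
          (by intro j hj h; interval_cases j <;> first | decide | exact absurd h (by assumption))
          ⟨4, by norm_num, by decide⟩).elim
      · exact (false_of_dvd 4 [0, 0, 2, 1, 0, 3] (by simp)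
          (by intro i hi h; interval_cases i <;> first | rfl | exact absurd (by assumption) h)
          (by intro j hj h; interval_cases j <;> first | decide | exact absurd h (by assumption))
          ⟨3, by norm_num, by decide⟩).elim
    · exact (false_of_dvd 3 [0, 0, 1, 0, 0, 2] (by simp)
        (by intro i hi h; interval_cases i <;> first | rfl | exact absurd (by assumption) h)
        (by intro j hj h; interval_cases j <;> first | decide | exact absurd h (by assumption))
        ⟨2, by norm_num, by decide⟩).elim
  -- If the nodes 2 and 5 are not both black, all black nodes are isolated, and the parity at white
  -- nodes removes them one by one.
  · classical
    have hcons : ∀ i, i + 1 < 5 → X i → ¬ X (i + 1) := by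
      intro i hi5 hi hi'
      obtain ⟨a, b, hai, hib, hX, ha, hb⟩ := exists_maximal_interval (n := 5)
        (X := fun i => i < 5 ∧ X i) (fun i h => h.1) (i := i) ⟨by omega, hi⟩
      have hb5 := (hX b (by omega) le_rfl).1
      have hb1 : i + 1 ≤ b := by
        by_contra h
        obtain rfl : b = i := by omega
        exact hb ⟨hi5, hi'⟩
      have := hd.eq_of_interval (by omega) (by omega) (fun k h h' => (hX k h h').2)
        (fun j _ hj k _ hk => forkM_eq_pathM (by omega) (by omega) _ _) ?_ (hτ a (by omega))
      · omega
      · intro j hj hj' k hk hk'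
        have hj6 := hd.mem_lt j hj
        have h1 : j ≠ b + 1 ∨ j = 5 := by
          by_contra! h; exact hb ⟨by omega, h.1 ▸ hj⟩
        have h2 : a = 0 ∨ j ≠ a - 1 := ha.imp_right fun h h' => h ⟨by omega, h' ▸ hj⟩
        by_contra hne
        have := (forkM_five_ne_zero_iff hj6 (by omega) (by omega)).1 hne
        have h3 : j = 5 → k ≠ 2 := by
          rintro rfl rfl; exact h25 ⟨(hX 2 hk hk').2, hj⟩
        omega
    have hev : ∀ i < 6, ¬ X i → Even (∑ k ∈ Finset.range 6, forkM 5 2 i k * (if X k then 1 else 0)) := by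
      intro i hi hiX
      refine hd.even_of_isolated (fun i _ => forkM_self _) ?_ hi hiX (hτ i hi)
      intro j hj k hk hkj
      have hj6 := hd.mem_lt j hj
      have hk6 := hd.mem_lt k hk
      by_contra hne
      have := (forkM_five_ne_zero_iff hj6 hk6 (Ne.symm hkj)).1 hne
      have h1 : k ≠ j + 1 ∨ 5 ≤ j + 1 := by
        by_contra! h; exact hcons j (by omega) hj (h.1 ▸ hk)
      have h2 : j ≠ k + 1 ∨ 5 ≤ k + 1 := by
        by_contra! h; exact hcons k (by omega) hk (h.1 ▸ hj)
      have h3 : k = 5 → j ≠ 2 := by rintro rfl rfl; exact h25 ⟨hj, hk⟩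
      have h4 : j = 5 → k ≠ 2 := by rintro rfl rfl; exact h25 ⟨hk, hj⟩
      omega
    have h01 := hcons 0 (by norm_num)
    have h34 := hcons 3 (by norm_num)
    have h12 := hcons 1 (by norm_num)
    have h23 := hcons 2 (by norm_num)
    have e0 := hev 0 (by norm_num)
    have e1 := hev 1 (by norm_num)
    have e2 := hev 2 (by norm_num)
    have e3 := hev 3 (by norm_num)
    have e4 := hev 4 (by norm_num)
    have e5 := hev 5 (by norm_num)
    simp only [Finset.sum_range_succ, Finset.sum_range_zero, forkM, extM, pathM] at e0 e1 e2 e3 e4 e5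
    norm_num at e0 e1 e2 e3 e4 e5 h01 h34 h12 h23
    left
    have n2 : ¬ X 2 := by
      intro h2
      have h5 : ¬ X 5 := fun h => h25 ⟨h2, h⟩
      have := e5 h5
      simp [h2, h5] at this
    have n0 : ¬ X 0 := fun h0 => by
      have n1 := h01 h0
      have := e1 n1
      simp [n1, n2, h0] at this
    have n1 : ¬ X 1 := fun h1 => by
      have := e0 n0
      simp [n0, h1] at this
    have n4 : ¬ X 4 := fun h4 => by
      have n3 : ¬ X 3 := fun h => h34 h h4
      have := e3 n3
      simp [n3, n2, h4] at this
    have n3 : ¬ X 3 := fun h3 => by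
      have := e4 n4
      simp [n4, h3] at this
    have n5 : ¬ X 5 := fun h5 => by
      have := e2 n2
      simp [n1, n2, n3, h5] at this
    intro i hi
    have := hd.mem_lt i hi
    interval_cases i <;> contradiction

/-- The Satake diagrams of type `E₆` with arrows. -/
theorem SatakeDatum.E₆_of_flip
    (hτ : τ 0 = 4 ∧ τ 1 = 3 ∧ τ 2 = 2 ∧ τ 3 = 1 ∧ τ 4 = 0 ∧ τ 5 = 5) (hne : ∃ i < 6, ¬ X i) :
    (∀ i, ¬ X i) ∨ (∀ i < 6, (X i ↔ i = 1 ∨ i = 2 ∨ i = 3)) := by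
  obtain ⟨t0, t1, t2, t3, t4, t5⟩ := hτ
  have h04 := hd.map_mem 0 (by norm_num)
  have h13 := hd.map_mem 1 (by norm_num)
  rw [t0] at h04
  rw [t1] at h13
  -- Isolated black nodes are fixed by τ, so a black node that is moved has a black neighbour.
  have hiso : ∀ i < 6, τ i ≠ i → X i → ∃ k < 6, X k ∧ k ≠ i ∧ forkM 5 2 i k ≠ 0 := by
    intro i hi hτi hiX
    by_contra! hcon
    exact hτi (hd.fixed_of_isolated hiX fun k hk hki => hcon k (hd.mem_lt k hk) hk hki)
  -- The nodes 2 and 5 would form a component of type A₂ whose nodes are not exchanged.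
  have h25 : ¬ (¬ X 1 ∧ X 2 ∧ X 5) := by
    rintro ⟨h1, h2, h5⟩
    have h3 := h13.not.2 h1
    have := hd.dvd_list 3 [0, 0, 1, 0, 0, 2] (by simp)
      (by intro i hi h; interval_cases i <;> first | rfl | exact absurd (by assumption) h)
      (by intro j hj h; interval_cases j <;> first | decide | exact absurd h (by assumption))
      2 (by norm_num)
    rw [t2] at this
    exact absurd this (by decide)
  have n0 : ¬ X 0 := by
    intro h0
    have h4 := h04.2 h0
    obtain ⟨k, hk, hkX, hk0, hk1⟩ := hiso 0 (by norm_num) (by omega) h0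
    have := (forkM_five_ne_zero_iff (by norm_num) hk (Ne.symm hk0)).1 hk1
    obtain rfl : k = 1 := by omega
    have h3 := h13.2 hkX
    by_cases h2 : X 2
    · have h5 : ¬ X 5 := by
        intro h5
        obtain ⟨i, hi, hiX⟩ := hne
        exact absurd (by interval_cases i <;> assumption) hiX
      -- The sum of the positive coroots of A₅. Its coefficient 9 at the branch node is odd, against
      -- the parity at the white node 5.
      have := hd.even_list [5, 8, 9, 8, 5, 0] (by simp)
        (by intro i hi h; interval_cases i <;> first | rfl | exact absurd (by assumption) h)
        (by intro j hj h; interval_cases j <;> first | decide | exact absurd h (by assumption))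
        (i := 5) (by norm_num) h5 t5
      exact absurd this (by decide)
    · have := hd.orthogonal (fun i => i = 0 ∨ i = 1) (by rintro i (rfl | rfl) <;> assumption) (by
        intro i hi k hk hk'
        have hk6 := hd.mem_lt k hk
        have hk2 : k ≠ 2 := fun h => h2 (h ▸ hk)
        by_contra hne
        have := (forkM_five_ne_zero_iff (by omega) hk6 (by omega)).1 hne
        omega) 0 (Or.inl rfl)
      omega
  have n4 : ¬ X 4 := h04.not.2 n0
  by_cases h1 : X 1
  · have h3 := h13.2 h1
    obtain ⟨k, hk, hkX, hk0, hk1⟩ := hiso 1 (by norm_num) (by omega) h1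
    have := (forkM_five_ne_zero_iff (by norm_num) hk (Ne.symm hk0)).1 hk1
    have hk' : k ≠ 0 := fun h => n0 (h ▸ hkX)
    obtain rfl : k = 2 := by omega
    by_cases h5 : X 5
    -- A component of type D₄ has trivial opposition, while τ exchanges two of its outer nodes.
    · have := hd.dvd_list 2 [0, 1, 0, 0, 0, 1] (by simp)
        (by intro i hi h; interval_cases i <;> first | rfl | exact absurd (by assumption) h)
        (by intro j hj h; interval_cases j <;> first | decide | exact absurd h (by assumption))
        1 (by norm_num)
      rw [t1] at this
      exact absurd this (by decide)
    · right
      intro i hi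
      interval_cases i <;> simp [*]
  · have n3 := h13.not.2 h1
    left
    have n2 : ¬ X 2 := by
      intro h2
      have h5 : ¬ X 5 := fun h5 => h25 ⟨h1, h2, h5⟩
      have := hd.even_list [0, 0, 1, 0, 0, 0] (by simp)
        (by intro i hi h; interval_cases i <;> first | rfl | exact absurd (by assumption) h)
        (by intro j hj h; interval_cases j <;> first | decide | exact absurd h (by assumption))
        (i := 5) (by norm_num) h5 t5
      exact absurd this (by decide)
    have n5 : ¬ X 5 := by
      intro h5
      have := hd.even_list [0, 0, 0, 0, 0, 1] (by simp)
        (by intro i hi h; interval_cases i <;> first | rfl | exact absurd (by assumption) h)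
        (by intro j hj h; interval_cases j <;> first | decide | exact absurd h (by assumption))
        (i := 2) (by norm_num) n2 t2
      exact absurd this (by decide)
    intro i hi
    have := hd.mem_lt i hi
    interval_cases i <;> contradiction

/-- The automorphism `-w₀` in type `E₆`. -/
theorem SatakeDatum.E₆_flip (hX : ∀ i < 6, X i) : τ 0 = 4 := by
  rcases hd.E₆_eq_id_or_flip with h | h
  -- The quotient of the weight lattice by the root lattice has order 3, so −1 does not act
  -- trivially on it. The opposition in type E₆ is therefore not the identity.
  · have := hd.dvd_list 3 [1, 2, 0, 1, 2, 0] (by simp) (fun i hi h => absurd (hX i hi) h)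
      (by intro j hj _; interval_cases j <;> decide) 0 (by norm_num)
    rw [h 0 (by norm_num)] at this
    exact absurd this (by decide)
  · exact h.1

end TypeE

end SymPair

end

/-! ### Satake data from split involutions; the condition on weights -/

noncomputable section
namespace SymPair
set_option linter.unusedSectionVars false

section Datum

variable {ι K M N : Type*} [Finite ι] [Field K] [CharZero K] [AddCommGroup M] [Module K M]
  [AddCommGroup N] [Module K N] {P : RootPairing ι K M N} [P.IsRootSystem] [P.IsCrystallographic]
  [P.IsReduced] {b : P.Base} {T : M ≃ₗ[K] M} {X : Set ι}

/-- The numbers of the nodes in `X`. -/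
def numPred {n : ℕ} (e : Fin n ≃ b.support) (X : Set ι) (i : ℕ) : Prop :=
  ∃ h : i < n, (e ⟨i, h⟩ : ι) ∈ X

/-- The permutation of the numbers given by a permutation of the nodes. -/
def numPerm {n : ℕ} (e : Fin n ≃ b.support) (τ : Equiv.Perm b.support) (i : ℕ) : ℕ :=
  if h : i < n then e.symm (τ (e ⟨i, h⟩)) else i

variable {n : ℕ} {e : Fin n ≃ b.support} {τ : Equiv.Perm b.support}

theorem numPred_iff (i : Fin n) : numPred e X i ↔ (e i : ι) ∈ X :=
  ⟨fun h => h.2, fun h => ⟨i.2, h⟩⟩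

theorem numPerm_apply (i : Fin n) : numPerm e τ i = e.symm (τ (e i)) := by
  simp [numPerm]

theorem numPerm_eq_iff (i j : Fin n) : numPerm e τ i = j ↔ τ (e i) = e j := by
  rw [numPerm_apply, ← Fin.ext_iff, Equiv.symm_apply_eq]

theorem sum_numbering (C : ℕ → ℕ → ℤ) (hC : ∀ i j, b.cartanMatrix (e i) (e j) = C i j) (c : ℕ → ℤ)
    (j : Fin n) : ∑ i ∈ Finset.range n, C j i * c i =
      ∑ i : b.support, c (e.symm i) * b.cartanMatrix (e j) i := by
  rw [Finset.sum_range, ← e.sum_comp]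
  refine Finset.sum_congr rfl fun i _ => ?_
  rw [hC, Equiv.symm_apply_apply, mul_comm]

theorem IsSplitInvolution.satakeDatum (hT : IsSplitInvolution b T X)
    (hτ : ∀ i : b.support, diagramMap P T X (P.root i) = P.root (τ i))
    (heven : ∀ i : b.support, (i : ι) ∉ X → τ i = i → ∀ c : b.support → ℤ,
      (∀ j : b.support, (j : ι) ∉ X → c j = 0) →
      (∀ j : b.support, (j : ι) ∈ X → ∑ k, c k * b.cartanMatrix j k = 2) →
      Even (∑ k, c k * b.cartanMatrix i k))
    {C : ℕ → ℕ → ℤ} (hC : ∀ i j, b.cartanMatrix (e i) (e j) = C i j) :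
    SatakeDatum n C (numPred e X) (numPerm e τ) where
  mem_lt i h := h.1
  map_lt i hi := by
    have := numPerm_apply (e := e) (τ := τ) ⟨i, hi⟩
    rw [this]; exact Fin.is_lt _
  map_map i hi := by
    have h1 := numPerm_apply (e := e) (τ := τ) ⟨i, hi⟩
    have h2 : numPerm e τ (numPerm e τ (⟨i, hi⟩ : Fin n)) = (⟨i, hi⟩ : Fin n) := by
      rw [h1, numPerm_eq_iff, Equiv.apply_symm_apply, hT.diagramPerm_diagramPerm hτ]
    exact h2
  cartan i hi j hj := by
    have h1 := numPerm_apply (e := e) (τ := τ) ⟨i, hi⟩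
    have h2 := numPerm_apply (e := e) (τ := τ) ⟨j, hj⟩
    simp only at h1 h2
    rw [h1, h2, ← hC, Equiv.apply_symm_apply, Equiv.apply_symm_apply, hT.cartanMatrix_diagramPerm hτ,
      hC]
  map_mem i hi := by
    have h1 := numPerm_apply (e := e) (τ := τ) ⟨i, hi⟩
    simp only at h1
    rw [h1, numPred_iff, Equiv.apply_symm_apply, hT.diagramPerm_mem_iff hτ,
      ← numPred_iff (e := e) (X := X) ⟨i, hi⟩]
  orthogonal J hJ horth i hi := by
    obtain ⟨hin, hiX⟩ := hJ i hi
    have key := hT.diagramPerm_mem_of_orthogonal hτ (J := {k | ∃ j : Fin n, J j ∧ (e j : ι) = k})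
      (by rintro _ ⟨j, hj, rfl⟩; exact (hJ j hj).2)
      (by
        rintro _ ⟨j, hj, rfl⟩ k hk hkJ
        have hkb := hT.subset hk
        obtain ⟨k', hk'⟩ : ∃ k', e k' = ⟨k, hkb⟩ := e.surjective _
        have hk'' : (e k' : ι) = k := by rw [hk']
        have h := horth j hj k' ((numPred_iff k').2 (hk'' ▸ hk)) fun h => hkJ ⟨k', h, hk''⟩
        rw [← hC, RootPairing.Base.cartanMatrix_apply_eq_zero_iff_pairing] at h
        rwa [← hk''])
      (e ⟨i, hin⟩) ⟨_, hi, rfl⟩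
    obtain ⟨j, hj, hje⟩ := key
    have : numPerm e τ (⟨i, hin⟩ : Fin n) = j := by
      rw [numPerm_eq_iff]; exact Subtype.ext hje.symm
    simp only at this
    rwa [this]
  dvd m c hc hdvd i hi := by
    have key := hT.dvd_add_diagramPerm hτ (m := m) (c := fun k => c (e.symm k))
      (fun k hk => hc _ fun h => hk (by simpa using (numPred_iff _).1 h))
      (fun j hj => by
        have h := hdvd (e.symm j) ((numPred_iff _).2 (by simpa using hj))
        rw [sum_numbering C hC] at h
        simpa using h) (e ⟨i, hi⟩)
    have h1 := numPerm_apply (e := e) (τ := τ) ⟨i, hi⟩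
    simp only at h1
    rw [h1]
    simpa using key
  even i hi hiX hτi c hc hsum := by
    have h := heven (e ⟨i, hi⟩) (fun h => hiX ⟨hi, h⟩)
      ((numPerm_eq_iff (e := e) (τ := τ) ⟨i, hi⟩ ⟨i, hi⟩).1 hτi) (fun k => c (e.symm k))
      (fun k hk => hc _ fun h => hk (by simpa using (numPred_iff _).1 h))
      (fun j hj => by
        have h := hsum (e.symm j) ((numPred_iff _).2 (by simpa using hj))
        rw [sum_numbering C hC] at h
        simpa using h)
    have h2 := sum_numbering C hC c ⟨i, hi⟩
    simp only at h2
    rwa [h2]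

/-- The involution `-w₀`. -/
theorem isSplitInvolution_refl (b : P.Base) :
    IsSplitInvolution b (LinearEquiv.refl K M) (b.support : Set ι) where
  permutesRoots i := ⟨i, rfl⟩
  involutive _ := rfl
  subset := le_rfl
  fixed _ _ := rfl
  moved _ hj hj' := absurd hj hj'

/-- All nodes are black here, so the parity condition is empty. The results on Satake data thereby
apply to −w₀. -/
theorem satakeDatum_refl
    (hτ : ∀ i : b.support, diagramMap P (LinearEquiv.refl K M) b.support (P.root i) = P.root (τ i))
    {C : ℕ → ℕ → ℤ} (hC : ∀ i j, b.cartanMatrix (e i) (e j) = C i j) :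
    SatakeDatum n C (numPred e b.support) (numPerm e τ) :=
  (isSplitInvolution_refl b).satakeDatum hτ (fun i hi => absurd i.2 hi) hC

theorem numPred_support (i : ℕ) (hi : i < n) : numPred e (b.support : Set ι) i := ⟨hi, (e ⟨i, hi⟩).2⟩

theorem longestElement_support (x : M) : longestElement P b.support x =
    -diagramMap P (LinearEquiv.refl K M) b.support x := by
  rw [diagramMap_apply]; simp

theorem ext_coroot' (b : P.Base) {x y : M} (h : ∀ i ∈ b.support, P.coroot' i x = P.coroot' i y) :
    x = y := by
  refine P.toPerfPair.injective (b.toCoweightBasis.ext fun i => ?_)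
  rw [b.toCoweightBasis_apply]
  exact h i i.2

theorem ext_root (b : P.Base) {f g : M ≃ₗ[K] M} (h : ∀ i : b.support, f (P.root i) = g (P.root i)) :
    f = g := by
  refine LinearEquiv.toLinearMap_injective (b.toWeightBasis.ext fun i => ?_)
  rw [b.toWeightBasis_apply]
  exact h i

namespace IsSplitInvolution

variable (hT : IsSplitInvolution b T X)
include hT

/-- Substitution of T = −w_X δ and w₀ = −δ₀. In this form only the two diagram automorphisms and w_X
remain. -/
theorem apply_eq_iff (μ : M) : T μ = μ + longestElement P b.support μ - longestElement P X μ ↔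
    longestElement P X (μ - diagramMap P T X μ) =
      μ - diagramMap P (LinearEquiv.refl K M) b.support μ := by
  rw [hT.apply_eq, longestElement_support, map_sub]
  constructor <;> intro h
  · rw [sub_eq_add_neg, h]; abel
  · rw [eq_sub_iff_add_eq, ← sub_eq_neg_add, h]; abel

/-- The hypothesis says that T exchanges v and w_X v, so T negates u = w_X v − v. But u lies in the
span of X, which T fixes; hence u = 0. -/
theorem longestElement_apply_of_diagramMap_eq_neg {v : M} (hv : diagramMap P T X v = -v) :
    longestElement P X v = v := by
  have hT1 : T (longestElement P X v) = v := by
    have := hv; rw [diagramMap_apply] at this; exact neg_injective this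
  set u := longestElement P X v - v with hu
  have hu1 : u ∈ Submodule.span K (P.root '' X) := apply_sub_mem_span (longestElement_mem X) v
  have h1 : T u = u := hT.apply_of_mem_span hu1
  have h2 : T u = v - longestElement P X v := by
    rw [hu, map_sub, hT1]
    congr 1
    have h3 := hT.involutive (longestElement P X v)
    rwa [hT1] at h3
  have h3 : (2 : K) • u = 0 := by
    rw [two_smul]
    nth_rewrite 1 [← h1]
    rw [h2, hu]; abel
  have h4 : u = 0 := (smul_eq_zero.1 h3).resolve_left two_ne_zero
  exact sub_eq_zero.1 h4

theorem condition_of_diagramMap_eq (h : diagramMap P T X = diagramMap P (LinearEquiv.refl K M) b.support)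
    (μ : M) : T μ = μ + longestElement P b.support μ - longestElement P X μ := by
  rw [hT.apply_eq_iff, ← h]
  refine hT.longestElement_apply_of_diagramMap_eq_neg ?_
  rw [map_sub, hT.diagramMap_diagramMap]; abel

theorem condition_iff_of_diagramMap_eq_refl (h : diagramMap P T X = LinearEquiv.refl K M) (μ : M) :
    T μ = μ + longestElement P b.support μ - longestElement P X μ ↔
      μ = -longestElement P b.support μ := by
  rw [hT.apply_eq_iff, h, LinearEquiv.refl_apply, sub_self, map_zero, longestElement_support, neg_neg,
    eq_comm, sub_eq_zero]

theorem condition_iff_of_refl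
    (h : diagramMap P (LinearEquiv.refl K M) b.support = LinearEquiv.refl K M) (μ : M) :
    T μ = μ + longestElement P b.support μ - longestElement P X μ ↔ μ = diagramMap P T X μ := by
  rw [hT.apply_eq_iff, h, LinearEquiv.refl_apply, sub_self, LinearEquiv.map_eq_zero_iff, sub_eq_zero]

theorem diagramMap_eq_refl (hτ : ∀ i : b.support, diagramMap P T X (P.root i) = P.root (τ i))
    (h : ∀ i, τ i = i) : diagramMap P T X = LinearEquiv.refl K M :=
  ext_root b fun i => by rw [hτ, h]; rfl

theorem eq_diagramMap_iff (hτ : ∀ i : b.support, diagramMap P T X (P.root i) = P.root (τ i)) (μ : M) :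
    μ = diagramMap P T X μ ↔ ∀ i : b.support, P.coroot' (τ i) μ = P.coroot' i μ := by
  constructor
  · intro h i
    nth_rewrite 1 [h]
    exact hT.coroot'_diagramMap hτ i μ
  · intro h
    refine ext_coroot' b fun i hi => ?_
    obtain ⟨j, hj⟩ := τ.surjective ⟨i, hi⟩
    have h1 := h j
    have h2 := hT.coroot'_diagramMap hτ j μ
    rw [hj] at h1 h2
    exact h1.trans h2.symm

end IsSplitInvolution

end Datum

end SymPair

end

/-! ### Satake diagrams in terms of τ; numberings and Cartan matrices -/

noncomputable section
namespace SymPair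
set_option linter.unusedSectionVars false

section IntegralSpan

variable {ι K M N : Type*} [Finite ι] [Field K] [CharZero K] [AddCommGroup M] [Module K M]
  [AddCommGroup N] [Module K N] {P : RootPairing ι K M N} [P.IsRootSystem] [P.IsCrystallographic]
  [P.IsReduced]

/-- Integrality of the Cartan numbers refines `apply_sub_mem_span`; the arrows of a Satake diagram
are defined by means of the integral span. -/
theorem apply_root_sub_mem_span_int {J : Set ι} {w : M ≃ₗ[K] M} (hw : w ∈ reflectionSubgroup P J)
    (k : ι) : w (P.root k) - P.root k ∈ Submodule.span ℤ (P.root '' J) := by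
  induction hw using reflectionSubgroup_induction with
  | one => simp
  | refl_mul i hi w hw h =>
    obtain ⟨k', hk'⟩ := permutesRoots_of_mem hw k
    have : (P.reflection i * w) (P.root k) - P.root k =
        (w (P.root k) - P.root k) - P.pairingIn ℤ k' i • P.root i := by
      rw [LinearEquiv.mul_apply, hk', RootPairing.reflection_apply_root,
        ← P.algebraMap_pairingIn ℤ, algebraMap_int_eq, Int.coe_castRingHom, Int.cast_smul_eq_zsmul]
      abel
    rw [this]
    exact sub_mem h (Submodule.smul_mem _ _ (Submodule.subset_span ⟨i, hi, rfl⟩))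

end IntegralSpan

open LieAlgebra.IsKilling (rootSystem)

variable {L : Type*} [LieRing L] [LieAlgebra ℂ L] [FiniteDimensional ℂ L]
  [LieAlgebra.IsSemisimple ℂ L] {H : LieSubalgebra ℂ L} [H.IsCartanSubalgebra]
  {b : (rootSystem H).Base} {θ : L ≃ₗ⁅ℂ⁆ L}

section Diagram

variable (hi : ∀ x, θ (θ x) = x) (hs : IsMaximallySplit b θ) {τ : Equiv.Perm b.support}
  (hτ : ∀ i : b.support, diagramMap (rootSystem H) (bigThetaEquiv hi hs) (fixedSimpleRoots hs)
    ((rootSystem H).root i) = (rootSystem H).root (τ i))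
include hτ

theorem bigTheta_root (i : b.support) : bigTheta hs ((rootSystem H).root i) =
    -longestElement (rootSystem H) (fixedSimpleRoots hs) ((rootSystem H).root (τ i)) := by
  have := (isSplitInvolution hi hs).apply_eq ((rootSystem H).root i)
  rwa [hτ] at this

/-- The Satake datum of a maximally split involution. -/
theorem satakeDatum {n : ℕ} {e : Fin n ≃ b.support} {C : ℕ → ℕ → ℤ}
    (hC : ∀ i j, b.cartanMatrix (e i) (e j) = C i j) :
    SatakeDatum n C (numPred e (fixedSimpleRoots hs)) (numPerm e τ) := by
  classical
  refine (isSplitInvolution hi hs).satakeDatum hτ (fun i hiX hτi c hc hsum => ?_) hC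
  let c' : H.root → ℤ := fun k => if h : k ∈ b.support then c ⟨k, h⟩ else 0
  have key : ∀ i : b.support, ∑ k, c' k * (rootSystem H).pairingIn ℤ i k =
      ∑ k, c k * b.cartanMatrix i k := by
    intro i
    rw [← Finset.sum_subset (Finset.subset_univ b.support)]
    · rw [← Finset.sum_coe_sort b.support]
      refine Finset.sum_congr rfl fun k _ => ?_
      simp only [c', k.2, dif_pos]
      rfl
    · intro k _ hk
      simp [c', hk]
  have := even_of_map_mem hi hs (i := i) i.2 hiX ?_ (n := c') ?_ ?_
  · rwa [key] at this
  · rw [bigTheta_root hi hs hτ, hτi, neg_add_eq_sub, ← neg_sub]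
    exact neg_mem (apply_sub_mem_span (longestElement_mem _) _)
  · intro j hj
    simp only [c']
    split_ifs with h
    · exact hc ⟨j, h⟩ hj
    · rfl
  · intro j hj
    rw [key ⟨j, fixedSimpleRoots_subset hs hj⟩]
    exact hsum _ hj

/-- Modulo the black roots Θαᵢ is −α_{τ i}, and this residue determines τ i for a white node i. -/
theorem hasSatakeDiagram_iff {n : ℕ} {e : Fin n ≃ b.support} {X : Set (Fin n)} {p : Fin n → Fin n} :
    HasSatakeDiagram hs e X p ↔ (∀ i : Fin n, numPred e (fixedSimpleRoots hs) i ↔ i ∈ X) ∧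
      ∀ i ∉ X, numPerm e τ i = p i := by
  simp only [HasSatakeDiagram, numPred_iff, numPerm_eq_iff]
  refine and_congr_right fun hX => forall₂_congr fun i hiX => ⟨fun h => ?_, fun h => ?_⟩
  · refine ((isSplitInvolution hi hs).eq_diagramPerm hτ (fun h => hiX ((hX i).1 h)) ?_).symm
    exact Submodule.span_subset_span ℤ ℂ _ h
  · rw [bigTheta_root hi hs hτ, h, neg_add_eq_sub, ← neg_sub]
    exact neg_mem (apply_root_sub_mem_span_int (longestElement_mem _) _)

omit hτ in
include hi in
theorem exists_white {n : ℕ} (e : Fin n ≃ b.support) (hne : ∃ x, θ x ≠ x) :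
    ∃ i < n, ¬ numPred e (fixedSimpleRoots hs) i := by
  by_contra! hcon
  obtain ⟨x, hx⟩ := hne
  refine hx (forall_eq_of_fixed_eq_support hi hs (fun j hj => ?_) x)
  have := (numPred_iff (e := e) (e.symm ⟨j, hj⟩)).1 (hcon _ (Fin.is_lt _))
  simpa using this

end Diagram

section Renumber

variable {ι K M N : Type*} [Finite ι] [Field K] [CharZero K] [AddCommGroup M] [Module K M]
  [AddCommGroup N] [Module K N] {P : RootPairing ι K M N} [P.IsRootSystem] [P.IsCrystallographic]
  [P.IsReduced] {b : P.Base} {n : ℕ} {e : Fin n ≃ b.support}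
  {τ : Equiv.Perm b.support} {X : Set ι}

theorem numPred_trans (π : Equiv.Perm (Fin n)) (i : Fin n) :
    numPred (π.trans e) X i ↔ numPred e X (π i) := by
  simp only [numPred_iff, Equiv.trans_apply]

theorem numPerm_trans (π : Equiv.Perm (Fin n)) (i j : Fin n) :
    numPerm (π.trans e) τ i = j ↔ numPerm e τ (π i) = π j := by
  simp only [numPerm_eq_iff, Equiv.trans_apply]

end Renumber

section Matrices

theorem A_apply (n : ℕ) (i j : Fin n) : CartanMatrix.A n i j = pathM n (-1) (-1) i j := by
  simp only [CartanMatrix.A, Matrix.of_apply, pathM, Fin.ext_iff]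
  split_ifs <;> omega

theorem B_apply (n : ℕ) (i j : Fin n) : CartanMatrix.B n i j = pathM n (-2) (-1) i j := by
  simp only [CartanMatrix.B, Matrix.of_apply, pathM, Fin.ext_iff]
  split_ifs <;> omega

theorem C_apply (n : ℕ) (i j : Fin n) : CartanMatrix.C n i j = pathM n (-1) (-2) i j := by
  simp only [CartanMatrix.C, Matrix.of_apply, pathM, Fin.ext_iff]
  split_ifs <;> omega

theorem D_apply {m : ℕ} (hm : 3 ≤ m) (i j : Fin (m + 1)) :
    CartanMatrix.D (m + 1) i j = forkM m (m - 2) i j := by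
  simp only [CartanMatrix.D, Matrix.of_apply, forkM, extM, pathM, Fin.ext_iff]
  have hi := i.2
  have hj := j.2
  generalize (i : ℕ) = i at *
  generalize (j : ℕ) = j at *
  grind (splits := 40)

/-- The numbers in `forkM 5 2` of the nodes of the diagram of type `E₆`. -/
def permE₆ : Equiv.Perm (Fin 6) where
  toFun := ![0, 5, 1, 2, 3, 4]
  invFun := ![0, 2, 3, 4, 5, 1]
  left_inv := by decide
  right_inv := by decide

theorem E₆_apply : ∀ i j : Fin 6, CartanMatrix.E₆ i j = forkM 5 2 (permE₆ i) (permE₆ j) :=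
  fun i j => by fin_cases i <;> fin_cases j <;> rfl

theorem exists_perm_E₇ : ∃ π : Equiv.Perm (Fin 7), ∀ i j : Fin 7,
    CartanMatrix.E₇ i j = forkM 6 3 (π i) (π j) :=
  ⟨⟨![5, 6, 4, 3, 2, 1, 0], ![6, 5, 4, 3, 2, 0, 1], by decide, by decide⟩,
    fun i j => by fin_cases i <;> fin_cases j <;> rfl⟩

theorem exists_perm_E₈ : ∃ π : Equiv.Perm (Fin 8), ∀ i j : Fin 8,
    CartanMatrix.E₈ i j = forkM 7 4 (π i) (π j) :=
  ⟨⟨![6, 7, 5, 4, 3, 2, 1, 0], ![7, 6, 5, 4, 3, 2, 0, 1], by decide, by decide⟩,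
    fun i j => by fin_cases i <;> fin_cases j <;> rfl⟩

theorem F₄_apply : ∀ i j : Fin 4, CartanMatrix.F₄ i j = fourM i j :=
  fun i j => by fin_cases i <;> fin_cases j <;> rfl

theorem G₂_apply : ∀ i j : Fin 2, CartanMatrix.G₂ i j = pathM 2 (-3) (-1) i j :=
  fun i j => by fin_cases i <;> fin_cases j <;> rfl

end Matrices

end SymPair

end

/-! ### Every simple pair occurs in Araki's list -/

noncomputable section
namespace SymPair
set_option linter.unusedSectionVars false

open LieAlgebra.IsKilling (rootSystem)

variable {L : Type*} [LieRing L] [LieAlgebra ℂ L] [FiniteDimensional ℂ L]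
  [LieAlgebra.IsSemisimple ℂ L] {H : LieSubalgebra ℂ L} [H.IsCartanSubalgebra]
  {b : (rootSystem H).Base} {θ : L ≃ₗ⁅ℂ⁆ L}

section Diagram

variable (hi : ∀ x, θ (θ x) = x) (hs : IsMaximallySplit b θ) {τ : Equiv.Perm b.support}
  (hτ : ∀ i : b.support, diagramMap (rootSystem H) (bigThetaEquiv hi hs) (fixedSimpleRoots hs)
    ((rootSystem H).root i) = (rootSystem H).root (τ i))
include hτ

theorem isAI_or_isAII_or_isAIII_or_isAIV {n : ℕ} (hn : 1 ≤ n) {e : Fin n ≃ b.support}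
    (he : ∀ i j, b.cartanMatrix (e i) (e j) = pathM n (-1) (-1) i j) (hne : ∃ x, θ x ≠ x) :
    IsAI hs e ∨ IsAII hs e ∨ (∃ r, IsAIII hs e r) ∨ IsAIV hs e := by
  have hd := satakeDatum hi hs hτ he
  have hw := exists_white hi hs e hne
  have hA : IsNumbering e (CartanMatrix.A n) := fun i j => by rw [he, A_apply]
  have hid (hτ' : ∀ i < n, numPerm e τ i = i) : IsAI hs e ∨ IsAII hs e := by
    rcases hd.path_of_eq_id hτ' hw with h | ⟨ho, h3, h⟩
    · refine Or.inl ⟨hn, hA, (hasSatakeDiagram_iff hi hs hτ).2 ⟨by simp [h], fun i _ => ?_⟩⟩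
      exact hτ' i i.2
    · refine Or.inr ⟨h3, ho, hA, (hasSatakeDiagram_iff hi hs hτ).2 ⟨fun i => ?_, fun i _ => ?_⟩⟩
      · rw [h i i.2, Set.mem_ofPred_eq, Nat.odd_add_one, Nat.not_odd_iff_even]
      · exact hτ' i i.2
  rcases hd.eq_id_or_reverse (isPathLike_pathM (by norm_num) (by norm_num)) with hτ' | hτ'
  · rcases hid hτ' with h | h <;> simp [h]
  -- With a single node the reversal is the identity.
  · obtain rfl | hn2 : n = 1 ∨ 2 ≤ n := by omega
    · rcases hid (fun i hi => by rw [hτ' i hi]; omega) with h | h <;> simp [h]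
    obtain ⟨r, hr1, hr2, h⟩ := hd.path_of_eq_reverse hn2 hτ' hw
    obtain rfl | hr : r = 1 ∨ 2 ≤ r := by omega
    · refine Or.inr (Or.inr (Or.inr ⟨hn2, hA, (hasSatakeDiagram_iff hi hs hτ).2
        ⟨fun i => ?_, fun i _ => ?_⟩⟩))
      · rw [h i i.2, Set.mem_ofPred_eq]; omega
      · rw [hτ' i i.2, Fin.val_rev]; omega
    · refine Or.inr (Or.inr (Or.inl ⟨r, hr, hr2, hA, (hasSatakeDiagram_iff hi hs hτ).2
        ⟨fun i => ?_, fun i _ => ?_⟩⟩))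
      · rw [h i i.2, Set.mem_ofPred_eq]; omega
      · rw [hτ' i i.2, Fin.val_rev]; omega

/-- An involution of the three legs of D₄ fixes one of them. With that leg numbered 0, only the
exchange of the last two nodes is left as a nontrivial possibility. -/
theorem exists_renumbering_four {e : Fin 4 ≃ b.support}
    (he : ∀ i j, b.cartanMatrix (e i) (e j) = forkM 3 1 i j) :
    ∃ e' : Fin 4 ≃ b.support, (∀ i j, b.cartanMatrix (e' i) (e' j) = forkM 3 1 i j) ∧
      numPerm e' τ 0 = 0 := by
  have hd := satakeDatum hi hs hτ (C := forkM 3 (3 - 2)) he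
  have key (a : Fin 4) (ha : ∀ i j : Fin 4,
      forkM 3 1 (Equiv.swap 0 a i) (Equiv.swap 0 a j) = forkM 3 1 i j)
      (hτa : numPerm e τ a = a) : ∃ e' : Fin 4 ≃ b.support,
      (∀ i j, b.cartanMatrix (e' i) (e' j) = forkM 3 1 i j) ∧ numPerm e' τ 0 = 0 := by
    refine ⟨(Equiv.swap 0 a).trans e, fun i j => ?_, ?_⟩
    · rw [Equiv.trans_apply, Equiv.trans_apply, he, ha]
    · have := (numPerm_trans (e := e) (τ := τ) (Equiv.swap 0 a) 0 0).2 (by simpa using hτa)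
      exact this
  have h1 : numPerm e τ 1 = 1 := hd.fork_branch le_rfl
  have inj {i j : ℕ} (hi : i < 4) (hj : j < 4) (h : numPerm e τ i = numPerm e τ j) : i = j :=
    hd.map_injective hi hj h
  have l0 := hd.map_lt 0 (by norm_num)
  have l2 := hd.map_lt 2 (by norm_num)
  have l3 := hd.map_lt 3 (by norm_num)
  have n0 : numPerm e τ 0 ≠ 1 := fun h => by
    have := inj (by norm_num) (by norm_num) (h.trans h1.symm); omega
  have n2 : numPerm e τ 2 ≠ 1 := fun h => by
    have := inj (by norm_num) (by norm_num) (h.trans h1.symm); omega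
  have n3 : numPerm e τ 3 ≠ 1 := fun h => by
    have := inj (by norm_num) (by norm_num) (h.trans h1.symm); omega
  have m0 := hd.map_map 0 (by norm_num)
  obtain h | h | h : numPerm e τ 0 = 0 ∨ numPerm e τ 0 = 2 ∨ numPerm e τ 0 = 3 := by omega
  · exact ⟨e, he, h⟩
  · refine key 3 (fun i j => by fin_cases i <;> fin_cases j <;> rfl) ?_
    have a : numPerm e τ 3 ≠ 0 := fun h' => by
      have := hd.map_map 3 (by norm_num); rw [h'] at this; omega
    have c : numPerm e τ 3 ≠ 2 := fun h' => by
      have := inj (by norm_num) (by norm_num) (h.trans h'.symm); omega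
    change numPerm e τ 3 = 3
    omega
  · refine key 2 (fun i j => by fin_cases i <;> fin_cases j <;> rfl) ?_
    have a : numPerm e τ 2 ≠ 0 := fun h' => by
      have := hd.map_map 2 (by norm_num); rw [h'] at this; omega
    have c : numPerm e τ 2 ≠ 3 := fun h' => by
      have := inj (by norm_num) (by norm_num) (h.trans h'.symm); omega
    change numPerm e τ 2 = 2
    omega

/-- Normalises the symmetries of the diagram. If just one of the two last nodes is black, their
exchange makes it the node m − 1. -/
theorem exists_renumbering_fork {m : ℕ} (hm : 3 ≤ m) {e : Fin (m + 1) ≃ b.support}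
    (he : ∀ i j, b.cartanMatrix (e i) (e j) = forkM m (m - 2) i j) :
    ∃ e' : Fin (m + 1) ≃ b.support,
      (∀ i j, b.cartanMatrix (e' i) (e' j) = forkM m (m - 2) i j) ∧
      (m = 3 → numPerm e' τ 0 = 0) ∧
      (numPred e' (fixedSimpleRoots hs) m → numPred e' (fixedSimpleRoots hs) (m - 1)) := by
  obtain ⟨e, he, h0⟩ : ∃ e' : Fin (m + 1) ≃ b.support,
      (∀ i j, b.cartanMatrix (e' i) (e' j) = forkM m (m - 2) i j) ∧
      (m = 3 → numPerm e' τ 0 = 0) := by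
    by_cases h3 : m = 3
    · subst h3
      obtain ⟨e', h, h'⟩ := exists_renumbering_four hi hs hτ he
      exact ⟨e', h, fun _ => h'⟩
    · exact ⟨e, he, fun h => absurd h h3⟩
  by_cases hX : numPred e (fixedSimpleRoots hs) m → numPred e (fixedSimpleRoots hs) (m - 1)
  · exact ⟨e, he, h0, hX⟩
  push Not at hX
  let p : Fin (m + 1) := ⟨m - 1, by omega⟩
  let q : Fin (m + 1) := ⟨m, by omega⟩
  have hpq : ∀ i : Fin (m + 1), (Equiv.swap p q i : ℕ) =
      if (i : ℕ) = m - 1 then m else if (i : ℕ) = m then m - 1 else i := by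
    intro i
    rw [Equiv.swap_apply_def]
    simp only [p, q, Fin.ext_iff]
    split_ifs <;> rfl
  refine ⟨(Equiv.swap p q).trans e, fun i j => ?_, fun h3 => ?_, fun h => absurd ?_ hX.2⟩
  · rw [Equiv.trans_apply, Equiv.trans_apply, he, hpq, hpq, forkM_swap hm _ i.2 _ j.2]
  · have h00 : Equiv.swap p q 0 = 0 := Fin.ext (by rw [hpq, Fin.val_zero]; split_ifs <;> omega)
    have := (numPerm_trans (e := e) (τ := τ) (Equiv.swap p q) 0 0).2 (by
      rw [h00]; exact h0 h3)
    exact this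
  · have := (numPred_trans (e := e) (X := fixedSimpleRoots hs) (Equiv.swap p q) q).1 h
    rwa [Equiv.swap_apply_right] at this

theorem exists_type_D {m : ℕ} (hm : 3 ≤ m) {e : Fin (m + 1) ≃ b.support}
    (he : ∀ i j, b.cartanMatrix (e i) (e j) = forkM m (m - 2) i j) (hne : ∃ x, θ x ≠ x) :
    ∃ e : Fin (m + 1) ≃ b.support, (∃ r, IsDI₁ hs e r) ∨ IsDI₂ hs e ∨ IsDI₃ hs e ∨ IsDII hs e ∨
      IsDIII₁ hs e ∨ IsDIII₂ hs e := by
  obtain ⟨e, he, h0, hX⟩ := exists_renumbering_fork hi hs hτ hm he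
  have hd := satakeDatum hi hs hτ he
  have hw := exists_white hi hs e hne
  have hD : IsNumbering e (CartanMatrix.D (m + 1)) := fun i j => by rw [he, D_apply hm]
  have hcase := hd.fork_eq_id_or_swap hm h0
  have hfix : ∀ i, i + 2 ≤ m → numPerm e τ i = i := by
    rcases hcase with h | h
    · exact fun i hi => h i (by omega)
    · exact h.1
  have hswap (h : (numPerm e τ (m - 1) = m ∧ numPerm e τ m = m - 1)) (i : Fin (m + 1)) :
      numPerm e τ i = (swapLast i : Fin (m + 1)) := by
    obtain ⟨i, hi⟩ := i
    unfold swapLast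
    simp only
    split_ifs with h1 h2
    · obtain rfl : i = m - 1 := by omega
      simp [h.1]
    · obtain rfl : i = m := by omega
      rw [h.2]; rfl
    · exact hfix i (by omega)
  refine ⟨e, ?_⟩
  rcases hd.fork_classify hm hcase hX hw with ⟨r, hr1, hr2, h⟩ | h | ⟨ht, ho, h⟩ | ⟨ht, ho, h⟩
  · have hsd : HasSatakeDiagram hs e {i | r + 1 ≤ i.val + 1} id := by
      refine (hasSatakeDiagram_iff hi hs hτ).2 ⟨fun i => ?_, fun i hiX => ?_⟩
      · rw [h i i.2, Set.mem_ofPred_eq]; omega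
      · rw [Set.mem_ofPred_eq] at hiX
        exact hfix i (by omega)
    obtain rfl | hr : r = 1 ∨ 2 ≤ r := by omega
    · exact Or.inr (Or.inr (Or.inr (Or.inl ⟨by omega, hD, hsd⟩)))
    · exact Or.inl ⟨r, by omega, hr, by omega, hD, hsd⟩
  · rcases hcase with h' | h'
    · exact Or.inr (Or.inr (Or.inl ⟨by omega, hD, (hasSatakeDiagram_iff hi hs hτ).2
        ⟨by simp [h], fun i _ => h' i i.2⟩⟩))
    · exact Or.inr (Or.inl ⟨by omega, hD, (hasSatakeDiagram_iff hi hs hτ).2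
        ⟨by simp [h], fun i _ => hswap h'.2 i⟩⟩)
  · refine Or.inr (Or.inr (Or.inr (Or.inr (Or.inl ⟨by omega, ho.add_one, hD,
      (hasSatakeDiagram_iff hi hs hτ).2 ⟨fun i => ?_, fun i _ => ht i i.2⟩⟩))))
    rw [h i i.2, Set.mem_ofPred_eq, Nat.odd_add_one, Nat.not_odd_iff_even]
  · refine Or.inr (Or.inr (Or.inr (Or.inr (Or.inr ⟨by omega, ho.add_one, hD,
      (hasSatakeDiagram_iff hi hs hτ).2 ⟨fun i => ?_, fun i _ => hswap ht i⟩⟩))))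
    rw [h i i.2, Set.mem_ofPred_eq, Nat.odd_add_one, Nat.not_odd_iff_even]
    exact and_congr_right fun _ => by omega

theorem exists_type_E₆ {e : Fin 6 ≃ b.support}
    (he : ∀ i j, b.cartanMatrix (e i) (e j) = forkM 5 2 i j) (hne : ∃ x, θ x ≠ x) :
    ∃ e : Fin 6 ≃ b.support, IsEI hs e ∨ IsEII hs e ∨ IsEIII hs e ∨ IsEIV hs e := by
  have hd := satakeDatum hi hs hτ he
  have hw := exists_white hi hs e hne
  have hE : IsNumbering (permE₆.trans e) CartanMatrix.E₆ := fun i j => by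
    rw [Equiv.trans_apply, Equiv.trans_apply, he, E₆_apply]
  have hX (X : Set (Fin 6)) (h : ∀ i, numPred e (fixedSimpleRoots hs) (permE₆ i) ↔ i ∈ X) (i : Fin 6) :
      numPred (permE₆.trans e) (fixedSimpleRoots hs) i ↔ i ∈ X := by
    rw [numPred_trans, h]
  refine ⟨permE₆.trans e, ?_⟩
  rcases hd.E₆_eq_id_or_flip with ht | ht
  · have hid (i : Fin 6) : numPerm (permE₆.trans e) τ i = (id i : Fin 6) := by
      rw [numPerm_trans]; exact ht _ (Fin.is_lt _)
    rcases hd.E₆_of_eq_id ht hw with h | h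
    · exact Or.inl ⟨hE, (hasSatakeDiagram_iff hi hs hτ).2 ⟨hX _ (by simp [h]), fun i _ => hid i⟩⟩
    · refine Or.inr (Or.inr (Or.inr ⟨hE, (hasSatakeDiagram_iff hi hs hτ).2
        ⟨hX _ fun i => ?_, fun i _ => hid i⟩⟩))
      rw [h _ (Fin.is_lt _)]
      revert i
      decide
  · have hflip (i : Fin 6) : numPerm (permE₆.trans e) τ i =
        ((![5, 1, 4, 3, 2, 0] : Fin 6 → Fin 6) i : Fin 6) := by
      rw [numPerm_trans]
      obtain ⟨t0, t1, t2, t3, t4, t5⟩ := ht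
      fin_cases i
      · exact t0
      · exact t5
      · exact t1
      · exact t2
      · exact t3
      · exact t4
    rcases hd.E₆_of_flip ht hw with h | h
    · exact Or.inr (Or.inl ⟨hE, (hasSatakeDiagram_iff hi hs hτ).2 ⟨hX _ (by simp [h]),
        fun i _ => hflip i⟩⟩)
    · refine Or.inr (Or.inr (Or.inl ⟨hE, (hasSatakeDiagram_iff hi hs hτ).2
        ⟨hX _ fun i => ?_, fun i _ => hflip i⟩⟩))
      rw [h _ (Fin.is_lt _)]
      revert i
      decide

end Diagram

theorem isInArakiList [(rootSystem H).IsIrreducible] (hi : ∀ x, θ (θ x) = x)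
    (hs : IsMaximallySplit b θ) (hne : ∃ x, θ x ≠ x) : IsInArakiList hs := by
  obtain ⟨τ, hτ⟩ := (isSplitInvolution hi hs).exists_diagramPerm
  obtain ⟨n, g, hg, e, he⟩ := exists_dynkinForm_of_isIrreducible b
  cases hg with
  | A n hn =>
    refine Or.inr (Or.inl ⟨n, e, ?_⟩)
    rcases isAI_or_isAII_or_isAIII_or_isAIV hi hs hτ hn he hne with h | h | h | h <;> simp [h]
  | B n hn => exact Or.inl (Or.inl ⟨n, hn, e, fun i j => by rw [he, B_apply]⟩)
  | C n hn => exact Or.inl (Or.inr (Or.inl ⟨n, by omega, e, fun i j => by rw [he, C_apply]⟩))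
  | D n hn =>
    obtain ⟨e, h⟩ := exists_type_D hi hs hτ hn he hne
    exact Or.inr (Or.inl ⟨_, e, by simp only [h, or_true]⟩)
  | E₆ => exact Or.inr (Or.inr (exists_type_E₆ hi hs hτ he hne))
  | E₇ =>
    obtain ⟨π, hπ⟩ := exists_perm_E₇
    exact Or.inl (Or.inr (Or.inr (Or.inl ⟨π.trans e, fun i j => by
      rw [Equiv.trans_apply, Equiv.trans_apply, he, hπ]⟩)))
  | E₈ =>
    obtain ⟨π, hπ⟩ := exists_perm_E₈
    exact Or.inl (Or.inr (Or.inr (Or.inr (Or.inl ⟨π.trans e, fun i j => by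
      rw [Equiv.trans_apply, Equiv.trans_apply, he, hπ]⟩))))
  | F₄ => exact Or.inl (Or.inr (Or.inr (Or.inr (Or.inr (Or.inl ⟨e, fun i j => by
      rw [he, F₄_apply]⟩)))))
  | G₂ => exact Or.inl (Or.inr (Or.inr (Or.inr (Or.inr (Or.inr ⟨e, fun i j => by
      rw [he, G₂_apply]⟩)))))

end SymPair

end

/-! ### Rigidity of diagrams, fundamental weights, and the general values -/

noncomputable section
namespace SymPair
set_option linter.unusedSectionVars false

open LieAlgebra.IsKilling (rootSystem)

theorem SatakeDatum.eq_id_of_asymmetric {n : ℕ} {C : ℕ → ℕ → ℤ} {X : ℕ → Prop} {τ : ℕ → ℕ}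
    (hd : SatakeDatum n C X τ) (hC : IsPathLike n C) {i j : ℕ} (hi : i < n) (hj : j < n)
    (h : C (n - 1 - i) (n - 1 - j) ≠ C i j) : ∀ i < n, τ i = i := by
  refine (hd.eq_id_or_reverse hC).resolve_right fun hτ => h ?_
  rw [← hτ i hi, ← hτ j hj, hd.cartan i hi j hj]

/-- The solution of an invertible system with constant right-hand side is invariant under the
symmetries of the matrix. If its entries are distinct, no symmetry moves an index. -/
theorem perm_eq_id_of_mulVec {n : ℕ} {C : Matrix (Fin n) (Fin n) ℤ} (hdet : C.det ≠ 0)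
    {σ : Equiv.Perm (Fin n)} (hσ : ∀ i j, C (σ i) (σ j) = C i j) {c : Fin n → ℤ}
    (hc : Function.Injective c) {d : ℤ} (h : C.mulVec c = fun _ => d) (i : Fin n) : σ i = i := by
  have key : C.mulVec (c ∘ σ) = C.mulVec c := by
    rw [h]
    ext i
    have := congrFun h (σ i)
    rw [← this]
    change ∑ j, C i j * c (σ j) = ∑ j, C (σ i) j * c j
    rw [← Equiv.sum_comp σ fun j => C (σ i) j * c j]
    exact Finset.sum_congr rfl fun j _ => by rw [hσ]
  have := Matrix.eq_zero_of_mulVec_eq_zero hdet (v := c ∘ σ - c) (by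
    rw [Matrix.mulVec_sub, key, sub_self])
  exact hc (congrFun (sub_eq_zero.1 this) i)

/-- The coefficients 1, 2, …, n are divisible by n + 1 on the roots. If τ were the identity, n + 1
would divide 2. -/
theorem SatakeDatum.path_eq_reverse {n : ℕ} (hn : 2 ≤ n) {X : ℕ → Prop} {τ : ℕ → ℕ}
    (hd : SatakeDatum n (pathM n (-1) (-1)) X τ) (hX : ∀ i < n, X i) : ∀ i < n, τ i = n - 1 - i := by
  refine (hd.eq_id_or_reverse (isPathLike_pathM (by norm_num) (by norm_num))).resolve_left
    fun h => ?_
  have key := hd.dvd (n + 1) (fun i => if i < n then (i : ℤ) + 1 else 0)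
    (fun i hi => if_neg fun h => hi (hX i h)) (fun j hj => ?_) 0 (by omega)
  · rw [h 0 (by omega), if_pos (by omega)] at key
    have := Int.le_of_dvd (by norm_num) key
    omega
  · have hjn := hd.mem_lt j hj
    rw [sum_pathM hjn]
    by_cases hl : j + 1 < n
    · refine ⟨0, ?_⟩
      split_ifs <;> omega
    · refine ⟨1, ?_⟩
      split_ifs <;> omega

variable {L : Type*} [LieRing L] [LieAlgebra ℂ L] [FiniteDimensional ℂ L]
  [LieAlgebra.IsSemisimple ℂ L] {H : LieSubalgebra ℂ L} [H.IsCartanSubalgebra]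
  {b : (rootSystem H).Base} {θ : L ≃ₗ⁅ℂ⁆ L}

section FundamentalWeights

open Classical in
theorem fundamentalWeight_apply (i j : b.support) :
    fundamentalWeight b i ((rootSystem H).coroot j) = if j = i then 1 else 0 := by
  rw [fundamentalWeight, ← b.toCoweightBasis_apply j, Basis.coord_apply, Basis.repr_self,
    Finsupp.single_apply]

theorem add_mem_dominantWeights {μ ν : Dual ℂ H} (hμ : μ ∈ dominantWeights b)
    (hν : ν ∈ dominantWeights b) : μ + ν ∈ dominantWeights b := fun i hi => by
  obtain ⟨k, hk⟩ := hμ i hi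
  obtain ⟨l, hl⟩ := hν i hi
  exact ⟨k + l, by rw [LinearMap.add_apply, hk, hl, Nat.cast_add]⟩

theorem fundamentalWeight_mem (i : b.support) : fundamentalWeight b i ∈ dominantWeights b := by
  classical
  exact fun j hj => ⟨if (⟨j, hj⟩ : b.support) = i then 1 else 0, by
    rw [fundamentalWeight_apply i ⟨j, hj⟩]; split_ifs <;> simp⟩

theorem eq_sum_fundamentalWeight {n : ℕ} (e : Fin n ≃ b.support) (μ : Dual ℂ H) :
    μ = ∑ i, μ ((rootSystem H).coroot (e i)) • fundamentalWeight b (e i) := by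
  refine ext_coroot' b fun j hj => ?_
  change μ ((rootSystem H).coroot j) =
    (∑ i, μ ((rootSystem H).coroot (e i)) • fundamentalWeight b (e i)) ((rootSystem H).coroot j)
  obtain ⟨k, hk⟩ := e.surjective ⟨j, hj⟩
  have hk' : ((e k : b.support) : H.root) = j := by rw [hk]
  rw [← hk', LinearMap.sum_apply, Finset.sum_eq_single k]
  · rw [LinearMap.smul_apply, fundamentalWeight_apply, if_pos rfl, smul_eq_mul, mul_one]
  · intro i _ hik
    rw [LinearMap.smul_apply, fundamentalWeight_apply, if_neg fun h => hik (e.injective h.symm),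
      smul_zero]
  · simp

/-- In the basis of fundamental weights, membership is the equality of the last two coordinates;
these may then be paired off. -/
theorem mem_evenSubmonoid_iff {m : ℕ} (hm : 1 ≤ m) (e : Fin (m + 1) ≃ b.support) (μ : Dual ℂ H) :
    μ ∈ evenSubmonoid e ↔ μ ∈ dominantWeights b ∧
      μ ((rootSystem H).coroot (e ⟨m - 1, by omega⟩)) =
        μ ((rootSystem H).coroot (e ⟨m, by omega⟩)) := by
  constructor
  · intro h
    induction h using AddSubmonoid.closure_induction with
    | mem x hx =>
      rcases hx with ⟨i, hi, rfl⟩ | ⟨i, j, hi, hj, rfl⟩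
      · refine ⟨fundamentalWeight_mem _, ?_⟩
        rw [fundamentalWeight_apply, fundamentalWeight_apply, if_neg, if_neg]
        all_goals
          rw [EmbeddingLike.apply_eq_iff_eq, Fin.ext_iff]
          simp only; omega
      · refine ⟨add_mem_dominantWeights (fundamentalWeight_mem _) (fundamentalWeight_mem _), ?_⟩
        simp only [LinearMap.add_apply, fundamentalWeight_apply, EmbeddingLike.apply_eq_iff_eq,
          Fin.ext_iff]
        rw [if_pos (by omega), if_neg (by omega), if_neg (by omega), if_pos (by omega), add_zero,
          zero_add]
    | zero => exact ⟨fun i _ => ⟨0, by simp⟩, by simp⟩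
    | add x y _ _ hx hy =>
      exact ⟨add_mem_dominantWeights hx.1 hy.1, by
        rw [LinearMap.add_apply, LinearMap.add_apply, hx.2, hy.2]⟩
  · rintro ⟨hμ, heq⟩
    choose k hk using fun i : Fin (m + 1) => hμ (e i) (e i).2
    obtain ⟨l, rfl⟩ : ∃ l, m = l + 1 := ⟨m - 1, by omega⟩
    have hsum := eq_sum_fundamentalWeight e μ
    rw [Fin.sum_univ_castSucc, Fin.sum_univ_castSucc, add_assoc] at hsum
    rw [hsum]
    refine add_mem (sum_mem fun i _ => ?_) ?_
    · rw [hk, Nat.cast_smul_eq_nsmul]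
      have hmem : fundamentalWeight b (e i.castSucc.castSucc) ∈ evenSubmonoid e :=
        AddSubmonoid.mem_closure_of_mem (Or.inl ⟨i.castSucc.castSucc, by simp, rfl⟩)
      exact nsmul_mem hmem _
    · have : μ ((rootSystem H).coroot (e (Fin.castSucc (Fin.last l)))) =
          μ ((rootSystem H).coroot (e (Fin.last (l + 1)))) := heq
      rw [this, hk, ← smul_add, Nat.cast_smul_eq_nsmul]
      have hmem : fundamentalWeight b (e (Fin.castSucc (Fin.last l))) +
          fundamentalWeight b (e (Fin.last (l + 1))) ∈ evenSubmonoid e :=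
        AddSubmonoid.mem_closure_of_mem (Or.inr ⟨_, _, by simp, by simp, rfl⟩)
      exact nsmul_mem hmem _

end FundamentalWeights

section Values

variable (hi : ∀ x, θ (θ x) = x) (hs : IsMaximallySplit b θ) {τ τ₀ : Equiv.Perm b.support}
  (hτ : ∀ i : b.support, diagramMap (rootSystem H) (bigThetaEquiv hi hs) (fixedSimpleRoots hs)
    ((rootSystem H).root i) = (rootSystem H).root (τ i))
  (hτ₀ : ∀ i : b.support, diagramMap (rootSystem H) (LinearEquiv.refl ℂ (Dual ℂ H)) b.support
    ((rootSystem H).root i) = (rootSystem H).root (τ₀ i))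
  {n : ℕ} {e : Fin n ≃ b.support}

theorem forall_of_numPerm (h : ∀ i < n, numPerm e τ i = numPerm e τ₀ i) (i : b.support) :
    τ i = τ₀ i := by
  obtain ⟨k, rfl⟩ := e.surjective i
  have := h k k.2
  rw [numPerm_apply, numPerm_apply, ← Fin.ext_iff] at this
  exact e.symm.injective this

theorem forall_eq_of_numPerm (h : ∀ i < n, numPerm e τ i = i) (i : b.support) : τ i = i := by
  obtain ⟨k, rfl⟩ := e.surjective i
  exact (numPerm_eq_iff k k).1 (h k k.2)

include hτ hτ₀ in
theorem PZB_eq_dominantWeights (h : ∀ i < n, numPerm e τ i = numPerm e τ₀ i) :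
    PZB hs = dominantWeights b := by
  have heq : diagramMap (rootSystem H) (bigThetaEquiv hi hs) (fixedSimpleRoots hs) =
      diagramMap (rootSystem H) (LinearEquiv.refl ℂ (Dual ℂ H)) b.support :=
    ext_root b fun i => by rw [hτ, hτ₀, forall_of_numPerm h]
  ext μ
  exact and_iff_left ((isSplitInvolution hi hs).condition_of_diagramMap_eq heq μ)

include hτ in
theorem PZB_eq_selfdualWeights (h : ∀ i < n, numPerm e τ i = i) : PZB hs = selfdualWeights b := by
  ext μ
  refine and_congr_right fun _ =>
    (isSplitInvolution hi hs).condition_iff_of_diagramMap_eq_refl ?_ μ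
  exact (isSplitInvolution hi hs).diagramMap_eq_refl hτ (forall_eq_of_numPerm h)

theorem fixed_iff_of_swap {m : ℕ} (hm : 1 ≤ m) {e : Fin (m + 1) ≃ b.support}
    (h : (∀ i, i + 2 ≤ m → numPerm e τ i = i) ∧ numPerm e τ (m - 1) = m ∧ numPerm e τ m = m - 1)
    (μ : Dual ℂ H) : (∀ i : b.support, (rootSystem H).coroot' (τ i) μ = (rootSystem H).coroot' i μ) ↔
      μ ((rootSystem H).coroot (e ⟨m - 1, by omega⟩)) =
        μ ((rootSystem H).coroot (e ⟨m, by omega⟩)) := by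
  obtain ⟨h1, h2, h3⟩ := h
  have h2' := (numPerm_eq_iff (e := e) (τ := τ) ⟨m - 1, by omega⟩ ⟨m, by omega⟩).1 h2
  have h3' := (numPerm_eq_iff (e := e) (τ := τ) ⟨m, by omega⟩ ⟨m - 1, by omega⟩).1 h3
  constructor
  · intro h
    have := h (e ⟨m, by omega⟩)
    rw [h3'] at this
    exact this
  · intro h i
    obtain ⟨⟨k, hk⟩, rfl⟩ := e.surjective i
    obtain hk' | rfl | rfl : k + 2 ≤ m ∨ k = m - 1 ∨ k = m := by omega
    · rw [(numPerm_eq_iff (e := e) (τ := τ) ⟨k, hk⟩ ⟨k, hk⟩).1 (h1 k hk')]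
    · rw [h2']; exact h.symm
    · rw [h3']; exact h

-- If one of τ, τ₀ is trivial, the condition is invariance of μ under the other one, here the
-- exchange of the last two nodes.
include hτ hτ₀ in
theorem PZB_eq_evenSubmonoid {m : ℕ} (hm : 1 ≤ m) {e : Fin (m + 1) ≃ b.support}
    (h : (∀ i < m + 1, numPerm e τ i = i) ∧ ((∀ i, i + 2 ≤ m → numPerm e τ₀ i = i) ∧
        numPerm e τ₀ (m - 1) = m ∧ numPerm e τ₀ m = m - 1) ∨
      (∀ i < m + 1, numPerm e τ₀ i = i) ∧ ((∀ i, i + 2 ≤ m → numPerm e τ i = i) ∧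
        numPerm e τ (m - 1) = m ∧ numPerm e τ m = m - 1)) :
    PZB hs = evenSubmonoid e := by
  ext μ
  rw [SetLike.mem_coe, mem_evenSubmonoid_iff hm]
  refine and_congr_right fun _ => ?_
  rcases h with ⟨h1, h2⟩ | ⟨h1, h2⟩
  · refine ((isSplitInvolution hi hs).condition_iff_of_diagramMap_eq_refl
      ((isSplitInvolution hi hs).diagramMap_eq_refl hτ (forall_eq_of_numPerm h1)) μ).trans ?_
    rw [longestElement_support, neg_neg, (isSplitInvolution_refl b).eq_diagramMap_iff hτ₀,
      fixed_iff_of_swap hm h2]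
  · refine ((isSplitInvolution hi hs).condition_iff_of_refl
      ((isSplitInvolution_refl b).diagramMap_eq_refl hτ₀ (forall_eq_of_numPerm h1)) μ).trans ?_
    rw [(isSplitInvolution hi hs).eq_diagramMap_iff hτ, fixed_iff_of_swap hm h2]

end Values

end SymPair

end

/-! ### The values for simple Lie algebras, type by type -/

noncomputable section
namespace SymPair
set_option linter.unusedSectionVars false

open LieAlgebra.IsKilling (rootSystem)

variable {L : Type*} [LieRing L] [LieAlgebra ℂ L] [FiniteDimensional ℂ L]
  [LieAlgebra.IsSemisimple ℂ L] {H : LieSubalgebra ℂ L} [H.IsCartanSubalgebra]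
  {b : (rootSystem H).Base} {θ : L ≃ₗ⁅ℂ⁆ L}

theorem SatakeDatum.B_eq_id {n : ℕ} (hn : 2 ≤ n) {X : ℕ → Prop} {τ : ℕ → ℕ}
    (hd : SatakeDatum n (pathM n (-2) (-1)) X τ) : ∀ i < n, τ i = i := by
  refine hd.eq_id_of_asymmetric (isPathLike_pathM (by norm_num) (by norm_num)) (i := n - 2)
    (j := n - 1) (by omega) (by omega) ?_
  simp only [pathM]
  split_ifs <;> omega

theorem SatakeDatum.C_eq_id {n : ℕ} (hn : 2 ≤ n) {X : ℕ → Prop} {τ : ℕ → ℕ}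
    (hd : SatakeDatum n (pathM n (-1) (-2)) X τ) : ∀ i < n, τ i = i := by
  refine hd.eq_id_of_asymmetric (isPathLike_pathM (by norm_num) (by norm_num)) (i := n - 1)
    (j := n - 2) (by omega) (by omega) ?_
  simp only [pathM]
  split_ifs <;> omega

theorem SatakeDatum.F₄_eq_id {X : ℕ → Prop} {τ : ℕ → ℕ} (hd : SatakeDatum 4 fourM X τ) :
    ∀ i < 4, τ i = i := by
  refine hd.eq_id_of_asymmetric (fun i hi j hj hij => ?_) (i := 1) (j := 2) (by omega) (by omega)
    (by decide)
  simp only [fourM]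
  split_ifs <;> omega

theorem SatakeDatum.G₂_eq_id {X : ℕ → Prop} {τ : ℕ → ℕ}
    (hd : SatakeDatum 2 (pathM 2 (-3) (-1)) X τ) : ∀ i < 2, τ i = i :=
  hd.eq_id_of_asymmetric (isPathLike_pathM (by norm_num) (by norm_num)) (i := 0) (j := 1)
    (by omega) (by omega) (by decide)

section Values

variable (hi : ∀ x, θ (θ x) = x) (hs : IsMaximallySplit b θ) {τ τ₀ : Equiv.Perm b.support}
  (hτ : ∀ i : b.support, diagramMap (rootSystem H) (bigThetaEquiv hi hs) (fixedSimpleRoots hs)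
    ((rootSystem H).root i) = (rootSystem H).root (τ i))
  (hτ₀ : ∀ i : b.support, diagramMap (rootSystem H) (LinearEquiv.refl ℂ (Dual ℂ H)) b.support
    ((rootSystem H).root i) = (rootSystem H).root (τ₀ i))

theorem eq_id_of_mulVec {n : ℕ} {e : Fin n ≃ b.support} {C : Matrix (Fin n) (Fin n) ℤ}
    (he : IsNumbering e C) (hdet : C.det ≠ 0) {c : Fin n → ℤ} (hc : Function.Injective c) {d : ℤ}
    (h : C.mulVec c = fun _ => d)
    (hcartan : ∀ i j, b.cartanMatrix (τ i) (τ j) = b.cartanMatrix i j) :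
    ∀ i < n, numPerm e τ i = i := by
  intro i hi
  have := perm_eq_id_of_mulVec hdet (σ := (e.trans τ).trans e.symm)
    (fun i j => by rw [← he, ← he]; simp [hcartan]) hc h ⟨i, hi⟩
  have h' := numPerm_apply (e := e) (τ := τ) ⟨i, hi⟩
  simp only at h'
  rw [h']
  exact congrArg Fin.val this

include hi hs hτ hτ₀

theorem PZB_of_isTypeBCEFG (h : IsTypeBCEFG b) : PZB hs = dominantWeights b := by
  have hdat {n : ℕ} {e : Fin n ≃ b.support} {C : ℕ → ℕ → ℤ}
      (he : ∀ i j, b.cartanMatrix (e i) (e j) = C i j)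
      (hC : ∀ X τ, SatakeDatum n C X τ → ∀ i < n, τ i = i) : PZB hs = dominantWeights b :=
    PZB_eq_dominantWeights hi hs hτ hτ₀ (e := e) fun i hin =>
      (hC _ _ (satakeDatum hi hs hτ he) i hin).trans (hC _ _ (satakeDatum_refl hτ₀ he) i hin).symm
  have hmat {n : ℕ} {e : Fin n ≃ b.support} {C : Matrix (Fin n) (Fin n) ℤ}
      (he : IsNumbering e C) (hdet : C.det ≠ 0) {c : Fin n → ℤ} (hc : Function.Injective c)
      (h : C.mulVec c = fun _ => 2) : PZB hs = dominantWeights b :=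
    PZB_eq_dominantWeights hi hs hτ hτ₀ (e := e) fun i hin =>
      (eq_id_of_mulVec he hdet hc h ((isSplitInvolution hi hs).cartanMatrix_diagramPerm hτ) i hin).trans
        (eq_id_of_mulVec he hdet hc h
          ((isSplitInvolution_refl b).cartanMatrix_diagramPerm hτ₀) i hin).symm
  rcases h with ⟨n, hn, e, he⟩ | ⟨n, hn, e, he⟩ | ⟨e, he⟩ | ⟨e, he⟩ | ⟨e, he⟩ | ⟨e, he⟩
  · exact hdat (fun i j => (he i j).trans (B_apply n i j)) fun _ _ hd => hd.B_eq_id hn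
  · exact hdat (fun i j => (he i j).trans (C_apply n i j)) fun _ _ hd => hd.C_eq_id hn
  -- The coefficients of the sum of the positive roots, which has the value 2 at each simple coroot.
  -- They are distinct, so the diagram has no symmetry; the same is done for E₈.
  · refine hmat he (by rw [CartanMatrix.E₇_det]; norm_num) (c := ![34, 49, 66, 96, 75, 52, 27])
      (by decide) ?_
    ext i; fin_cases i <;> rfl
  · refine hmat he (by rw [CartanMatrix.E₈_det]; norm_num)
      (c := ![92, 136, 182, 270, 220, 168, 114, 58]) (by decide) ?_
    ext i; fin_cases i <;> rfl
  · exact hdat (fun i j => (he i j).trans (F₄_apply i j)) fun _ _ hd => hd.F₄_eq_id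
  · exact hdat (fun i j => (he i j).trans (G₂_apply i j)) fun _ _ hd => hd.G₂_eq_id

omit hτ₀ in
theorem PZB_of_isAI {n : ℕ} {e : Fin n ≃ b.support} (h : IsAI hs e) : PZB hs = selfdualWeights b := by
  have hd := (hasSatakeDiagram_iff hi hs hτ).1 h.2.2
  exact PZB_eq_selfdualWeights hi hs hτ fun i hin => hd.2 ⟨i, hin⟩ (Set.notMem_empty _)

omit hτ₀ in
theorem PZB_of_isDI₃ {n : ℕ} {e : Fin n ≃ b.support} (h : IsDI₃ hs e) :
    PZB hs = selfdualWeights b := by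
  have hd := (hasSatakeDiagram_iff hi hs hτ).1 h.2.2
  exact PZB_eq_selfdualWeights hi hs hτ fun i hin => hd.2 ⟨i, hin⟩ (Set.notMem_empty _)

omit hτ₀ in
theorem PZB_of_isEI {e : Fin 6 ≃ b.support} (h : IsEI hs e) : PZB hs = selfdualWeights b := by
  have hd := (hasSatakeDiagram_iff hi hs hτ).1 h.2
  exact PZB_eq_selfdualWeights hi hs hτ fun i hin => hd.2 ⟨i, hin⟩ (Set.notMem_empty _)

-- The white nodes are fixed because there are no arrows, the black ones because they are isolated.
-- So τ is trivial.
omit hτ₀ in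
theorem PZB_eq_selfdualWeights_of_isolated {n : ℕ} {e : Fin n ≃ b.support} {C : ℕ → ℕ → ℤ}
    (he : ∀ i j, b.cartanMatrix (e i) (e j) = C i j)
    (hsd : HasSatakeDiagram hs e {i | Odd (i.val + 1)} id)
    (hC : ∀ i < n, ∀ j < n, Even i → Even j → j ≠ i → C i j = 0) : PZB hs = selfdualWeights b := by
  have hd := satakeDatum hi hs hτ he
  have hsd := (hasSatakeDiagram_iff hi hs hτ).1 hsd
  have hX (i : ℕ) (hin : i < n) : numPred e (fixedSimpleRoots hs) i ↔ Even i := by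
    have := hsd.1 ⟨i, hin⟩
    rwa [Set.mem_ofPred_eq, Nat.odd_add_one, Nat.not_odd_iff_even] at this
  refine PZB_eq_selfdualWeights hi hs hτ (e := e) fun i hin => ?_
  by_cases hiX : numPred e (fixedSimpleRoots hs) i
  · refine hd.fixed_of_isolated hiX fun k hk hki => ?_
    have hkn := hd.mem_lt k hk
    exact hC i hin k hkn ((hX i hin).1 hiX) ((hX k hkn).1 hk) hki
  · exact hsd.2 ⟨i, hin⟩ fun h => hiX ((hsd.1 ⟨i, hin⟩).2 h)

omit hτ₀ in
theorem PZB_of_isAII {n : ℕ} {e : Fin n ≃ b.support} (h : IsAII hs e) :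
    PZB hs = selfdualWeights b := by
  refine PZB_eq_selfdualWeights_of_isolated hi hs hτ
    (fun i j => (h.2.2.1 i j).trans (A_apply n i j)) h.2.2.2 fun i hi j hj hie hje hij => ?_
  simp only [pathM]
  grind

omit hτ₀ in
theorem PZB_of_isDIII₁ {n : ℕ} {e : Fin n ≃ b.support} (h : IsDIII₁ hs e) :
    PZB hs = selfdualWeights b := by
  obtain ⟨hn, hne, he, hsd⟩ := h
  obtain ⟨m, rfl⟩ : ∃ m, n = m + 1 := ⟨n - 1, by omega⟩
  refine PZB_eq_selfdualWeights_of_isolated hi hs hτ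
    (fun i j => (he i j).trans (D_apply (by omega) i j)) hsd fun i hi j hj hie hje hij => ?_
  by_contra h
  rw [← ne_eq, forkM_ne_zero_iff (by omega) hi hj hij.symm] at h
  grind

omit hi hs hτ hτ₀ in
theorem E₆_numbering {e : Fin 6 ≃ b.support} (he : IsNumbering e CartanMatrix.E₆) (i j : Fin 6) :
    b.cartanMatrix (permE₆.symm.trans e i) (permE₆.symm.trans e j) = forkM 5 2 i j := by
  rw [Equiv.trans_apply, Equiv.trans_apply, he, E₆_apply, Equiv.apply_symm_apply,
    Equiv.apply_symm_apply]

omit hτ₀ in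
theorem PZB_of_isEIV {e : Fin 6 ≃ b.support} (h : IsEIV hs e) : PZB hs = selfdualWeights b := by
  have hd := satakeDatum hi hs hτ (E₆_numbering h.1)
  have hsd := (hasSatakeDiagram_iff hi hs hτ).1 h.2
  refine PZB_eq_selfdualWeights hi hs hτ (e := permE₆.symm.trans e)
    (hd.E₆_eq_id_or_flip.resolve_right fun hf => ?_)
  have h0 : numPerm e τ (0 : Fin 6) = (0 : Fin 6) := hsd.2 0 (by decide)
  have := (numPerm_trans (e := e) (τ := τ) permE₆.symm 0 0).2 h0
  have h4 := hf.1
  change numPerm (permE₆.symm.trans e) τ 0 = 0 at this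
  omega

/-- The arrow at the white node α₁ shows that τ is the flip, and −w₀ is the flip too. -/
theorem PZB_eq_dominantWeights_of_E₆ {e : Fin 6 ≃ b.support} (he : IsNumbering e CartanMatrix.E₆)
    {X : Set (Fin 6)} (hX : 0 ∉ X) (hsd : HasSatakeDiagram hs e X ![5, 1, 4, 3, 2, 0]) :
    PZB hs = dominantWeights b := by
  have he' := E₆_numbering he
  have hd := satakeDatum hi hs hτ he'
  have hd₀ := satakeDatum_refl hτ₀ he'
  have hsd := (hasSatakeDiagram_iff hi hs hτ).1 hsd
  have h0 : numPerm e τ (0 : Fin 6) = (5 : Fin 6) := hsd.2 0 hX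
  have h1 := (numPerm_trans (e := e) (τ := τ) permE₆.symm 0 4).2 h0
  change numPerm (permE₆.symm.trans e) τ 0 = 4 at h1
  have h2 : numPerm (permE₆.symm.trans e) τ₀ 0 = 4 := hd₀.E₆_flip fun i hi => numPred_support i hi
  have hf := hd.E₆_eq_id_or_flip.resolve_left fun h => by have := h 0 (by norm_num); omega
  have hf₀ := hd₀.E₆_eq_id_or_flip.resolve_left fun h => by have := h 0 (by norm_num); omega
  refine PZB_eq_dominantWeights hi hs hτ hτ₀ (e := permE₆.symm.trans e) fun i hi => ?_
  obtain ⟨a0, a1, a2, a3, a4, a5⟩ := hf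
  obtain ⟨c0, c1, c2, c3, c4, c5⟩ := hf₀
  interval_cases i <;> simp only [a0, a1, a2, a3, a4, a5, c0, c1, c2, c3, c4, c5]

theorem PZB_eq_dominantWeights_of_A {n : ℕ} (hn : 2 ≤ n) {e : Fin n ≃ b.support}
    (he : IsNumbering e (CartanMatrix.A n)) {X : Set (Fin n)} (hX : (⟨0, by omega⟩ : Fin n) ∉ X)
    (hsd : HasSatakeDiagram hs e X Fin.rev) : PZB hs = dominantWeights b := by
  have he' (i j : Fin n) := (he i j).trans (A_apply n i j)
  have hd := satakeDatum hi hs hτ he'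
  have hd₀ := satakeDatum_refl hτ₀ he'
  have h0 := ((hasSatakeDiagram_iff hi hs hτ).1 hsd).2 _ hX
  simp only [Fin.val_rev] at h0
  have h := (hd.eq_id_or_reverse (isPathLike_pathM (by norm_num) (by norm_num))).resolve_left
    fun h => by have := h 0 (by omega); omega
  have h₀ := hd₀.path_eq_reverse hn fun i hi => numPred_support i hi
  exact PZB_eq_dominantWeights hi hs hτ hτ₀ (e := e) fun i hi => (h i hi).trans (h₀ i hi).symm

theorem PZB_of_isAIII {n r : ℕ} {e : Fin n ≃ b.support} (h : IsAIII hs e r) :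
    PZB hs = dominantWeights b := by
  obtain ⟨hr, hn, he, hsd⟩ := h
  refine PZB_eq_dominantWeights_of_A hi hs hτ hτ₀ (by omega) he ?_ hsd
  rw [Set.mem_ofPred_eq]; simp only; omega

theorem PZB_of_isAIV {n : ℕ} {e : Fin n ≃ b.support} (h : IsAIV hs e) :
    PZB hs = dominantWeights b := by
  obtain ⟨hn, he, hsd⟩ := h
  refine PZB_eq_dominantWeights_of_A hi hs hτ hτ₀ hn he ?_ hsd
  rw [Set.mem_ofPred_eq]; simp only; omega

-- This is `fork_parity` with all nodes black, that is r = 0. For D₄ it must first be known that a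
-- leg is fixed.
omit hi hτ hs in
theorem fork_refl_cases {m : ℕ} (hm : 3 ≤ m) {e : Fin (m + 1) ≃ b.support}
    (he : ∀ i j, b.cartanMatrix (e i) (e j) = forkM m (m - 2) i j) :
    (Odd m ∧ ∀ i < m + 1, numPerm e τ₀ i = i) ∨
      (Even m ∧ (∀ i, i + 2 ≤ m → numPerm e τ₀ i = i) ∧ numPerm e τ₀ (m - 1) = m ∧
        numPerm e τ₀ m = m - 1) := by
  have hd := satakeDatum_refl hτ₀ he
  have hX : ∀ i < m + 1, (numPred e (b.support : Set H.root) i ↔ 0 ≤ i) := fun i hi =>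
    iff_of_true (numPred_support i hi) (Nat.zero_le i)
  have hp := hd.fork_parity hm (by omega) hX
  rcases hd.fork_eq_id_or_swap hm (fun h3 => by
    subst h3; exact hd.fork_four_eq_id rfl (fun i hi => numPred_support i hi) 0 (by norm_num))
    with h | h
  · have := hp.1 (h m (by omega))
    exact Or.inl ⟨by simpa [Nat.even_add_one] using this, h⟩
  · have := hp.2 h.2.2
    exact Or.inr ⟨by simpa [Nat.odd_add_one] using this, h⟩

omit hi hτ hs hτ₀ in
theorem eq_of_swap {m : ℕ} {s t : ℕ → ℕ}
    (h : (∀ i, i + 2 ≤ m → s i = i) ∧ s (m - 1) = m ∧ s m = m - 1)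
    (h' : (∀ i, i + 2 ≤ m → t i = i) ∧ t (m - 1) = m ∧ t m = m - 1) : ∀ i < m + 1, s i = t i := by
  intro i hi
  obtain hk | rfl | rfl : i + 2 ≤ m ∨ i = m - 1 ∨ i = m := by omega
  · rw [h.1 i hk, h'.1 i hk]
  · rw [h.2.1, h'.2.1]
  · rw [h.2.2, h'.2.2]

theorem PZB_of_isDIII₂ {n : ℕ} {e : Fin n ≃ b.support} (h : IsDIII₂ hs e) :
    PZB hs = dominantWeights b := by
  obtain ⟨hn, hno, he, hsd⟩ := h
  obtain ⟨m, rfl⟩ : ∃ m, n = m + 1 := ⟨n - 1, by omega⟩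
  have hme : Even m := by simpa [Nat.odd_add_one] using hno
  have hm : 3 ≤ m := by omega
  have he' (i j : Fin (m + 1)) := (he i j).trans (D_apply hm i j)
  have hd := satakeDatum hi hs hτ he'
  have hmτ := ((hasSatakeDiagram_iff hi hs hτ).1 hsd).2 ⟨m, by omega⟩
    (by rw [Set.mem_ofPred_eq]; simp only; omega)
  simp only [swapLast, dif_neg (by omega : ¬ m + 2 = m + 1), dif_pos] at hmτ
  have h := (hd.fork_eq_id_or_swap hm fun h => absurd hme (by subst h; decide)).resolve_left
    fun h => by have := h m (by omega); omega
  have h₀ := (fork_refl_cases hτ₀ hm he').resolve_left fun h => (Nat.not_odd_iff_even.2 hme) h.1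
  exact PZB_eq_dominantWeights hi hs hτ hτ₀ (e := e) (eq_of_swap h h₀.2)

theorem PZB_of_isDI₂ {n : ℕ} {e : Fin n ≃ b.support} (h : IsDI₂ hs e) :
    (Odd n → PZB hs = dominantWeights b) ∧ (Even n → PZB hs = evenSubmonoid e) := by
  obtain ⟨hn, he, hsd⟩ := h
  obtain ⟨m, rfl⟩ : ∃ m, n = m + 1 := ⟨n - 1, by omega⟩
  have hm : 3 ≤ m := by omega
  have he' (i j : Fin (m + 1)) := (he i j).trans (D_apply hm i j)
  have hsw (i : ℕ) (hi' : i < m + 1) := ((hasSatakeDiagram_iff hi hs hτ).1 hsd).2 ⟨i, hi'⟩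
    (Set.notMem_empty _)
  have h : (∀ i, i + 2 ≤ m → numPerm e τ i = i) ∧ numPerm e τ (m - 1) = m ∧
      numPerm e τ m = m - 1 := by
    refine ⟨fun i hi => ?_, ?_, ?_⟩
    · rw [hsw i (by omega), swapLast, dif_neg (by simp only; omega), dif_neg (by simp only; omega)]
    · rw [hsw (m - 1) (by omega), swapLast, dif_pos (by simp only; omega)]; rfl
    · rw [hsw m (by omega), swapLast, dif_neg (by simp only; omega), dif_pos (by simp only)]; rfl
  rcases fork_refl_cases hτ₀ hm he' with ⟨hmo, h₀⟩ | ⟨hme, h₀⟩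
  · refine ⟨fun ho => ?_, fun _ => ?_⟩
    · exact absurd hmo (Nat.not_odd_iff_even.2 (by simpa [Nat.odd_add_one] using ho))
    · exact PZB_eq_evenSubmonoid hi hs hτ hτ₀ (by omega) (Or.inr ⟨h₀, h⟩)
  · refine ⟨fun _ => ?_, fun hev => ?_⟩
    · exact PZB_eq_dominantWeights hi hs hτ hτ₀ (e := e) (eq_of_swap h h₀)
    · exact absurd hme (by simpa [Nat.even_add_one] using hev)

/-- The black tail has n − r nodes, so τ is trivial if and only if n − r is even, while τ₀ is
trivial if and only if n is even. They agree exactly for even r; for odd r one is trivial and the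
other is the exchange of the last two nodes. -/
theorem PZB_of_black_tail {n r : ℕ} (hn : 4 ≤ n) (hr : 1 ≤ r) (hrn : r + 2 ≤ n)
    {e : Fin n ≃ b.support} (he : IsNumbering e (CartanMatrix.D n))
    (hsd : HasSatakeDiagram hs e {i | r + 1 ≤ i.val + 1} id) :
    (Even r → PZB hs = dominantWeights b) ∧ (Odd r → PZB hs = evenSubmonoid e) := by
  obtain ⟨m, rfl⟩ : ∃ m, n = m + 1 := ⟨n - 1, by omega⟩
  have hm : 3 ≤ m := by omega
  have he' (i j : Fin (m + 1)) := (he i j).trans (D_apply hm i j)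
  have hd := satakeDatum hi hs hτ he'
  have hsd := (hasSatakeDiagram_iff hi hs hτ).1 hsd
  have hX (i : ℕ) (hi : i < m + 1) : numPred e (fixedSimpleRoots hs) i ↔ r ≤ i :=
    (hsd.1 ⟨i, hi⟩).trans (by rw [Set.mem_ofPred_eq]; simp only; omega)
  have hp := hd.fork_parity hm (by omega) hX
  have h0 : numPerm e τ 0 = 0 := hsd.2 ⟨0, by omega⟩ (by rw [Set.mem_ofPred_eq]; simp only; omega)
  rcases hd.fork_eq_id_or_swap hm (fun _ => h0) with h | h
  · have hev := hp.1 (h m (by omega))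
    rcases fork_refl_cases hτ₀ hm he' with ⟨hmo, h₀⟩ | ⟨hme, h₀⟩
    · refine ⟨fun _ => PZB_eq_dominantWeights hi hs hτ hτ₀ (e := e) fun i hi =>
        (h i hi).trans (h₀ i hi).symm, fun ho => ?_⟩
      grind
    · refine ⟨fun hr => ?_, fun _ =>
        PZB_eq_evenSubmonoid hi hs hτ hτ₀ (by omega) (Or.inl ⟨h, h₀⟩)⟩
      grind
  · have hod := hp.2 h.2.2
    rcases fork_refl_cases hτ₀ hm he' with ⟨hmo, h₀⟩ | ⟨hme, h₀⟩
    · refine ⟨fun hr => ?_, fun _ =>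
        PZB_eq_evenSubmonoid hi hs hτ hτ₀ (by omega) (Or.inr ⟨h₀, h⟩)⟩
      grind
    · refine ⟨fun _ => PZB_eq_dominantWeights hi hs hτ hτ₀ (e := e) (eq_of_swap h h₀),
        fun ho => ?_⟩
      grind

end Values

end SymPair

end

/-! ### Orthogonal sets of simple roots and their exchange -/

noncomputable section
namespace SymPair
set_option linter.unusedSectionVars false

section Orthogonal

variable {ι K M N : Type*} [Finite ι] [Field K] [CharZero K] [AddCommGroup M] [Module K M]
  [AddCommGroup N] [Module K N] {P : RootPairing ι K M N} [P.IsRootSystem] [P.IsCrystallographic]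
  [P.IsReduced] {b : P.Base}

theorem apply_eq_self_of_coroot'_eq_zero {S : Set ι} {w : M ≃ₗ[K] M} (hw : w ∈ reflectionSubgroup P S)
    {x : M} (hx : ∀ i ∈ S, P.coroot' i x = 0) : w x = x := by
  induction hw using reflectionSubgroup_induction with
  | one => rfl
  | refl_mul i hi w _ h =>
    rw [LinearEquiv.mul_apply, h, RootPairing.reflection_apply, hx i hi, zero_smul, sub_zero]

theorem longestElement_empty : longestElement P (∅ : Set ι) = 1 := by
  have h := longestElement_mem (P := P) (∅ : Set ι)
  rwa [reflectionSubgroup, Set.image_empty, Subgroup.closure_empty, Subgroup.mem_bot] at h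

variable {S S' : Set ι} (hS : S ⊆ b.support) (hS' : S' ⊆ b.support)
  (horth : ∀ i ∈ S, ∀ j ∈ S', P.pairing i j = 0)
include hS hS' horth

theorem coroot'_apply_of_mem_reflectionSubgroup {w : M ≃ₗ[K] M} (hw : w ∈ reflectionSubgroup P S)
    (x : M) {j : ι} (hj : j ∈ S') : P.coroot' j (w x) = P.coroot' j x := by
  have h := apply_sub_mem_span hw x
  have hle : Submodule.span K (P.root '' S) ≤ LinearMap.ker (P.coroot' j) := by
    rw [Submodule.span_le]
    rintro _ ⟨i, hi, rfl⟩
    rw [SetLike.mem_coe, LinearMap.mem_ker, RootPairing.root_coroot'_eq_pairing, horth i hi j hj]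
  have := hle h
  rwa [LinearMap.mem_ker, map_sub, sub_eq_zero] at this

/-- Each factor acts trivially on the roots of the other set, so the product makes all simple roots
negative, which characterises the longest element. -/
theorem longestElement_mul_longestElement (hu : ∀ i ∈ b.support, i ∈ S ∨ i ∈ S') :
    longestElement P S * longestElement P S' = longestElement P b.support := by
  have hfix (w : M ≃ₗ[K] M) (hw : w ∈ reflectionSubgroup P S) (j : ι) (hj : j ∈ S') :
      w (P.root j) = P.root j :=
    apply_eq_self_of_coroot'_eq_zero hw fun i hi => by
      rw [RootPairing.root_coroot'_eq_pairing, P.pairing_eq_zero_iff, horth i hi j hj]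
  have hmono {T : Set ι} (hT : T ⊆ b.support) : reflectionSubgroup P T ≤
      reflectionSubgroup P (b.support : Set ι) := Subgroup.closure_mono (Set.image_mono hT)
  refine eq_longestElement le_rfl (mul_mem (hmono hS (longestElement_mem S))
    (hmono hS' (longestElement_mem S'))) fun j hj k hk => ?_
  rw [LinearEquiv.mul_apply] at hk
  rcases hu j hj with hjS | hjS
  · have : longestElement P S' (P.root j) = P.root j :=
      apply_eq_self_of_coroot'_eq_zero (longestElement_mem S') fun i hi => by
        rw [RootPairing.root_coroot'_eq_pairing, horth j hjS i hi]
    rw [this] at hk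
    exact not_isPos_of_longestElement_apply hS hjS hk
  · have hx : ∀ i ∈ S, P.coroot' i (longestElement P S' (P.root j)) = 0 := by
      intro i hi
      have hle : Submodule.span K (P.root '' S') ≤ LinearMap.ker (P.coroot' i) := by
        rw [Submodule.span_le]
        rintro _ ⟨k, hk, rfl⟩
        rw [SetLike.mem_coe, LinearMap.mem_ker, RootPairing.root_coroot'_eq_pairing,
          P.pairing_eq_zero_iff, horth i hi k hk]
      exact hle (apply_mem_span (longestElement_mem S') (Submodule.subset_span ⟨j, hjS, rfl⟩))
    rw [apply_eq_self_of_coroot'_eq_zero (longestElement_mem S) hx] at hk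
    exact not_isPos_of_longestElement_apply hS' hjS hk

theorem longestElement_support_apply (hu : ∀ i ∈ b.support, i ∈ S ∨ i ∈ S') {x : M}
    (hx : ∀ i ∈ S', P.coroot' i x = 0) :
    longestElement P b.support x = longestElement P S x := by
  rw [← longestElement_mul_longestElement hS hS' horth hu, LinearEquiv.mul_apply,
    apply_eq_self_of_coroot'_eq_zero (longestElement_mem S') hx]

end Orthogonal

section Exchange

variable {ι K M N : Type*} [Finite ι] [Field K] [CharZero K] [AddCommGroup M] [Module K M]
  [AddCommGroup N] [Module K N] {P : RootPairing ι K M N} [P.IsRootSystem] [P.IsCrystallographic]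
  [P.IsReduced] {b : P.Base} {T : M ≃ₗ[K] M} (hT : IsSplitInvolution b T ∅)
  {τ : Equiv.Perm b.support} (hτ : ∀ i : b.support, diagramMap P T ∅ (P.root i) = P.root (τ i))
  {S S' : Set ι} (hS : S ⊆ b.support) (hS' : S' ⊆ b.support) (hSS : Disjoint S S')
  (hu : ∀ i ∈ b.support, i ∈ S ∨ i ∈ S')
  (horth : ∀ i ∈ S, ∀ j ∈ S', P.pairing i j = 0)
  (hswap : ∀ i : b.support, (i : ι) ∈ S → (τ i : ι) ∈ S')
  (hswap' : ∀ i : b.support, (i : ι) ∈ S' → (τ i : ι) ∈ S)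

theorem diagramMap_empty (x : M) : diagramMap P T ∅ x = -T x := by
  rw [diagramMap_apply, longestElement_empty]; rfl

include hT hτ hS hS' hswap hswap'

/-- Conjugation by δ carries the generators of W(S) to generators of W(S') and preserves positivity,
hence carries longest element to longest element. -/
theorem IsSplitInvolution.diagramMap_longestElement (x : M) :
    diagramMap P T ∅ (longestElement P S x) = longestElement P S' (diagramMap P T ∅ x) := by
  set f := diagramMap P T ∅ with hf
  have hinv : f * f = 1 := LinearEquiv.ext hT.diagramMap_diagramMap
  have hperm : PermutesRoots P f := hT.permutesRoots_diagramMap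
  have hconj : ∀ w ∈ reflectionSubgroup P S, f * w * f ∈ reflectionSubgroup P S' := by
    intro w hw
    induction hw using reflectionSubgroup_induction with
    | one => rw [mul_one, hinv]; exact one_mem _
    | refl_mul i hi w _ h =>
      have h1 := hperm.reflection_mul (hτ ⟨i, hS hi⟩)
      have : f * (P.reflection i * w) * f = P.reflection (τ ⟨i, hS hi⟩) * (f * w * f) := by
        rw [← mul_assoc f, ← h1]; simp only [mul_assoc]
      rw [this]
      exact mul_mem (reflection_mem (hswap _ hi)) h
  have key : f * longestElement P S * f = longestElement P S' := by
    refine eq_longestElement hS' (hconj _ (longestElement_mem S)) fun j hj k hk hpos => ?_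
    rw [LinearEquiv.mul_apply, LinearEquiv.mul_apply, hτ ⟨j, hS' hj⟩] at hk
    have h1 : longestElement P S (P.root (τ ⟨j, hS' hj⟩)) = f (P.root k) := by
      rw [← hk]; exact (hT.diagramMap_diagramMap _).symm
    obtain ⟨l, hl, hl'⟩ := hT.diagramMap_isPos hpos
    exact not_isPos_of_longestElement_apply hS (hswap' ⟨j, hS' hj⟩ hj) (h1.trans hl') hl
  rw [← key, LinearEquiv.mul_apply, LinearEquiv.mul_apply, ← LinearEquiv.mul_apply f f, hinv]
  rfl

include hu horth

/-- With T = −f the condition reads w_S μ + ν = −f(μ + w_S ν). The left-hand side vanishes on the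
coroots of S', the right-hand side on those of S, so both are zero. -/
theorem IsSplitInvolution.exchange_condition_iff {μ ν : M} (hμ : ∀ i ∈ S', P.coroot' i μ = 0)
    (hν : ∀ i ∈ S', P.coroot' i ν = 0) :
    T (μ - T ν) = (μ - T ν) + longestElement P b.support (μ - T ν) - longestElement P ∅ (μ - T ν) ↔
      ν = -longestElement P S μ := by
  set f := diagramMap P T ∅ with hf
  have hTf (x : M) : T x = -f x := by rw [hf, diagramMap_empty, neg_neg]
  have hff (x : M) : f (f x) = x := hT.diagramMap_diagramMap x
  have horth' : ∀ i ∈ S', ∀ j ∈ S, P.pairing i j = 0 := fun i hi j hj => by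
    rw [P.pairing_eq_zero_iff]; exact horth j hj i hi
  have hf0 {y : M} (hy : ∀ i ∈ S', P.coroot' i y = 0) : ∀ i ∈ S, P.coroot' i (f y) = 0 := by
    intro i hi
    have h := hT.coroot'_diagramMap hτ (τ ⟨i, hS hi⟩) y
    rw [hT.diagramPerm_diagramPerm hτ, hy _ (hswap _ hi)] at h
    exact h
  have hμ' : longestElement P b.support μ = longestElement P S μ :=
    longestElement_support_apply hS hS' horth hu hμ
  have hν' : longestElement P b.support (f ν) = f (longestElement P S ν) := by
    rw [longestElement_support_apply hS' hS horth' (fun i hi => (hu i hi).symm) (hf0 hν)]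
    exact (hT.diagramMap_longestElement hτ hS hS' hswap hswap' ν).symm
  rw [longestElement_empty, LinearEquiv.coe_one, id, add_sub_cancel_left, hTf ν, sub_neg_eq_add,
    map_add, map_add, hμ', hν', hTf μ, hTf (f ν), hff]
  constructor
  · intro h
    have h1 : longestElement P S μ + ν = -f (μ + longestElement P S ν) := by
      rw [map_add, ← sub_eq_zero, ← neg_eq_zero.2 (sub_eq_zero.2 h)]; abel
    have h2 : longestElement P S μ + ν = 0 := by
      refine ext_coroot' b fun i hi => ?_
      rw [map_zero]
      rcases hu i hi with hiS | hiS
      · rw [h1, map_neg, hf0 (fun j hj => ?_) i hiS, neg_zero]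
        rw [map_add, coroot'_apply_of_mem_reflectionSubgroup hS hS' horth (longestElement_mem S) ν hj,
          hμ j hj, hν j hj, add_zero]
      · rw [map_add, coroot'_apply_of_mem_reflectionSubgroup hS hS' horth (longestElement_mem S) μ hiS,
          hμ i hiS, hν i hiS, add_zero]
    exact eq_neg_of_add_eq_zero_right h2
  · rintro rfl
    rw [map_neg, longestElement_apply_apply hS, map_neg]; abel

end Exchange

end SymPair

end

/-! ### The diagonal case -/

noncomputable section
namespace SymPair
set_option linter.unusedSectionVars false

open LieAlgebra.IsKilling (rootSystem)
open LieAlgebra (rootSpace)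

variable {L : Type*} [LieRing L] [LieAlgebra ℂ L] [FiniteDimensional ℂ L]
  [LieAlgebra.IsSemisimple ℂ L] {H : LieSubalgebra ℂ L} [H.IsCartanSubalgebra]
  {b : (rootSystem H).Base} {θ : L ≃ₗ⁅ℂ⁆ L}

/-- For a minimal ideal I and its preimage J under θ, both I + J and I ∩ J are stable under θ. The
sum is therefore everything. The intersection is zero in the diagonal case; otherwise I is
everything, and its minimality means that 𝔤 is simple. -/
theorem isSimple_or_isDiagonal (hθ : IsIrreduciblePair θ) :
    LieAlgebra.IsSimple ℂ L ∨ ∃ I J : LieIdeal ℂ L, IsDiagonal θ I J := by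
  have hnt : (⊤ : LieIdeal ℂ L) ≠ ⊥ := by
    intro h
    obtain ⟨x, hx⟩ := hθ.ne_id
    have h0 (y : L) : y = 0 := by
      have : y ∈ (⊤ : LieIdeal ℂ L) := LieSubmodule.mem_top y
      rwa [h, LieSubmodule.mem_bot] at this
    exact hx ((h0 _).trans (h0 _).symm)
  obtain ⟨I, hI, -⟩ := (IsAtomic.eq_bot_or_exists_atom_le (⊤ : LieIdeal ℂ L)).resolve_left hnt
  let J : LieIdeal ℂ L := LieIdeal.comap (θ : L →ₗ⁅ℂ⁆ L) I
  have hJ (x : L) : x ∈ J ↔ θ x ∈ I := Iff.rfl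
  have hsup : I ⊔ J = ⊤ := by
    refine (hθ.irreducible (I ⊔ J) fun x hx => ?_).resolve_left fun h =>
      hI.1 (le_bot_iff.1 (h ▸ le_sup_left))
    obtain ⟨y, hy, z, hz, rfl⟩ := (LieSubmodule.mem_sup _ _ _).1 hx
    rw [map_add, add_comm]
    exact (LieSubmodule.mem_sup _ _ _).2
      ⟨θ z, hz, θ y, by rw [hJ, hθ.involutive]; exact hy, rfl⟩
  rcases hθ.irreducible (I ⊓ J) (fun x hx => by
    rw [LieSubmodule.mem_inf] at hx ⊢
    exact ⟨hx.2, by rw [hJ, hθ.involutive]; exact hx.1⟩) with h | h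
  · exact Or.inr ⟨I, J, LieAlgebra.IsSemisimple.isSimple_of_isAtom I hI,
      ⟨disjoint_iff.2 h, codisjoint_iff.2 hsup⟩,
      fun x hx => by rw [hJ, hθ.involutive]; exact hx, fun x hx => hx⟩
  · have hIt : I = ⊤ := top_le_iff.1 (h ▸ inf_le_left)
    subst hIt
    refine Or.inl ⟨fun K => ?_, fun hab => ?_⟩
    · rcases eq_or_ne K ⊤ with h | h
      · exact Or.inr h
      · exact Or.inl (hI.2 K (lt_top_iff_ne_top.2 h))
    · refine LieAlgebra.IsSemisimple.non_abelian_of_isAtom _ hI ⟨fun x y => ?_⟩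
      exact Subtype.ext (hab.trivial (x : L) (y : L))

section Diagonal

variable {I J : LieIdeal ℂ L} (hc : IsCompl I J)

include hc

theorem eq_zero_of_isCompl {x : L} (hx : x ∈ I) (hx' : x ∈ J) : x = 0 := by
  have := disjoint_iff.1 hc.disjoint
  have h : x ∈ I ⊓ J := (LieSubmodule.mem_inf _ _ _).2 ⟨hx, hx'⟩
  rwa [this, LieSubmodule.mem_bot] at h

theorem mem_rootSet_or (k : H.root) : k ∈ I.rootSet ∨ k ∈ J.rootSet := by
  obtain ⟨x, hx, hx0⟩ := exists_mem_rootSpace_ne_zero k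
  have hxt : x ∈ I ⊔ J := by
    rw [codisjoint_iff.1 hc.codisjoint]; exact LieSubmodule.mem_top x
  obtain ⟨y, hy, z, hz, hyz⟩ := (LieSubmodule.mem_sup _ _ _).1 hxt
  have hyk (h : H) : ⁅(h : L), y⁆ = (k.1 : H → ℂ) h • y := by
    have h1 := LieAlgebra.IsKilling.lie_eq_smul_of_mem_rootSpace hx h
    rw [← hyz, lie_add, smul_add] at h1
    have h2 : ⁅(h : L), y⁆ - (k.1 : H → ℂ) h • y = (k.1 : H → ℂ) h • z - ⁅(h : L), z⁆ := by
      rw [sub_eq_sub_iff_add_eq_add]; exact h1.trans (add_comm _ _)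
    refine sub_eq_zero.1 (eq_zero_of_isCompl hc
      (sub_mem (lie_mem_right ℂ L I _ _ hy) (I.smul_mem _ hy)) ?_)
    rw [h2]
    exact sub_mem (J.smul_mem _ hz) (lie_mem_right ℂ L J _ _ hz)
  have hyr : y ∈ rootSpace H k.1 := mem_rootSpace_of_forall_lie hyk
  have hfin := LieAlgebra.IsKilling.finrank_rootSpace_eq_one k.1 (H.isNonZero_coe_root k)
  have key {v : L} (hv : v ∈ rootSpace H k.1) (hv0 : v ≠ 0) {I' : LieIdeal ℂ L} (hvI : v ∈ I') :
      k ∈ I'.rootSet := by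
    intro u hu
    obtain ⟨c, hc⟩ := (finrank_eq_one_iff_of_nonzero' (⟨v, hv⟩ : rootSpace H k.1)
      (by simpa [Subtype.ext_iff] using hv0)).1 hfin ⟨u, hu⟩
    have : u = c • v := (congrArg Subtype.val hc).symm
    rw [this]
    exact I'.smul_mem c hvI
  by_cases hy0 : y = 0
  · refine Or.inr (key hx hx0 ?_)
    rw [← hyz, hy0, zero_add]; exact hz
  · exact Or.inl (key hyr hy0 hy)

theorem notMem_rootSet {k : H.root} (hk : k ∈ I.rootSet) : k ∉ J.rootSet := by
  intro hk'
  obtain ⟨x, hx, hx0⟩ := exists_mem_rootSpace_ne_zero k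
  exact hx0 (eq_zero_of_isCompl hc (hk hx) (hk' hx))

theorem pairing_eq_zero_of_isCompl {i j : H.root} (hi : i ∈ I.rootSet) (hj : j ∈ J.rootSet) :
    (rootSystem H).pairing i j = 0 :=
  I.rootSet_apply_coroot_eq_zero_of_notMem_rootSet hi (fun h => notMem_rootSet hc h hj)

theorem mem_rootSet_of_bigTheta (hi : ∀ x, θ (θ x) = x) (hs : IsMaximallySplit b θ)
    (hmap : ∀ x ∈ I, θ x ∈ J) {i j : H.root} (hiI : i ∈ I.rootSet)
    (hij : bigTheta hs ((rootSystem H).root i) = (rootSystem H).root j) : j ∈ J.rootSet := by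
  refine (mem_rootSet_or hc j).resolve_left fun h => ?_
  obtain ⟨x, hx, hx0⟩ := exists_mem_rootSpace_ne_zero i
  have h1 := map_mem_rootSpace hi hs (mem_rootSpace_root.2 hx)
  rw [hij] at h1
  exact hx0 (θ.injective (by
    rw [map_zero]; exact eq_zero_of_isCompl hc (h h1) (hmap x (hiI hx))))

end Diagonal

theorem mem_rootSet_of_root_eq_neg {I : LieIdeal ℂ L} {i j : H.root} (hi : i ∈ I.rootSet)
    (h : (rootSystem H).root j = -(rootSystem H).root i) : j ∈ I.rootSet := by
  have : j = (rootSystem H).reflectionPerm i i := (rootSystem H).root.injective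
    (by rw [RootPairing.root_reflectionPerm, RootPairing.reflection_apply_self, h])
  rw [this]
  exact (I.reflectionPerm_mem_rootSet_iff i i).2 hi

section Values

variable {I J : LieIdeal ℂ L} (hd : IsDiagonal θ I J)
  (hi : ∀ x, θ (θ x) = x) (hs : IsMaximallySplit b θ)
include hd hi

/-- Θ maps roots of I to roots of J and conversely, so it fixes none. -/
theorem fixedSimpleRoots_eq_empty : fixedSimpleRoots hs = ∅ := by
  refine Set.eq_empty_of_forall_notMem fun i h => ?_
  rcases mem_rootSet_or hd.isCompl i with hI | hJ
  · exact notMem_rootSet hd.isCompl hI (mem_rootSet_of_bigTheta hd.isCompl hi hs hd.map_left hI h.2)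
  · exact notMem_rootSet hd.isCompl.symm hJ
      (mem_rootSet_of_bigTheta hd.isCompl.symm hi hs hd.map_right hJ h.2)

theorem isSplitInvolution_empty : IsSplitInvolution b (bigThetaEquiv hi hs) ∅ := by
  rw [← fixedSimpleRoots_eq_empty hd hi hs]
  exact isSplitInvolution hi hs

variable {τ : Equiv.Perm b.support}
  (hτ : ∀ i : b.support, diagramMap (rootSystem H) (bigThetaEquiv hi hs) ∅
    ((rootSystem H).root i) = (rootSystem H).root (τ i))
include hτ

omit hd in
theorem diagramPerm_mem_simpleRootsIn (hc : IsCompl I J) (hmap : ∀ x ∈ I, θ x ∈ J) (i : b.support)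
    (h : (i : H.root) ∈ simpleRootsIn b I) : (τ i : H.root) ∈ simpleRootsIn b J := by
  refine ⟨(τ i).2, ?_⟩
  obtain ⟨j, hj⟩ := exists_root_eq_neg (P := rootSystem H) (τ i)
  have h1 : bigTheta hs ((rootSystem H).root i) = (rootSystem H).root j := by
    rw [hj, ← hτ, diagramMap_empty, neg_neg]; rfl
  have h2 := mem_rootSet_of_bigTheta hc hi hs hmap h.2 h1
  exact mem_rootSet_of_root_eq_neg h2 (by rw [hj, neg_neg])

/-- The value of `μ - Θ ν` at the simple coroots. -/
theorem sub_bigTheta_apply (μ ν : Dual ℂ H) (i : b.support) :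
    (μ - bigTheta hs ν) ((rootSystem H).coroot i) =
      μ ((rootSystem H).coroot i) + ν ((rootSystem H).coroot (τ i)) := by
  have hT := isSplitInvolution_empty hd hi hs
  have h := hT.coroot'_diagramMap hτ (τ i) ν
  rw [hT.diagramPerm_diagramPerm hτ, diagramMap_empty] at h
  have h' : (-bigTheta hs ν) ((rootSystem H).coroot i) = ν ((rootSystem H).coroot (τ i)) := h
  rw [sub_eq_add_neg, LinearMap.add_apply, h']

theorem sub_bigTheta_mem {μ ν : Dual ℂ H} (hμ : μ ∈ dominantWeights b)
    (hν : ν ∈ dominantWeights b) : μ - bigTheta hs ν ∈ dominantWeights b := fun i hib => by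
  obtain ⟨k, hk⟩ := hμ i hib
  obtain ⟨m, hm⟩ := hν _ (τ ⟨i, hib⟩).2
  exact ⟨k + m, by rw [sub_bigTheta_apply hd hi hs hτ _ _ ⟨i, hib⟩, hk, hm, Nat.cast_add]⟩

/-- At the coroots of I the difference has the values of μ. At those of J it has the values of ν,
transported by τ. -/
theorem sub_bigTheta_injOn {μ ν μ' ν' : Dual ℂ H}
    (hμ : μ ∈ dominantWeightsOn b (simpleRootsIn b I))
    (hν : ν ∈ dominantWeightsOn b (simpleRootsIn b I))
    (hμ' : μ' ∈ dominantWeightsOn b (simpleRootsIn b I))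
    (hν' : ν' ∈ dominantWeightsOn b (simpleRootsIn b I))
    (heq : μ - bigTheta hs ν = μ' - bigTheta hs ν') : μ = μ' ∧ ν = ν' := by
  have hT := isSplitInvolution_empty hd hi hs
  have hv (i : b.support) : μ ((rootSystem H).coroot i) + ν ((rootSystem H).coroot (τ i)) =
      μ' ((rootSystem H).coroot i) + ν' ((rootSystem H).coroot (τ i)) := by
    rw [← sub_bigTheta_apply hd hi hs hτ, ← sub_bigTheta_apply hd hi hs hτ, heq]
  have hτI (i : b.support) (h : (i : H.root) ∈ simpleRootsIn b I) :
      (τ i : H.root) ∉ simpleRootsIn b I := fun h' => notMem_rootSet hd.isCompl h'.2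
    (diagramPerm_mem_simpleRootsIn hi hs hτ hd.isCompl hd.map_left i h).2
  refine ⟨ext_coroot' b fun i hib => ?_, ext_coroot' b fun i hib => ?_⟩
  · change μ ((rootSystem H).coroot i) = μ' ((rootSystem H).coroot i)
    by_cases hI : i ∈ simpleRootsIn b I
    · have h1 := hv ⟨i, hib⟩
      have hn := hτI ⟨i, hib⟩ hI
      rwa [hν.2 _ (τ ⟨i, hib⟩).2 hn, hν'.2 _ (τ ⟨i, hib⟩).2 hn, add_zero, add_zero] at h1
    · rw [hμ.2 i hib hI, hμ'.2 i hib hI]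
  · change ν ((rootSystem H).coroot i) = ν' ((rootSystem H).coroot i)
    by_cases hI : i ∈ simpleRootsIn b I
    · have h1 := hv (τ ⟨i, hib⟩)
      have hn := hτI ⟨i, hib⟩ hI
      rwa [hμ.2 _ (τ ⟨i, hib⟩).2 hn, hμ'.2 _ (τ ⟨i, hib⟩).2 hn, zero_add, zero_add,
        hT.diagramPerm_diagramPerm hτ] at h1
    · rw [hν.2 i hib hI, hν'.2 i hib hI]

omit hd hi hτ in
theorem exists_forall_coroot_eq (b : (rootSystem H).Base) (c : b.support → ℂ) :
    ∃ μ : Dual ℂ H, ∀ i : b.support, μ ((rootSystem H).coroot i) = c i :=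
  ⟨b.toCoweightBasis.constr ℂ c, fun i => by
    rw [← b.toCoweightBasis_apply, Basis.constr_basis]⟩

theorem exists_sub_bigTheta_eq {l : Dual ℂ H} (hl : l ∈ dominantWeights b) :
    ∃ μ ∈ dominantWeightsOn b (simpleRootsIn b I), ∃ ν ∈ dominantWeightsOn b (simpleRootsIn b I),
      μ - bigTheta hs ν = l := by
  classical
  have hT := isSplitInvolution_empty hd hi hs
  have key (c : b.support → ℂ) (hc : ∀ i, ∃ k : ℕ, c i = k) :
      ∃ μ ∈ dominantWeightsOn b (simpleRootsIn b I), ∀ i : b.support, μ ((rootSystem H).coroot i) =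
        if (i : H.root) ∈ simpleRootsIn b I then c i else 0 := by
    obtain ⟨μ, hμ⟩ := exists_forall_coroot_eq b fun i =>
      if (i : H.root) ∈ simpleRootsIn b I then c i else 0
    refine ⟨μ, ⟨fun i hib => ?_, fun i hib hn => (hμ ⟨i, hib⟩).trans (if_neg hn)⟩, hμ⟩
    rw [hμ ⟨i, hib⟩]
    split_ifs
    · exact hc _
    · exact ⟨0, by simp⟩
  obtain ⟨μ, hμd, hμ⟩ := key (fun i => l ((rootSystem H).coroot i)) fun i => hl i i.2
  obtain ⟨ν, hνd, hν⟩ := key (fun i => l ((rootSystem H).coroot (τ i))) fun i => hl _ (τ i).2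
  refine ⟨μ, hμd, ν, hνd, ext_coroot' b fun i hib => ?_⟩
  refine (sub_bigTheta_apply hd hi hs hτ μ ν ⟨i, hib⟩).trans ?_
  rw [hμ, hν, hT.diagramPerm_diagramPerm hτ]
  change _ = l ((rootSystem H).coroot i)
  rcases mem_rootSet_or hd.isCompl i with hI | hJ
  · have hI' : i ∈ simpleRootsIn b I := ⟨hib, hI⟩
    rw [if_pos hI', if_neg fun h => notMem_rootSet hd.isCompl h.2
      (diagramPerm_mem_simpleRootsIn hi hs hτ hd.isCompl hd.map_left ⟨i, hib⟩ hI').2, add_zero]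
  · have hJ' : i ∈ simpleRootsIn b J := ⟨hib, hJ⟩
    rw [if_neg fun h => notMem_rootSet hd.isCompl h.2 hJ, if_pos
      (diagramPerm_mem_simpleRootsIn hi hs hτ hd.isCompl.symm hd.map_right ⟨i, hib⟩ hJ'), zero_add]

theorem bijOn_dominantWeightsOn :
    Set.BijOn (fun μν : Dual ℂ H × Dual ℂ H => μν.1 - bigTheta hs μν.2)
      (dominantWeightsOn b (simpleRootsIn b I) ×ˢ dominantWeightsOn b (simpleRootsIn b I))
      (dominantWeights b) := by
  refine ⟨fun μν h => sub_bigTheta_mem hd hi hs hτ h.1.1 h.2.1, fun μν h μν' h' heq => ?_,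
    fun l hl => ?_⟩
  · obtain ⟨h1, h2⟩ := sub_bigTheta_injOn hd hi hs hτ h.1 h.2 h'.1 h'.2 heq
    exact Prod.ext h1 h2
  · obtain ⟨μ, hμ, ν, hν, rfl⟩ := exists_sub_bigTheta_eq hd hi hs hτ hl
    exact ⟨(μ, ν), ⟨hμ, hν⟩, rfl⟩

theorem PZB_of_isDiagonal {τ₀ : Equiv.Perm b.support}
    (hτ₀ : ∀ i : b.support, diagramMap (rootSystem H) (LinearEquiv.refl ℂ (Dual ℂ H)) b.support
      ((rootSystem H).root i) = (rootSystem H).root (τ₀ i)) :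
    PZB hs = (fun μν : Dual ℂ H × Dual ℂ H => μν.1 - bigTheta hs μν.2) ''
      {μν | μν.1 ∈ dominantWeightsOn b (simpleRootsIn b I) ∧
        μν.2 = -longestElement (rootSystem H) (simpleRootsIn b I) μν.1} := by
  have hT := isSplitInvolution_empty hd hi hs
  have hIJ := diagramPerm_mem_simpleRootsIn hi hs hτ hd.isCompl hd.map_left
  have hJI := diagramPerm_mem_simpleRootsIn hi hs hτ hd.isCompl.symm hd.map_right
  have hor (i : H.root) (hib : i ∈ b.support) : i ∈ simpleRootsIn b I ∨ i ∈ simpleRootsIn b J :=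
    (mem_rootSet_or hd.isCompl i).imp (fun h => ⟨hib, h⟩) fun h => ⟨hib, h⟩
  have hnot {i : H.root} (h : i ∈ simpleRootsIn b J) : i ∉ simpleRootsIn b I :=
    fun h' => notMem_rootSet hd.isCompl h'.2 h.2
  have hsub (I : LieIdeal ℂ L) : simpleRootsIn b I ⊆ b.support := fun _ h => h.1
  have horth : ∀ i ∈ simpleRootsIn b I, ∀ j ∈ simpleRootsIn b J, (rootSystem H).pairing i j = 0 :=
    fun i hi j hj => pairing_eq_zero_of_isCompl hd.isCompl hi.2 hj.2
  have hvan {μ : Dual ℂ H} (hμ : μ ∈ dominantWeightsOn b (simpleRootsIn b I)) :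
      ∀ i ∈ simpleRootsIn b J, (rootSystem H).coroot' i μ = 0 := fun i hi => hμ.2 i hi.1 (hnot hi)
  have hcond {μ ν : Dual ℂ H} (hμ : μ ∈ dominantWeightsOn b (simpleRootsIn b I))
      (hν : ν ∈ dominantWeightsOn b (simpleRootsIn b I)) :=
    hT.exchange_condition_iff hτ (hsub I) (hsub J) hor horth hIJ hJI (hvan hμ) (hvan hν)
  have hbij := bijOn_dominantWeightsOn hd hi hs hτ
  ext l
  constructor
  · rintro ⟨hl, hl'⟩
    obtain ⟨⟨μ, ν⟩, ⟨hμ, hν⟩, rfl⟩ := hbij.surjOn hl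
    refine ⟨(μ, ν), ⟨hμ, (hcond hμ hν).1 ?_⟩, rfl⟩
    rw [w₀', fixedSimpleRoots_eq_empty hd hi hs] at hl'
    exact hl'
  · rintro ⟨⟨μ, ν⟩, ⟨hμ, hν'⟩, rfl⟩
    simp only at hμ hν'
    have hν : ν ∈ dominantWeightsOn b (simpleRootsIn b I) := by
      refine ⟨fun i hib => ?_, fun i hib hn => ?_⟩
      -- On weights supported on I the elements w₀ and w₀¹ agree. So ν = −w₀μ, and −w₀ permutes the
      -- simple coroots and preserves dominance.
      · have h1 : ν = diagramMap (rootSystem H) (LinearEquiv.refl ℂ (Dual ℂ H)) b.support μ := by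
          rw [hν', ← longestElement_support_apply (hsub I) (hsub J) horth hor (hvan hμ),
            longestElement_support, neg_neg]
        obtain ⟨j, hj⟩ := τ₀.surjective ⟨i, hib⟩
        have h2 := (isSplitInvolution_refl b).coroot'_diagramMap hτ₀ j μ
        rw [hj, ← h1] at h2
        obtain ⟨k, hk⟩ := hμ.1 j j.2
        exact ⟨k, h2.trans hk⟩
      · have hJ := (hor i hib).resolve_left hn
        have h1 := coroot'_apply_of_mem_reflectionSubgroup (hsub I) (hsub J) horth
          (longestElement_mem _) μ hJ
        have h2 := hvan hμ i hJ
        change (rootSystem H).coroot' i ν = 0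
        rw [hν', map_neg, h1, h2, neg_zero]
    refine ⟨hbij.mapsTo ⟨hμ, hν⟩, ?_⟩
    rw [w₀', fixedSimpleRoots_eq_empty hd hi hs]
    exact (hcond hμ hν).2 hν'

end Values

end SymPair

end

open SymPair in
theorem proposition9p1 {L : Type*} [LieRing L] [LieAlgebra ℂ L] [FiniteDimensional ℂ L]
    [LieAlgebra.IsSemisimple ℂ L] {H : LieSubalgebra ℂ L} [H.IsCartanSubalgebra]
    (b : (LieAlgebra.IsKilling.rootSystem H).Base) (θ : L ≃ₗ⁅ℂ⁆ L)
    (hirr : IsIrreduciblePair θ) (hs : IsMaximallySplit b θ) :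
    -- the pairs treated below are all irreducible symmetric pairs
    ((LieAlgebra.IsSimple ℂ L ∧ IsInArakiList hs) ∨ ∃ I J : LieIdeal ℂ L, IsDiagonal θ I J) ∧
    -- the diagonal case; the second factor is identified with the first one through `-Θ`
    (∀ I J : LieIdeal ℂ L, IsDiagonal θ I J →
      Set.BijOn (fun μν : Dual ℂ H × Dual ℂ H => μν.1 - bigTheta hs μν.2)
        (dominantWeightsOn b (simpleRootsIn b I) ×ˢ dominantWeightsOn b (simpleRootsIn b I))
        (dominantWeights b) ∧
      PZB hs = (fun μν : Dual ℂ H × Dual ℂ H => μν.1 - bigTheta hs μν.2) ''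
        {μν | μν.1 ∈ dominantWeightsOn b (simpleRootsIn b I) ∧
          μν.2 = -longestElement (LieAlgebra.IsKilling.rootSystem H) (simpleRootsIn b I) μν.1}) ∧
    -- types `B`, `C`, `E₇`, `E₈`, `F₄`, `G₂`
    (IsTypeBCEFG b → PZB hs = dominantWeights b) ∧
    -- types with selfdual weights only
    ((∃ (n : ℕ) (e : Fin n ≃ b.support),
        IsAI hs e ∨ IsAII hs e ∨ IsDI₃ hs e ∨ IsDIII₁ hs e) ∨
      (∃ e : Fin 6 ≃ b.support, IsEI hs e ∨ IsEIV hs e) →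
      PZB hs = selfdualWeights b) ∧
    -- types `A`, `D`, `E₆` with all weights
    ((∃ (n : ℕ) (e : Fin n ≃ b.support),
        (∃ r, IsAIII hs e r) ∨ IsAIV hs e ∨ IsDIII₂ hs e) ∨
      (∃ e : Fin 6 ≃ b.support, IsEII hs e ∨ IsEIII hs e) →
      PZB hs = dominantWeights b) ∧
    -- types `DI`, case 1, and `DII`, where `r = 1` in type `DII`
    (∀ (n : ℕ) (e : Fin n ≃ b.support) (r : ℕ), (IsDI₁ hs e r ∨ (IsDII hs e ∧ r = 1)) →
      (Even r → PZB hs = dominantWeights b) ∧ (Odd r → PZB hs = evenSubmonoid e)) ∧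
    -- type `DI`, case 2
    (∀ (n : ℕ) (e : Fin n ≃ b.support), IsDI₂ hs e →
      (Odd n → PZB hs = dominantWeights b) ∧ (Even n → PZB hs = evenSubmonoid e)) := by
  have hi := hirr.involutive
  obtain ⟨τ, hτ⟩ := (isSplitInvolution hi hs).exists_diagramPerm
  obtain ⟨τ₀, hτ₀⟩ := (isSplitInvolution_refl b).exists_diagramPerm
  refine ⟨?_, fun I J hd => ?_, PZB_of_isTypeBCEFG hi hs hτ hτ₀, ?_, ?_, ?_,
    fun n e h => PZB_of_isDI₂ hi hs hτ hτ₀ h⟩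
  · rcases isSimple_or_isDiagonal hirr with h | h
    · exact Or.inl ⟨h, isInArakiList hi hs hirr.ne_id⟩
    · exact Or.inr h
  · obtain ⟨σ, hσ⟩ := (isSplitInvolution_empty hd hi hs).exists_diagramPerm
    exact ⟨bijOn_dominantWeightsOn hd hi hs hσ, PZB_of_isDiagonal hd hi hs hσ hτ₀⟩
  · rintro (⟨n, e, h | h | h | h⟩ | ⟨e, h | h⟩)
    · exact PZB_of_isAI hi hs hτ h
    · exact PZB_of_isAII hi hs hτ h
    · exact PZB_of_isDI₃ hi hs hτ h
    · exact PZB_of_isDIII₁ hi hs hτ h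
    · exact PZB_of_isEI hi hs hτ h
    · exact PZB_of_isEIV hi hs hτ h
  · rintro (⟨n, e, ⟨r, h⟩ | h | h⟩ | ⟨e, h | h⟩)
    · exact PZB_of_isAIII hi hs hτ hτ₀ h
    · exact PZB_of_isAIV hi hs hτ hτ₀ h
    · exact PZB_of_isDIII₂ hi hs hτ hτ₀ h
    · exact PZB_eq_dominantWeights_of_E₆ hi hs hτ hτ₀ h.1 (Set.notMem_empty _) h.2
    · exact PZB_eq_dominantWeights_of_E₆ hi hs hτ hτ₀ h.1 (by decide) h.2
  · rintro n e r (⟨hn, hr, hrn, he, h⟩ | ⟨⟨hn, he, h⟩, rfl⟩)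
    · exact PZB_of_black_tail hi hs hτ hτ₀ hn (by omega) hrn he h
    · exact PZB_of_black_tail hi hs hτ hτ₀ hn le_rfl (by omega) he h
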